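/- For a half-integer $j\ge 0$ let $\mathcal H_j$ be the spin-$j$ representation of $SU(2)$ (symmetric tensors with $2j$ spinor indices), and let $\mathcal H_{(j,j)}=\mathcal H_j\otimes\mathcal H_j$ be the simple representation of $SO(4)=(SU(2)_+\times SU(2)_-)/\mathbb Z_2$. Let $\mathcal H_{2j}\subset\mathcal H_{(j,j)}$ be the highest-spin subspace under the diagonal $SU(2)$. **Intertwiners.** For half-integers $j_1,\dots,j_4\ge0$ put $\mathcal K^{SO(4)}=\mathrm{Inv}_{SO(4)}\big(\bigotimes_a\mathcal H_{(j_a,j_a)}\big)$ and $\mathcal K_{SO(3)}=\mathrm{Inv}_{SU(2)}\big(\bigotimes_a\mathcal H_{2j_a}\big)$. Let $\mathcal K_{ph}\subset\mathcal K^{SO(4)}$ be the image of $\mathcal H_{2j_1}\otimes\cdots\otimes\mathcal H_{2j_4}$ under the orthogonal projection onto $\mathcal K^{SO(4)}$. For $i\in\mathcal K_{SO(3)}$ let $f(i)=\int_{SO(4)}dV\,\big(\bigotimes_a D^{(j_a,j_a)}(V)\big)\,i$ (normalised Haar measure), and let $\pi:\mathcal K^{SO(4)}\to\mathcal K_{SO(3)}$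 be the orthogonal projection. Then $f(i)$ is the orthogonal projection of $i$ onto $\mathcal K^{SO(4)}$, and $f$ and $\pi$ are adjoint to each other. If $j_1+j_2+j_3+j_4\in\mathbb Z$, then $f:\mathcal K_{SO(3)}\to\mathcal K_{ph}$ and $\pi|_{\mathcal K_{ph}}:\mathcal K_{ph}\to\mathcal K_{SO(3)}$ are linear isomorphisms. **Boundary states.** Let $\Gamma$ be a finite oriented four-valent graph with links $l$ and nodes $n$. For a labelling $j$ of the links by half-integers, and tensors $I_n$ in the tensor product of the four $\mathcal H_{(j_l,j_l)}$ with $l$ at $n$, let $|j,I\rangle_4\in L^2(SO(4)^L)$ be the function $\big(\bigotimes_l D^{(j_l,j_l)}(g_l^+,g_l^-)\big)\cdot\big(\bigotimes_n I_n\big)$ multiplied by $\prod_l(2j_l+1)$. For $i_n\in\mathcal K_{SO(3)}$ at every node let $|2j,i\rangle_3\in L^2(SU(2)^L)$ be the function $\big(\bigotimes_l D^{(2j_l)}(g_l)\big)\cdot\big(\bigotimes_n i_n\big)$ multiplied by $\prod_l\sqrt{4j_l+1}$. (The contraction pattern is that of $\Gamma$; indices are lowered with the invariant spinor $\epsilon$.)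 Let $\mathcal H_{SO(3)}$ be the closed span of all the $|2j,i\rangle_3$, and let $\mathcal H_{ph}$ be the closed span of all the $|j,I\rangle_4$ with $I_n\in\mathcal K_{ph}$ at every node. Call $j$ admissible if the sum of the four spins at each node is an integer, and let $\mathcal H_{SO(3)}^{adm}\subset\mathcal H_{SO(3)}$ be the closed span of the $|2j,i\rangle_3$ with $j$ admissible. Then: 1. Applying $f$ at every node is group averaging at every node: $$\Big(\bigotimes_l D^{(j_l,j_l)}(g_l^+,g_l^-)\Big)\cdot\Big(\bigotimes_n f(i_n)\Big)=\int_{SO(4)^N}\prod_n dV_n\Big(\bigotimes_l D^{(j_l,j_l)}\big(V_{s(l)}(g^+_l,g^-_l)V_{t(l)}^{-1}\big)\Big)\cdot\Big(\bigotimes_n i_n\Big).$$ 2. There is a bounded linear map $F:\mathcal H_{SO(3)}\to L^2(SO(4)^L)$ with $F|2j,(i_n)\rangle_3=|j,(f(i_n))\rangle_4$, whose adjoint satisfies $F^\dagger|j,(I_n)\rangle_4=|2j,(\pi(I_n))\rangle_3$ for all $I_n\in\mathcal K^{SO(4)}$. 3. $F$ vanishes on the spin networks whose labels are not admissible. It restricts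 to a linear isomorphism from the (algebraic) span of the $|2j,i\rangle_3$ with $j$ admissible onto the span of the $|j,I\rangle_4$ with $I_n\in\mathcal K_{ph}$. It is injective on $\mathcal H_{SO(3)}^{adm}$, and the closure of its range is $\mathcal H_{ph}$. 4. There is a unitary map $\mathcal H_{SO(3)}^{adm}\to\mathcal H_{ph}$ which, for every admissible $j$, maps the span of the $|2j,i\rangle_3$ onto the span of the $|j,I\rangle_4$ with $I_n\in\mathcal K_{ph}$. -/

import Mathlib

open MeasureTheory

noncomputable section

namespace EPR

/-! ### The groups -/

/-- `SU(2)`. -/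
abbrev SU2 : Type := Matrix.specialUnitaryGroup (Fin 2) ℂ

instance : SecondCountableTopology SU2 :=
  haveI : SecondCountableTopology (Matrix (Fin 2) (Fin 2) ℂ) :=
    inferInstanceAs (SecondCountableTopology (Fin 2 → Fin 2 → ℂ))
  TopologicalSpace.Subtype.secondCountableTopology _

instance : IsTopologicalGroup SU2 where
  continuous_mul := by
    refine Continuous.subtype_mk ?_ _
    exact (continuous_subtype_val.comp continuous_fst).matrix_mul
      (continuous_subtype_val.comp continuous_snd)
  continuous_inv := by
    refine Continuous.subtype_mk ?_ _
    exact continuous_subtype_val.matrix_conjTranspose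

instance : CompactSpace SU2 := by
  refine isCompact_iff_compactSpace.mp ?_
  have hcl : IsClosed {A : Matrix (Fin 2) (Fin 2) ℂ | A * star A = 1 ∧ A.det = 1} := by
    refine IsClosed.inter (isClosed_eq ?_ continuous_const) (isClosed_eq ?_ continuous_const)
    · exact continuous_id.matrix_mul continuous_id.matrix_conjTranspose
    · exact continuous_id.matrix_det
  have hset : ((Matrix.specialUnitaryGroup (Fin 2) ℂ : Set (Matrix (Fin 2) (Fin 2) ℂ)))
      = {A | A * star A = 1 ∧ A.det = 1} := by
    ext A
    simp [Matrix.mem_specialUnitaryGroup_iff, Matrix.mem_unitaryGroup_iff]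
  have hbox : IsCompact (Set.univ.pi fun _ : Fin 2 => Set.univ.pi fun _ : Fin 2 =>
      Metric.closedBall (0 : ℂ) 1) :=
    isCompact_univ_pi fun _ => isCompact_univ_pi fun _ => isCompact_closedBall _ _
  refine IsCompact.of_isClosed_subset hbox (hset ▸ hcl) ?_
  intro A hA i _ j _
  simpa using entry_norm_bound_of_unitary
    (Matrix.specialUnitaryGroup_le_unitaryGroup hA) i j

instance : MeasurableSpace SU2 := borel SU2

instance : BorelSpace SU2 := ⟨rfl⟩

/-- Normalised Haar measure on `SU(2)`. -/
def haarSU2 : Measure SU2 := Measure.haarMeasure ⊤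

instance : haarSU2.IsHaarMeasure := by unfold haarSU2; infer_instance

instance : IsProbabilityMeasure haarSU2 :=
  ⟨by simpa [haarSU2] using Measure.haarMeasure_self (K₀ := (⊤ : TopologicalSpace.PositiveCompacts SU2))⟩

/-- `Spin(4) = SU(2)₊ × SU(2)₋`, the double cover of `SO(4)`; an element of `SO(4)` is written
`(g₊, g₋)`, defined up to a common sign.  All the representations used below are simple,
`(j, j)`, hence representations of `SO(4)`, and all functions used below are invariant under
`(g₊, g₋) ↦ (-g₊, -g₋)`, i.e. are functions on copies of `SO(4)`. Integration over `SO(4)` is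
integration of the lifted function over `Spin(4)`. -/
abbrev Spin4 : Type := SU2 × SU2

/-- Normalised Haar measure on `Spin(4)`. -/
abbrev haarSpin4 : Measure Spin4 := haarSU2.prod haarSU2

/-- The diagonal embedding `g ↦ (g, g)` of the subgroup fixing the chosen normal vector. -/
def diag (g : SU2) : Spin4 := (g, g)

/-- The `SU(2)` element by which `(g₊, g₋)` acts on an unprimed (self-dual, `true`) or on a
primed (anti-self-dual, `false`) spinor index. -/
def chiral (V : Spin4) : Bool → SU2
  | true => V.1
  | false => V.2

theorem continuous_chiral {L : Type*} (l : L) (b : Bool) :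
    Continuous fun G : L → Spin4 => (chiral (G l) b : Matrix (Fin 2) (Fin 2) ℂ) := by
  cases b
  · exact continuous_subtype_val.comp (continuous_snd.comp (continuous_apply l))
  · exact continuous_subtype_val.comp (continuous_fst.comp (continuous_apply l))

/-! ### Spinor tensors and representation spaces -/

/-- Tensors over `ℂ²` with one spinor index `0, 1` for each element of `ι`, with the standard
hermitian inner product of `(ℂ²)^{⊗ ι}`. -/
abbrev Spinors (ι : Type*) [Fintype ι] [DecidableEq ι] : Type _ :=
  EuclideanSpace ℂ (ι → Fin 2)

/-- The action of `⊗ᵢ hᵢ` on `(ℂ²)^{⊗ ι}`. -/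
def act {ι : Type*} [Fintype ι] [DecidableEq ι] (h : ι → SU2) : Spinors ι →ₗ[ℂ] Spinors ι :=
  Matrix.toEuclideanLin
    (Matrix.of fun A B : ι → Fin 2 => ∏ x, (h x : Matrix (Fin 2) (Fin 2) ℂ) (A x) (B x))

/-- The tensors that are symmetric in each of the groups of indices given by the fibres of `p`.
As spin-`s` representations are the symmetric tensors with `2 s` spinor indices, this is the
tensor product, over the fibres of `p`, of the spin `s = (size of the fibre) / 2`
representations. -/
def symTensors {ι κ : Type*} [Fintype ι] [DecidableEq ι] (p : ι → κ) :
    Submodule ℂ (Spinors ι) where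
  carrier := {t | ∀ σ : Equiv.Perm ι, (∀ x, p (σ x) = p x) →
    ∀ A : ι → Fin 2, t (fun x => A (σ x)) = t A}
  add_mem' := by
    intro s t hs ht σ hσ A
    simp [hs σ hσ A, ht σ hσ A]
  zero_mem' := by
    intro σ _ A
    simp
  smul_mem' := by
    intro c t ht σ hσ A
    simp [ht σ hσ A]

/-- The spinor indices of a node with four links of spins `(j_a, j_a)`, where `m a = 2 j_a`:
on each link `a`, there are `2 j_a` unprimed (`true`) and `2 j_a` primed (`false`) indices. -/
abbrev Slot (m : Fin 4 → ℕ) : Type := (a : Fin 4) × (Bool × Fin (m a))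

/-- `H_{(j_1,j_1)} ⊗ ⋯ ⊗ H_{(j_4,j_4)}`, with `H_{(j,j)} = H_j ⊗ H_j` and `m a = 2 j_a`: on
each link, symmetric separately in the unprimed and in the primed indices. -/
def simpleSpace (m : Fin 4 → ℕ) : Submodule ℂ (Spinors (Slot m)) :=
  symTensors fun s : Slot m => (s.1, s.2.1)

/-- The subspace `H_{2j_1} ⊗ ⋯ ⊗ H_{2j_4}`, where `H_{2j} ⊆ H_j ⊗ H_j` is the highest-spin term
`2j` of the Clebsch-Gordan decomposition: on each link, symmetric in all `4 j_a` indices. -/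
def topSpace (m : Fin 4 → ℕ) : Submodule ℂ (Spinors (Slot m)) :=
  symTensors fun s : Slot m => s.1

/-- The action of `(g₊, g₋)` on the tensors at a node. -/
def spinAct {m : Fin 4 → ℕ} (V : Spin4) : Spinors (Slot m) →ₗ[ℂ] Spinors (Slot m) :=
  act fun s : Slot m => chiral V s.2.1

/-- The `SO(4)` intertwiners `Inv(H_{(j_1,j_1)} ⊗ ⋯ ⊗ H_{(j_4,j_4)})`. -/
def invSO4 (m : Fin 4 → ℕ) : Submodule ℂ (Spinors (Slot m)) :=
  simpleSpace m ⊓ ⨅ V : Spin4, LinearMap.eqLocus (spinAct V) LinearMap.id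

/-- The `SO(3)` intertwiners `Inv_{SU(2)}(H_{2j_1} ⊗ ⋯ ⊗ H_{2j_4})`, for the diagonal `SU(2)`. -/
def invSO3 (m : Fin 4 → ℕ) : Submodule ℂ (Spinors (Slot m)) :=
  topSpace m ⊓ ⨅ g : SU2, LinearMap.eqLocus (spinAct (diag g)) LinearMap.id

/-- `K_ph`: the orthogonal projection of `H_{2j_1} ⊗ ⋯ ⊗ H_{2j_4}` to the `SO(4)`
intertwiners. -/
def Kph (m : Fin 4 → ℕ) : Submodule ℂ (Spinors (Slot m)) :=
  (topSpace m).map ((invSO4 m).starProjection : Spinors (Slot m) →ₗ[ℂ] Spinors (Slot m))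

/-- The embedding `f`: read an `SO(3)` intertwiner as a tensor in
`H_{(j_1,j_1)} ⊗ ⋯ ⊗ H_{(j_4,j_4)}` and average over the group. -/
def fEmb {m : Fin 4 → ℕ} (i : Spinors (Slot m)) : Spinors (Slot m) :=
  ∫ V : Spin4, spinAct V i ∂haarSpin4

/-- The projection `π`: orthogonal projection to the `SO(3)` intertwiners. -/
def piProj {m : Fin 4 → ℕ} (I : Spinors (Slot m)) : Spinors (Slot m) :=
  (invSO3 m).starProjection I

/-! ### Spin networks -/

/-- An oriented four-valent graph with nodes `N` and links `L` (several links between two nodes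
and links from a node to itself are allowed): the half-links, `(l, false)` at the source and
`(l, true)` at the target of `l`, are distributed over the four legs of the nodes. -/
structure FourValentGraph (N L : Type*) where
  leg : L × Bool ≃ N × Fin 4

namespace FourValentGraph

variable {N L : Type*} (Γ : FourValentGraph N L)

/-- The source node of a link. -/
def source (l : L) : N := (Γ.leg (l, false)).1

/-- The target node of a link. -/
def target (l : L) : N := (Γ.leg (l, true)).1

/-- The labels of the four links at the node `n`. -/
abbrev atNode (k : L → ℕ) (n : N) : Fin 4 → ℕ := fun a => k (Γ.leg.symm (n, a)).1

/-- The labels `k l = 2 j_l` for which the sum of the spins `j_l` is an integer at every node. -/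
def Admissible (k : L → ℕ) : Prop := ∀ n, Even (∑ a, Γ.atNode k n a)

end FourValentGraph

/-- The invariant antisymmetric spinor. -/
def epsilon : Matrix (Fin 2) (Fin 2) ℂ := !![0, 1; -1, 0]

section Networks

variable {N L : Type*} [Fintype N] [Fintype L] [DecidableEq L] (Γ : FourValentGraph N L)

/-- The contraction `(⊗_l D^{(j_l,j_l)}(g_l⁺,g_l⁻)) · (⊗_n i_n)`, for `k l = 2 j_l`, as a function
of the group elements.  The representation matrices are written in spinor indices, and the index
at the source of a link is lowered with `ε`, so that the tensors at all nodes have upper indices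
only. -/
def contraction (k : L → ℕ) (i : ∀ n, Spinors (Slot (Γ.atNode k n))) (G : L → Spin4) : ℂ :=
  ∑ A : (h : L × Bool) → (Bool × Fin (k h.1) → Fin 2),
    (∏ l, ∏ s : Bool × Fin (k l),
      (epsilon * (chiral (G l) s.1 : Matrix (Fin 2) (Fin 2) ℂ)) (A (l, false) s) (A (l, true) s)) *
    ∏ n, i n (fun s => A (Γ.leg.symm (n, s.1)) s.2)

/-- The contraction `(⊗_l D^{(2j_l)}(g_l)) · (⊗_n i_n)`, as a function on `SU(2)^L`. It is the
same as the contraction for `(j_l, j_l)` at diagonal group elements, since `D^{(2j)}(g)` is the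
restriction of `D^{(j,j)}(g,g)` to the symmetric tensors. -/
def contraction₃ (k : L → ℕ) (i : ∀ n, Spinors (Slot (Γ.atNode k n))) (g : L → SU2) : ℂ :=
  contraction Γ k i fun l => diag (g l)

theorem continuous_contraction (k : L → ℕ) (i : ∀ n, Spinors (Slot (Γ.atNode k n))) :
    Continuous (contraction Γ k i) := by
  unfold contraction
  refine continuous_finsetSum _ fun A _ => Continuous.mul ?_ continuous_const
  refine continuous_finsetProd _ fun l _ => continuous_finsetProd _ fun s _ => ?_
  exact (continuous_const.matrix_mul (continuous_chiral l s.1)).matrix_elem _ _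

theorem continuous_contraction₃ (k : L → ℕ) (i : ∀ n, Spinors (Slot (Γ.atNode k n))) :
    Continuous (contraction₃ Γ k i) :=
  (continuous_contraction Γ k i).comp
    (continuous_pi fun l => (continuous_apply l).prodMk (continuous_apply l))

variable (L) in
/-- `L²(SU(2)^L)`. -/
abbrev L2SO3 : Type _ := Lp ℂ 2 (Measure.pi fun _ : L => haarSU2)

variable (L) in
/-- `L²(Spin(4)^L)`. -/
abbrev L2SO4 : Type _ := Lp ℂ 2 (Measure.pi fun _ : L => haarSpin4)

/-- The normalised `SO(3)` spin-network state `|2j_l, i_n⟩`, with `k l = 2 j_l`; each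
representation matrix is multiplied by the square root of the dimension `2 k l + 1`. -/
def ket₃ (k : L → ℕ) (i : ∀ n, Spinors (Slot (Γ.atNode k n))) : L2SO3 L :=
  (∏ l, (√(2 * k l + 1) : ℂ)) • ContinuousMap.toLp 2 _ ℂ ⟨_, continuous_contraction₃ Γ k i⟩

/-- The normalised `SO(4)` spin-network state with simple representations `(j_l, j_l)`, where
`k l = 2 j_l`, and with tensors `I_n` at the nodes; each representation matrix is multiplied by
the square root of the dimension `(k l + 1) ^ 2`. -/
def ket₄ (k : L → ℕ) (I : ∀ n, Spinors (Slot (Γ.atNode k n))) : L2SO4 L :=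
  (∏ l, (√((k l + 1) ^ 2) : ℂ)) • ContinuousMap.toLp 2 _ ℂ ⟨_, continuous_contraction Γ k I⟩

/-- The span of the `SO(3)` spin networks with link spins `k l`. -/
def sector₃ (k : L → ℕ) : Submodule ℂ (L2SO3 L) :=
  Submodule.span ℂ {ψ | ∃ i : ∀ n, Spinors (Slot (Γ.atNode k n)),
    (∀ n, i n ∈ invSO3 (Γ.atNode k n)) ∧ ψ = ket₃ Γ k i}

/-- The span of the `SO(4)` spin networks with link representations `(k l / 2, k l / 2)` and with
intertwiners in `K_ph`. -/
def sectorPh (k : L → ℕ) : Submodule ℂ (L2SO4 L) :=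
  Submodule.span ℂ {ψ | ∃ I : ∀ n, Spinors (Slot (Γ.atNode k n)),
    (∀ n, I n ∈ Kph (Γ.atNode k n)) ∧ ψ = ket₄ Γ k I}

/-- The span of all the `SO(3)` spin networks. -/
def span₃ : Submodule ℂ (L2SO3 L) := ⨆ k : L → ℕ, sector₃ Γ k

/-- The span of the `SO(3)` spin networks with admissible spins. -/
def spanAdm : Submodule ℂ (L2SO3 L) := ⨆ k : {k : L → ℕ // Γ.Admissible k}, sector₃ Γ k.1

/-- The span of the `SO(4)` spin networks with simple representations on the links and with
intertwiners in `K_ph` at the nodes. -/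
def spanPh : Submodule ℂ (L2SO4 L) := ⨆ k : L → ℕ, sectorPh Γ k

/-- `H_{SO(3)}`, the Hilbert space of the `SO(3)` spin networks on the graph. -/
abbrev HSO3 : Submodule ℂ (L2SO3 L) := (span₃ Γ).topologicalClosure

theorem ket₃_mem (k : L → ℕ) (i : ∀ n, Spinors (Slot (Γ.atNode k n)))
    (hi : ∀ n, i n ∈ invSO3 (Γ.atNode k n)) : ket₃ Γ k i ∈ HSO3 Γ :=
  Submodule.le_topologicalClosure _
    (Submodule.mem_iSup_of_mem k (Submodule.subset_span ⟨i, hi, rfl⟩))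

/-- The Hilbert space of the `SO(3)` spin networks with admissible spins. -/
abbrev HAdm : Submodule ℂ (L2SO3 L) := (spanAdm Γ).topologicalClosure

/-- `H_ph`, as a Hilbert space. -/
abbrev Hph : Submodule ℂ (L2SO4 L) := (spanPh Γ).topologicalClosure

end Networks

end EPR

end

/-! At one node, the group average `fEmb` is the orthogonal projection to the `SO(4)` invariants, so
it is adjoint to `piProj`, and a short orthogonality argument shows that it maps `invSO3` onto `Kph`
(`exists_fEmb_eq`). What remains is injectivity (`eq_zero_of_inner_invSO4`): if the spins sum to an
integer, an `SO(3)` intertwiner orthogonal to all `SO(4)` intertwiners is zero.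

An `SU(2)`-invariant tensor is determined by its full contractions with ε along perfect matchings of
its indices (`IsInvariant.eq_zero_of_fullContraction`). If a matching never pairs a primed with an
unprimed index, the contraction is an inner product with an `SO(4)` invariant and vanishes by
assumption. All other matchings reduce to these (`fullContraction_eq_zero_of_split`). A pair inside
one leg contracts symmetric indices and gives zero. Place the four legs at the corners of a square:
the Plücker relation trades one pair on each diagonal for two pairs on sides, until one diagonal is
free of pairs. For such a matching, integrality of the spin sum is what permits choosing a set of
pairs that covers exactly half of each leg (`exists_half`), and the symmetry within each leg lets
this half be renamed as the unprimed one.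

On a graph, Schur orthogonality, deduced from the same contraction criterion (`sum_linkKernel`),
turns inner products of spin networks into products of inner products at the nodes (`inner_ket₃`,
`inner_ket₄`). Cauchy-Schwarz then makes `F` a contraction, and its adjoint is `π` at the nodes. `F`
is injective on the admissible part because the adjoint reaches every admissible spin network. At a
node with half-integral spin sum, `(-1, 1)` acts by `-1` and no invariants exist. The unitary map is
not `F`: `F` only shows that corresponding sectors have equal finite dimension, and orthonormal
bases of these mutually orthogonal sectors are then matched. -/

noncomputable section

namespace EPR

open scoped ComplexConjugate

/-! ### Tensor products of `2 × 2` matrices -/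

section Kronecker

variable {ι κ : Type*} [Fintype ι] [Fintype κ]

/-- The matrix of `⊗ₓ h x` on `(ℂ²)^{⊗ ι}`. -/
def piKron (h : ι → Matrix (Fin 2) (Fin 2) ℂ) : Matrix (ι → Fin 2) (ι → Fin 2) ℂ :=
  Matrix.of fun A B => ∏ x, h x (A x) (B x)

theorem piKron_apply (h : ι → Matrix (Fin 2) (Fin 2) ℂ) (A B : ι → Fin 2) :
    piKron h A B = ∏ x, h x (A x) (B x) := rfl

theorem piKron_mul [DecidableEq ι] (h h' : ι → Matrix (Fin 2) (Fin 2) ℂ) :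
    piKron (fun x => h x * h' x) = piKron h * piKron h' := by
  ext A B
  simp only [piKron_apply, Matrix.mul_apply, Fintype.prod_sum, Finset.prod_mul_distrib]

theorem piKron_one [DecidableEq ι] : piKron (fun _ : ι => 1) = 1 := by
  ext A B
  simp only [piKron_apply, Matrix.one_apply, Finset.prod_ite_zero, Finset.prod_const_one,
    Finset.mem_univ, true_implies, funext_iff]

theorem piKron_smul (c : ι → ℂ) (h : ι → Matrix (Fin 2) (Fin 2) ℂ) :
    piKron (fun x => c x • h x) = (∏ x, c x) • piKron h := by
  ext A B
  simp [piKron_apply, Finset.prod_mul_distrib]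

theorem piKron_conjTranspose (h : ι → Matrix (Fin 2) (Fin 2) ℂ) :
    (piKron h).conjTranspose = piKron fun x => (h x).conjTranspose := by
  ext A B
  simp [piKron_apply, Matrix.conjTranspose_apply]

theorem piKron_comp (h : κ → Matrix (Fin 2) (Fin 2) ℂ) (σ : ι ≃ κ) (A B : κ → Fin 2) :
    piKron (fun x => h (σ x)) (fun x => A (σ x)) (fun x => B (σ x)) = piKron h A B := by
  simp only [piKron_apply]
  exact σ.prod_comp fun x => h x (A x) (B x)

theorem conj_piKron (h : ι → Matrix (Fin 2) (Fin 2) ℂ) (A B : ι → Fin 2) :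
    conj (piKron h A B) = piKron (fun x => (h x).map conj) A B := by
  simp [piKron_apply]

end Kronecker

theorem sum_comp_equiv {ι κ : Type*} [Fintype ι] [Fintype κ] [DecidableEq ι] [DecidableEq κ]
    (σ : ι ≃ κ) (F : (ι → Fin 2) → ℂ) :
    ∑ A : κ → Fin 2, F (fun x => A (σ x)) = ∑ A : ι → Fin 2, F A :=
  Fintype.sum_equiv (σ.symm.arrowCongr (Equiv.refl (Fin 2))) _ _ fun A => by
    congr 1

/-! ### The action of `SU(2)` on spinor tensors -/

section Act

variable {ι : Type*} [Fintype ι] [DecidableEq ι]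

theorem act_apply (h : ι → SU2) (t : Spinors ι) (A : ι → Fin 2) :
    act h t A = ∑ B, piKron (fun x => (h x : Matrix (Fin 2) (Fin 2) ℂ)) A B * t B := by
  simp only [act, Matrix.toLpLin_apply, Matrix.mulVec, dotProduct]
  rfl

theorem act_mul (h h' : ι → SU2) (t : Spinors ι) :
    act (fun x => h x * h' x) t = act h (act h' t) := by
  have : piKron (fun x => ((h x * h' x : SU2) : Matrix (Fin 2) (Fin 2) ℂ)) =
      piKron (fun x => (h x : Matrix (Fin 2) (Fin 2) ℂ)) *
        piKron (fun x => (h' x : Matrix (Fin 2) (Fin 2) ℂ)) := by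
    rw [← piKron_mul]; rfl
  ext A
  simp only [act_apply, this, Matrix.mul_apply, Finset.sum_mul, Finset.mul_sum]
  rw [Finset.sum_comm]
  simp only [mul_assoc]

theorem act_one (t : Spinors ι) : act (fun _ => 1) t = t := by
  ext A
  have : piKron (fun _ : ι => ((1 : SU2) : Matrix (Fin 2) (Fin 2) ℂ)) = 1 := piKron_one
  rw [act_apply, this]
  simp [Matrix.one_apply]

theorem inner_act_left (h : ι → SU2) (s t : Spinors ι) :
    inner ℂ (act h s) t = inner ℂ s (act (fun x => (h x)⁻¹) t) := by
  have key : piKron (fun x => (((h x)⁻¹ : SU2) : Matrix (Fin 2) (Fin 2) ℂ)) =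
      (piKron fun x => (h x : Matrix (Fin 2) (Fin 2) ℂ)).conjTranspose := by
    rw [piKron_conjTranspose]; rfl
  simp only [PiLp.inner_apply, act_apply, RCLike.inner_apply, key, Matrix.conjTranspose_apply,
    map_sum, map_mul, Finset.mul_sum, Finset.sum_mul]
  rw [Finset.sum_comm]
  refine Finset.sum_congr rfl fun A _ => Finset.sum_congr rfl fun B _ => ?_
  simp only [RCLike.star_def]
  ring

/-- Equal operators sit on the indices of one fibre, so the action commutes with every permutation
preserving the fibres. -/
theorem act_mem_symTensors {κ : Type*} {p : ι → κ} (h : ι → SU2)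
    (hp : ∀ x y, p x = p y → h x = h y) {t : Spinors ι} (ht : t ∈ symTensors p) :
    act h t ∈ symTensors p := by
  intro σ hσ A
  rw [act_apply, act_apply, ← sum_comp_equiv σ]
  refine Finset.sum_congr rfl fun B _ => ?_
  rw [ht σ hσ B, ← piKron_comp _ σ A B]
  congr 3
  funext x
  rw [hp _ _ (hσ x)]

theorem continuous_act {X : Type*} [TopologicalSpace X] {h : X → ι → SU2}
    (hh : ∀ x, Continuous fun v => h v x) (t : Spinors ι) : Continuous fun v => act (h v) t := by
  refine (PiLp.continuous_toLp 2 _).comp (continuous_pi fun A => ?_) |>.congr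
    fun v => (?_ : WithLp.toLp 2 (fun A => act (h v) t A) = _)
  · simp only [act_apply, piKron_apply]
    refine continuous_finsetSum _ fun B _ => Continuous.mul ?_ continuous_const
    refine continuous_finsetProd _ fun x _ => ?_
    exact (continuous_subtype_val.comp (hh x)).matrix_elem _ _
  · rfl

end Act

/-! ### The group average at a node -/

section Node

variable {m : Fin 4 → ℕ}

theorem chiral_mul (V W : Spin4) (b : Bool) : chiral (V * W) b = chiral V b * chiral W b := by
  cases b <;> rfl

theorem chiral_inv (V : Spin4) (b : Bool) : chiral V⁻¹ b = (chiral V b)⁻¹ := by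
  cases b <;> rfl

theorem chiral_diag (g : SU2) (b : Bool) : chiral (diag g) b = g := by
  cases b <;> rfl

theorem spinAct_mul (V W : Spin4) (t : Spinors (Slot m)) :
    spinAct (V * W) t = spinAct V (spinAct W t) := by
  unfold spinAct
  rw [← act_mul]
  simp only [chiral_mul]

theorem spinAct_one (t : Spinors (Slot m)) : spinAct (1 : Spin4) t = t := by
  unfold spinAct
  have h (b : Bool) : chiral 1 b = 1 := by cases b <;> rfl
  simp only [h, act_one]

theorem inner_spinAct_left (V : Spin4) (s t : Spinors (Slot m)) :
    inner ℂ (spinAct V s) t = inner ℂ s (spinAct V⁻¹ t) := by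
  unfold spinAct
  simp only [inner_act_left, chiral_inv]

theorem continuous_spinAct (t : Spinors (Slot m)) : Continuous fun V : Spin4 => spinAct V t := by
  refine continuous_act (fun x => ?_) t
  cases x.2.1
  · exact continuous_snd
  · exact continuous_fst

theorem spinAct_mem_simpleSpace (V : Spin4) {t : Spinors (Slot m)} (ht : t ∈ simpleSpace m) :
    spinAct V t ∈ simpleSpace m :=
  act_mem_symTensors _ (fun _ _ h => congrArg (chiral V) (congrArg Prod.snd h)) ht

theorem topSpace_le_simpleSpace : topSpace m ≤ simpleSpace m :=
  fun _ ht σ hσ A => ht σ (fun x => congrArg Prod.fst (hσ x)) A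

theorem spinAct_diag_mem_topSpace (g : SU2) {t : Spinors (Slot m)} (ht : t ∈ topSpace m) :
    spinAct (diag g) t ∈ topSpace m :=
  act_mem_symTensors _ (fun x y _ => by simp only [chiral_diag]) ht

theorem mem_invSO4 {t : Spinors (Slot m)} :
    t ∈ invSO4 m ↔ t ∈ simpleSpace m ∧ ∀ V : Spin4, spinAct V t = t := by
  simp [invSO4, Submodule.mem_iInf, LinearMap.mem_eqLocus]

theorem mem_invSO3 {t : Spinors (Slot m)} :
    t ∈ invSO3 m ↔ t ∈ topSpace m ∧ ∀ g : SU2, spinAct (diag g) t = t := by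
  simp [invSO3, Submodule.mem_iInf, LinearMap.mem_eqLocus]

theorem integrable_of_continuous {X E : Type*} [TopologicalSpace X] [CompactSpace X] [T2Space X]
    [MeasurableSpace X] [OpensMeasurableSpace X] [NormedAddCommGroup E]
    [SecondCountableTopologyEither X E] {μ : Measure X} [IsFiniteMeasure μ] {f : X → E}
    (hf : Continuous f) : Integrable f μ := by
  rw [← integrableOn_univ]
  exact hf.continuousOn.integrableOn_compact isCompact_univ

theorem integrable_spinAct (t : Spinors (Slot m)) :
    Integrable (fun V : Spin4 => spinAct V t) haarSpin4 :=
  integrable_of_continuous (continuous_spinAct t)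

theorem spinAct_fEmb (V : Spin4) (t : Spinors (Slot m)) : spinAct V (fEmb t) = fEmb t := by
  unfold fEmb
  have := (LinearMap.toContinuousLinearMap (spinAct (m := m) V)).integral_comp_comm
    (integrable_spinAct t)
  simp only [LinearMap.coe_toContinuousLinearMap'] at this
  rw [← this]
  simp only [← spinAct_mul]
  exact integral_mul_left_eq_self (fun W => spinAct W t) V

theorem fEmb_mem_simpleSpace {t : Spinors (Slot m)} (ht : t ∈ simpleSpace m) :
    fEmb t ∈ simpleSpace m := by
  intro σ hσ A
  have h (B : Slot m → Fin 2) : fEmb t B = ∫ V : Spin4, spinAct V t B ∂haarSpin4 :=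
    ((EuclideanSpace.proj (𝕜 := ℂ) B).integral_comp_comm (integrable_spinAct t)).symm
  rw [h, h]
  exact integral_congr_ae (.of_forall fun V => spinAct_mem_simpleSpace V ht σ hσ A)

theorem fEmb_mem_invSO4 {t : Spinors (Slot m)} (ht : t ∈ simpleSpace m) : fEmb t ∈ invSO4 m :=
  mem_invSO4.2 ⟨fEmb_mem_simpleSpace ht, fun V => spinAct_fEmb V t⟩

theorem inner_fEmb_right (s t : Spinors (Slot m)) :
    inner ℂ s (fEmb t) = ∫ V : Spin4, inner ℂ s (spinAct V t) ∂haarSpin4 :=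
  (integral_inner (integrable_spinAct t) s).symm

theorem inner_fEmb_of_invariant {s t : Spinors (Slot m)} (hs : ∀ V : Spin4, spinAct V s = s) :
    inner ℂ s (fEmb t) = inner ℂ s t := by
  rw [inner_fEmb_right]
  have (V : Spin4) : inner ℂ s (spinAct V t) = inner ℂ s t := by
    conv_lhs => rw [← hs V, inner_spinAct_left, ← spinAct_mul, inv_mul_cancel, spinAct_one]
  simp [this]

/-- The average is invariant, and pairing with an invariant tensor does not see the averaging, so
the difference is orthogonal to the invariants. -/
theorem fEmb_eq_starProjection {t : Spinors (Slot m)} (ht : t ∈ simpleSpace m) :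
    fEmb t = (invSO4 m).starProjection t := by
  symm
  refine Submodule.eq_starProjection_of_mem_orthogonal (fEmb_mem_invSO4 ht) ?_
  intro I hI
  rw [inner_sub_right, inner_fEmb_of_invariant (mem_invSO4.1 hI).2, sub_self]

theorem invSO3_le_simpleSpace : invSO3 m ≤ simpleSpace m :=
  fun _ ht => topSpace_le_simpleSpace (mem_invSO3.1 ht).1

theorem inner_fEmb_left_of_invariant {s t : Spinors (Slot m)}
    (hs : ∀ V : Spin4, spinAct V s = s) : inner ℂ (fEmb t) s = inner ℂ t s := by
  rw [← inner_conj_symm, inner_fEmb_of_invariant hs, inner_conj_symm]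

theorem inner_piProj_right {i : Spinors (Slot m)} (hi : i ∈ invSO3 m) (I : Spinors (Slot m)) :
    inner ℂ i (piProj I) = inner ℂ i I := by
  unfold piProj
  rw [← Submodule.inner_starProjection_left_eq_right,
    Submodule.starProjection_eq_self_iff.2 hi]

theorem inner_fEmb_eq_inner_piProj {i I : Spinors (Slot m)} (hi : i ∈ invSO3 m)
    (hI : I ∈ invSO4 m) : inner ℂ (fEmb i) I = inner ℂ i (piProj I) := by
  rw [inner_piProj_right hi, inner_fEmb_left_of_invariant (mem_invSO4.1 hI).2]

theorem inner_fEmb_fEmb (i j : Spinors (Slot m)) :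
    inner ℂ (fEmb i) (fEmb j) = inner ℂ i (fEmb j) :=
  inner_fEmb_left_of_invariant (spinAct_fEmb · j)

/-- Both sides equal the inner product of the two averages. -/
theorem inner_fEmb_left (i j : Spinors (Slot m)) :
    inner ℂ (fEmb i) j = inner ℂ i (fEmb j) := by
  rw [← inner_fEmb_fEmb, inner_fEmb_of_invariant (spinAct_fEmb · i)]

/-- `V⁻¹` acts as the adjoint of `V`, so this is the self-adjointness of the average. It is needed
because a gauge transformation `V` acts on the node tensors by `V⁻¹`. -/
theorem integral_spinAct_inv (t : Spinors (Slot m)) :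
    ∫ V : Spin4, spinAct V⁻¹ t ∂haarSpin4 = fEmb t := by
  have hint : Integrable (fun V : Spin4 => spinAct V⁻¹ t) haarSpin4 :=
    integrable_of_continuous ((continuous_spinAct t).comp continuous_inv)
  refine ext_inner_left ℂ fun s => ?_
  rw [← integral_inner hint]
  have (V : Spin4) : inner ℂ s (spinAct V⁻¹ t) = conj (inner ℂ t (spinAct V s)) := by
    rw [← inner_spinAct_left, inner_conj_symm]
  simp only [this]
  rw [integral_conj, ← inner_fEmb_right, inner_conj_symm, inner_fEmb_left]

end Node

/-! ### Invariant tensors are detected by full contractions with `ε` -/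

theorem exists_perm_comp_eq {ι κ : Type*} [Fintype ι] [DecidableEq ι] [DecidableEq κ]
    (A B : ι → κ)
    (h : ∀ c, (Finset.univ.filter fun x => A x = c).card =
      (Finset.univ.filter fun x => B x = c).card) :
    ∃ σ : Equiv.Perm ι, ∀ x, A (σ x) = B x := by
  have e (c : κ) : Nonempty ({x // B x = c} ≃ {x // A x = c}) := by
    refine Fintype.card_eq.1 ?_
    rw [Fintype.card_subtype, Fintype.card_subtype, h]
  exact ⟨Equiv.ofFiberEquiv fun c => (e c).some, fun x => Equiv.ofFiberEquiv_map _ x⟩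

/-- The sum counts the ones, and the number of zeros is then forced by the size of `ι`. -/
theorem exists_perm_comp_eq_of_sum_eq {ι : Type*} [Fintype ι] [DecidableEq ι] (A B : ι → Fin 2)
    (h : ∑ x, (A x : ℕ) = ∑ x, (B x : ℕ)) : ∃ σ : Equiv.Perm ι, ∀ x, A (σ x) = B x := by
  have h1 (C : ι → Fin 2) : (Finset.univ.filter fun x => C x = 1).card = ∑ x, (C x : ℕ) := by
    rw [Finset.card_filter]
    refine Finset.sum_congr rfl fun x _ => ?_
    generalize C x = c
    fin_cases c <;> rfl
  have h0 (C : ι → Fin 2) : (Finset.univ.filter fun x => C x = 0).card + ∑ x, (C x : ℕ) =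
      Fintype.card ι := by
    rw [Finset.card_filter, ← Finset.sum_add_distrib, Fintype.card_eq_sum_ones]
    refine Finset.sum_congr rfl fun x _ => ?_
    generalize C x = c
    fin_cases c <;> rfl
  refine exists_perm_comp_eq A B fun c => ?_
  have hA := h0 A
  have hB := h0 B
  fin_cases c
  · simp only [Fin.zero_eta]; omega
  · simp only [Fin.mk_one]; rw [h1, h1, h]

/-- Invariance of a tensor over `ℂ²` under `SU(2)`. -/
def IsInvariant {ι : Type*} [Fintype ι] [DecidableEq ι] (t : (ι → Fin 2) → ℂ) : Prop :=
  ∀ (g : SU2) (A : ι → Fin 2),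
    ∑ B, piKron (fun _ => (g : Matrix (Fin 2) (Fin 2) ℂ)) A B * t B = t A

theorem mem_SU2 {α β : ℂ} (h : α * conj α + β * conj β = 1) :
    !![α, β; -conj β, conj α] ∈ Matrix.specialUnitaryGroup (Fin 2) ℂ := by
  rw [Matrix.mem_specialUnitaryGroup_iff, Matrix.mem_unitaryGroup_iff]
  constructor
  · ext i j
    fin_cases i <;> fin_cases j <;>
      simp [Matrix.mul_apply, Fin.sum_univ_two, Matrix.star_apply] <;>
      first | ring1 | linear_combination h
  · rw [Matrix.det_fin_two_of]; linear_combination h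

/-- Component `0` of the invariance involves only the first row `(α, β)` of the group element, which
can be any unit vector. Thus the homogeneous form attached to `t` is constant on the unit sphere. -/
theorem IsInvariant.sum_eq {ι : Type*} [Fintype ι] [DecidableEq ι] {t : (ι → Fin 2) → ℂ}
    (ht : IsInvariant t) {α β : ℂ} (h : α * conj α + β * conj β = 1) :
    ∑ A : ι → Fin 2, (∏ x, ![α, β] (A x)) * t A = t 0 := by
  rw [← ht ⟨_, mem_SU2 h⟩ 0]
  refine Finset.sum_congr rfl fun A _ => ?_
  congr 1

/-- A homogeneous form of positive degree that is constant on the unit sphere of `ℂ²` vanishes, and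
a symmetric tensor is recovered from the coefficients of its form. -/
theorem IsInvariant.eq_zero_of_symmetric {ι : Type*} [Fintype ι] [DecidableEq ι] [Nonempty ι]
    {t : (ι → Fin 2) → ℂ} (ht : IsInvariant t)
    (hsym : ∀ (σ : Equiv.Perm ι) A, t (fun x => A (σ x)) = t A) : t = 0 := by
  have hN : (Fintype.card ι : ℂ) ≠ 0 := by exact_mod_cast Fintype.card_ne_zero
  have h0 : t 0 = 0 := by
    -- A phase whose power of order `card ι` is `-1`; the unit vector `(lam, 0)` then gives `t 0 =
    -- -t 0`.
    set lam : ℂ := Complex.exp ((Real.pi / Fintype.card ι : ℝ) * Complex.I) with hlam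
    have hc : lam * conj lam = 1 := by
      rw [Complex.mul_conj, Complex.normSq_eq_norm_sq, Complex.norm_exp_ofReal_mul_I]; norm_num
    have h := ht.sum_eq (α := lam) (β := 0) (by simpa using hc)
    rw [Finset.sum_eq_single 0] at h
    · have hp : lam ^ Fintype.card ι = -1 := by
        rw [hlam, ← Complex.exp_nat_mul]
        convert Complex.exp_pi_mul_I using 2
        push_cast
        field_simp
      simp only [Pi.zero_apply, Matrix.cons_val_zero, Finset.prod_const, Finset.card_univ, hp] at h
      linear_combination (-1 / 2 : ℂ) * h
    · intro A _ hA
      obtain ⟨x, hx⟩ : ∃ x, A x ≠ 0 := by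
        by_contra! hcon
        exact hA (funext hcon)
      have hx1 : A x = 1 := by
        revert hx
        generalize A x = c
        fin_cases c <;> simp
      rw [Finset.prod_eq_zero (Finset.mem_univ x) (by rw [hx1]; rfl), zero_mul]
    · simp
  -- The dehomogenised form: its value at `w` is that of the form at `(1, w)`, a multiple of a unit
  -- vector.
  have hpoly : ∑ A : ι → Fin 2, Polynomial.monomial (∑ x, (A x : ℕ)) (t A) = 0 := by
    refine Polynomial.funext fun w => ?_
    rw [Polynomial.eval_finsetSum, Polynomial.eval_zero]
    simp only [Polynomial.eval_monomial]
    set r : ℝ := (√(1 + Complex.normSq w))⁻¹ with hr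
    have hpos : 0 < 1 + Complex.normSq w := by have := Complex.normSq_nonneg w; linarith
    have hr0 : r ≠ 0 := by positivity
    have hr2 : r * r * (1 + Complex.normSq w) = 1 := by
      rw [hr, ← mul_inv, Real.mul_self_sqrt hpos.le, inv_mul_cancel₀ hpos.ne']
    have h := ht.sum_eq (α := r) (β := r * w) (by
      rw [map_mul, Complex.conj_ofReal]
      have : (r : ℂ) * r * (1 + Complex.normSq w) = 1 := by exact_mod_cast hr2
      rw [← this, Complex.normSq_eq_conj_mul_self]; ring)
    rw [h0] at h
    have hprod (A : ι → Fin 2) : ∏ x, ![(r : ℂ), r * w] (A x) =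
        r ^ Fintype.card ι * w ^ ∑ x, (A x : ℕ) := by
      rw [← Finset.prod_pow_eq_pow_sum, ← Finset.card_univ, ← Finset.prod_const,
        ← Finset.prod_mul_distrib]
      refine Finset.prod_congr rfl fun x _ => ?_
      generalize A x = c
      fin_cases c <;> simp
    simp only [hprod, mul_assoc, ← Finset.mul_sum] at h
    have h' := (mul_eq_zero.1 h).resolve_left (pow_ne_zero _ (by exact_mod_cast hr0))
    simpa only [mul_comm] using h'
  funext A
  have hcoef := congrArg (fun P => Polynomial.coeff P (∑ x, (A x : ℕ))) hpoly
  simp only [Polynomial.finsetSum_coeff, Polynomial.coeff_monomial, Polynomial.coeff_zero] at hcoef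
  -- By symmetry `t` depends only on the number of ones, so the coefficient is `t A` times a
  -- positive count.
  have heq (B : ι → Fin 2) : (if ∑ x, (B x : ℕ) = ∑ x, (A x : ℕ) then t B else 0) =
      if ∑ x, (B x : ℕ) = ∑ x, (A x : ℕ) then t A else 0 := by
    split_ifs with hB
    · obtain ⟨σ, hσ⟩ := exists_perm_comp_eq_of_sum_eq B A hB
      rw [← hsym σ B, funext hσ]
    · rfl
  simp only [heq, ← Finset.sum_filter, Finset.sum_const, nsmul_eq_mul] at hcoef
  refine (mul_eq_zero.1 hcoef).resolve_left ?_
  have : A ∈ Finset.univ.filter fun B : ι → Fin 2 => ∑ x, (B x : ℕ) = ∑ x, (A x : ℕ) := by simp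
  exact_mod_cast Finset.card_ne_zero_of_mem this

theorem sum_bool_arrow {α : Type*} [Fintype α] (F : (Bool → α) → ℂ) :
    ∑ f, F f = ∑ a, ∑ b, F fun x => bif x then b else a := by
  rw [← Fintype.sum_prod_type']
  refine Fintype.sum_equiv (Equiv.boolArrowEquivProd α) _ _ fun f => ?_
  congr 1
  funext x
  cases x <;> rfl

section Matching

variable {ι κ K : Type*} [Fintype ι] [DecidableEq ι] [Fintype κ] [DecidableEq κ]
  [Fintype K] [DecidableEq K]

/-- The product of the tensors `ε` over the pairs of a perfect matching. -/
def matchTensor (e : K × Bool ≃ ι) (A : ι → Fin 2) : ℂ :=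
  ∏ k, epsilon (A (e (k, false))) (A (e (k, true)))

/-- The full contraction of a tensor along a perfect matching. -/
def fullContraction (e : K × Bool ≃ ι) (t : (ι → Fin 2) → ℂ) : ℂ :=
  ∑ A, matchTensor e A * t A

theorem IsInvariant.comp_equiv {t : (ι → Fin 2) → ℂ} (ht : IsInvariant t) (e : ι ≃ κ) :
    IsInvariant fun A : κ → Fin 2 => t fun x => A (e x) := by
  intro g A
  refine Eq.trans ?_ (ht g fun x => A (e x))
  refine Eq.trans ?_ (sum_comp_equiv e _)
  exact Finset.sum_congr rfl fun B _ => congrArg (· * t fun x => B (e x))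
    (piKron_comp (fun _ => (g : Matrix (Fin 2) (Fin 2) ℂ)) e A B).symm

theorem fullContraction_comp (e : K × Bool ≃ κ) (σ : ι ≃ κ) (t : (ι → Fin 2) → ℂ) :
    fullContraction e (fun A => t fun x => A (σ x)) = fullContraction (e.trans σ.symm) t := by
  unfold fullContraction
  rw [← sum_comp_equiv σ]
  refine Finset.sum_congr rfl fun A _ => ?_
  simp [matchTensor]

/-- The contraction of a pair of indices with `ε`. -/
def pairContraction (t : (ι ⊕ Bool → Fin 2) → ℂ) (A : ι → Fin 2) : ℂ :=
  ∑ f : Bool → Fin 2, epsilon (f false) (f true) * t (Sum.elim A f)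

theorem sum_sum_elim (F : (ι ⊕ κ → Fin 2) → ℂ) :
    ∑ A, F A = ∑ A : ι → Fin 2, ∑ f : κ → Fin 2, F (Sum.elim A f) := by
  rw [← Fintype.sum_prod_type']
  exact Fintype.sum_equiv (Equiv.sumArrowEquivProdArrow ι κ (Fin 2)) _ _ fun A => by
    simp [Equiv.sumArrowEquivProdArrow, Sum.elim_comp_inl_inr]

theorem piKron_sum_elim (g : Matrix (Fin 2) (Fin 2) ℂ) (A B : ι → Fin 2) (f f' : κ → Fin 2) :
    piKron (fun _ : ι ⊕ κ => g) (Sum.elim A f) (Sum.elim B f') =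
      piKron (fun _ => g) A B * piKron (fun _ => g) f f' := by
  simp [piKron_apply, Fintype.prod_sum_type]

theorem det_SU2 (g : SU2) : (g : Matrix (Fin 2) (Fin 2) ℂ) 0 0 * (g : Matrix (Fin 2) (Fin 2) ℂ) 1 1
    - (g : Matrix (Fin 2) (Fin 2) ℂ) 0 1 * (g : Matrix (Fin 2) (Fin 2) ℂ) 1 0 = 1 := by
  rw [← Matrix.det_fin_two]
  exact (Matrix.mem_specialUnitaryGroup_iff.1 g.2).2

/-- The components of `gᵀ ε g = det g • ε`. -/
theorem sum_epsilon_mul (g : SU2) (c d : Fin 2) :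
    ∑ a, ∑ b, epsilon a b * ((g : Matrix (Fin 2) (Fin 2) ℂ) a c *
      (g : Matrix (Fin 2) (Fin 2) ℂ) b d) = epsilon c d := by
  have := det_SU2 g
  fin_cases c <;> fin_cases d <;> simp [epsilon, Fin.sum_univ_two] <;>
    first | ring1 | linear_combination this | linear_combination -this

/-- Invariance of ε allows two more factors of `g` to be inserted on the contracted pair; then `g`
acts on all indices of `t`. -/
theorem IsInvariant.isInvariant_pairContraction {t : (ι ⊕ Bool → Fin 2) → ℂ} (ht : IsInvariant t) :
    IsInvariant (pairContraction t) := by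
  intro g A
  have key (f' : Bool → Fin 2) : ∑ f : Bool → Fin 2, epsilon (f false) (f true) *
      piKron (fun _ => (g : Matrix (Fin 2) (Fin 2) ℂ)) f f' = epsilon (f' false) (f' true) := by
    rw [sum_bool_arrow, ← sum_epsilon_mul g]
    simp [piKron_apply, mul_comm]
  calc ∑ B, piKron (fun _ => (g : Matrix (Fin 2) (Fin 2) ℂ)) A B * pairContraction t B
      = ∑ B, ∑ f', ∑ f : Bool → Fin 2, piKron (fun _ => (g : Matrix (Fin 2) (Fin 2) ℂ)) A B *
          (epsilon (f false) (f true) * piKron (fun _ => (g : Matrix (Fin 2) (Fin 2) ℂ)) f f' *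
            t (Sum.elim B f')) := by
        refine Finset.sum_congr rfl fun B _ => ?_
        rw [pairContraction, Finset.mul_sum]
        refine Finset.sum_congr rfl fun f' _ => ?_
        rw [← key f', Finset.sum_mul, Finset.mul_sum]
    _ = ∑ f : Bool → Fin 2, ∑ B, ∑ f', piKron (fun _ => (g : Matrix (Fin 2) (Fin 2) ℂ)) A B *
          (epsilon (f false) (f true) * piKron (fun _ => (g : Matrix (Fin 2) (Fin 2) ℂ)) f f' *
            t (Sum.elim B f')) := by
        rw [Finset.sum_comm]
        refine (Finset.sum_congr rfl fun B _ => Finset.sum_comm).trans ?_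
        rw [Finset.sum_comm]
        exact Finset.sum_congr rfl fun f _ => Finset.sum_comm
    _ = pairContraction t A := by
        refine Finset.sum_congr rfl fun f _ => ?_
        rw [← ht g (Sum.elim A f), sum_sum_elim, Finset.mul_sum]
        refine Finset.sum_congr rfl fun B _ => ?_
        rw [Finset.mul_sum]
        refine Finset.sum_congr rfl fun f' _ => ?_
        rw [piKron_sum_elim]
        ring

/-- A perfect matching extended by a new pair. -/
def extendMatching (e : K × Bool ≃ ι) : Option K × Bool ≃ ι ⊕ Bool where
  toFun x := match x.1 with
    | some k => Sum.inl (e (k, x.2))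
    | none => Sum.inr x.2
  invFun y := match y with
    | Sum.inl i => (some (e.symm i).1, (e.symm i).2)
    | Sum.inr b => (none, b)
  left_inv x := by
    obtain ⟨_ | k, b⟩ := x <;> simp
  right_inv y := by
    cases y <;> simp

theorem fullContraction_extendMatching (e : K × Bool ≃ ι) (t : (ι ⊕ Bool → Fin 2) → ℂ) :
    fullContraction (extendMatching e) t = fullContraction e (pairContraction t) := by
  simp only [fullContraction, sum_sum_elim, pairContraction, Finset.mul_sum]
  refine Finset.sum_congr rfl fun A _ => Finset.sum_congr rfl fun f _ => ?_
  simp only [matchTensor, Fintype.prod_option, extendMatching, Equiv.coe_fn_mk, Sum.elim_inl,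
    Sum.elim_inr]
  ring

end Matching

/-- Brings two chosen indices into the form required by `pairContraction`. -/
theorem exists_sum_bool_equiv {ι : Type} {x y : ι} (hxy : x ≠ y) :
    ∃ (ι' : Type) (e : ι' ⊕ Bool ≃ ι), e (Sum.inr false) = x ∧ e (Sum.inr true) = y := by
  classical
  set v : Bool → ι := fun b => bif b then y else x with hv
  have hinj : Function.Injective v := by
    intro a b h
    cases a <;> cases b <;> simp_all [eq_comm]
  refine ⟨((Set.range v)ᶜ : Set ι), (Equiv.sumCongr (Equiv.refl _) (Equiv.ofInjective v hinj)).trans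
    ((Equiv.sumComm _ _).trans (Equiv.Set.sumCompl (Set.range v))), ?_, ?_⟩ <;> simp [hv]

/-- An `SU(2)`-invariant tensor vanishes if all its full contractions with `ε` do. -/
theorem IsInvariant.eq_zero_of_fullContraction (n : ℕ) :
    ∀ {ι : Type} [Fintype ι] [DecidableEq ι], Fintype.card ι = n →
    ∀ {t : (ι → Fin 2) → ℂ}, IsInvariant t →
    (∀ (K : Type) [Fintype K] [DecidableEq K] (e : K × Bool ≃ ι), fullContraction e t = 0) →
    t = 0 := by
  induction n using Nat.strong_induction_on with
  | _ n ih =>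
  intro ι _ _ hn t ht hc
  rcases isEmpty_or_nonempty ι with hι | hι
  · funext A
    -- Without indices, contraction along the empty matching is the single component of `t`.
    have := hc Empty (Equiv.equivOfIsEmpty _ _)
    simp only [fullContraction, matchTensor, Finset.univ_eq_empty, Finset.prod_empty, one_mul,
      Fintype.sum_unique] at this
    exact (congrArg t (Subsingleton.elim A _)).trans this
  refine ht.eq_zero_of_symmetric fun σ => ?_
  -- Over `ℂ²` the part of `t` antisymmetric in two indices is ε times a multiple of the contraction
  -- of these indices. That contraction is invariant with two indices fewer, so the induction
  -- hypothesis makes it zero.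
  have hswap (x y : ι) (A : ι → Fin 2) : t (fun z => A (Equiv.swap x y z)) = t A := by
    classical
    rcases eq_or_ne x y with rfl | hxy
    · simp
    obtain ⟨ι', e, rfl, rfl⟩ := exists_sum_bool_equiv hxy
    have : Finite (ι' ⊕ Bool) := Finite.of_equiv _ e.symm
    have : Finite ι' := Finite.of_injective (Sum.inl : ι' → ι' ⊕ Bool) Sum.inl_injective
    let := Fintype.ofFinite ι'
    have hcard : Fintype.card ι' < n := by
      rw [← hn, ← Fintype.card_congr e, Fintype.card_sum, Fintype.card_bool]; omega
    have hz := ih _ hcard rfl (ht.comp_equiv e.symm).isInvariant_pairContraction fun K _ _ e' => by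
      rw [← fullContraction_extendMatching, fullContraction_comp]
      exact hc _ _
    have hz' := congrFun hz fun z => A (e (Sum.inl z))
    simp only [pairContraction, sum_bool_arrow, Fin.sum_univ_two, epsilon, cond_true, cond_false,
      Pi.zero_apply, Matrix.of_apply, Matrix.cons_val_zero, Matrix.cons_val_one, zero_mul,
      one_mul, zero_add, add_zero, neg_mul] at hz'
    have hA : A = fun x => (Sum.elim (fun z => A (e (Sum.inl z))) fun b => bif b then
        A (e (Sum.inr true)) else A (e (Sum.inr false))) (e.symm x) := by
      funext x
      obtain ⟨y, rfl⟩ := e.surjective x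
      rcases y with y | b
      · simp
      · cases b <;> simp
    have hA' : (fun z => A (Equiv.swap (e (Sum.inr false)) (e (Sum.inr true)) z)) =
        fun x => (Sum.elim (fun z => A (e (Sum.inl z))) fun b => bif b then
        A (e (Sum.inr false)) else A (e (Sum.inr true))) (e.symm x) := by
      funext x
      obtain ⟨y, rfl⟩ := e.surjective x
      rcases y with y | b
      · rw [Equiv.swap_apply_of_ne_of_ne] <;> simp
      · cases b <;> simp
    rw [hA', hA]
    simp only [Equiv.symm_apply_apply, Sum.elim_inr, cond_true, cond_false, Sum.elim_inl]
    generalize A (e (Sum.inr false)) = a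
    generalize A (e (Sum.inr true)) = b
    fin_cases a <;> fin_cases b
    · rfl
    · simp only [Fin.zero_eta, Fin.mk_one]; linear_combination -hz'
    · simp only [Fin.zero_eta, Fin.mk_one]; linear_combination hz'
    · rfl
  induction σ using Equiv.Perm.swap_induction_on with
  | one => intro A; rfl
  | swap_mul f x y _ ih => exact fun A => (ih fun z => A (Equiv.swap x y z)).trans (hswap x y A)

/-! ### Contractions of tensors that are symmetric in groups of indices -/

section Symmetric

variable {ι K : Type*} [Fintype ι] [DecidableEq ι] [Fintype K] [DecidableEq K]
  {t : (ι → Fin 2) → ℂ}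

theorem epsilon_antisymm (a b : Fin 2) : epsilon a b = -epsilon b a := by
  fin_cases a <;> fin_cases b <;> simp [epsilon]

/-- Antisymmetrising three indices that take only two values gives zero. -/
theorem epsilon_pluecker (a b c d : Fin 2) :
    epsilon a b * epsilon c d = epsilon a c * epsilon b d + epsilon a d * epsilon c b := by
  fin_cases a <;> fin_cases b <;> fin_cases c <;> fin_cases d <;> simp [epsilon]

theorem fullContraction_trans_of_symmetric (e : K × Bool ≃ ι) (σ : Equiv.Perm ι)
    (ht : ∀ A, t (fun x => A (σ x)) = t A) :
    fullContraction (e.trans σ) t = fullContraction e t := by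
  have h := fullContraction_comp (e.trans σ) σ t
  rw [funext ht] at h
  rw [h]
  congr 1
  ext x
  simp

theorem matchTensor_split (e : K × Bool ≃ ι) (k : K) (A : ι → Fin 2) :
    matchTensor e A = epsilon (A (e (k, false))) (A (e (k, true))) *
      ∏ k' ∈ Finset.univ.erase k, epsilon (A (e (k', false))) (A (e (k', true))) :=
  (Finset.mul_prod_erase _ _ (Finset.mem_univ k)).symm

/-- A contraction inside a group of symmetric indices vanishes. -/
theorem fullContraction_eq_zero_of_swap (e : K × Bool ≃ ι) (k : K)
    (ht : ∀ A, t (fun x => A (Equiv.swap (e (k, false)) (e (k, true)) x)) = t A) :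
    fullContraction e t = 0 := by
  have h := fullContraction_trans_of_symmetric e _ ht
  -- Exchanging the two ends of the pair `k` flips the sign of one ε and touches no other pair.
  have hneg : fullContraction (e.trans (Equiv.swap (e (k, false)) (e (k, true)))) t =
      -fullContraction e t := by
    unfold fullContraction
    rw [← Finset.sum_neg_distrib]
    refine Finset.sum_congr rfl fun A _ => ?_
    rw [matchTensor_split _ k, matchTensor_split e k, ← neg_mul, ← neg_mul, ← epsilon_antisymm]
    congr 2
    · simp
    · refine Finset.prod_congr rfl fun k' hk' => ?_
      have hk := Finset.ne_of_mem_erase hk'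
      simp only [Equiv.trans_apply]
      rw [Equiv.swap_apply_of_ne_of_ne, Equiv.swap_apply_of_ne_of_ne] <;>
        simp [hk]
  linear_combination (1 / 2 : ℂ) * hneg - (1 / 2 : ℂ) * h

/-- The Plücker relation for contractions along matchings. -/
theorem fullContraction_pluecker (e : K × Bool ≃ ι) {k l : K} (hkl : k ≠ l) :
    fullContraction e t =
      fullContraction (e.trans (Equiv.swap (e (k, true)) (e (l, false)))) t +
      fullContraction (e.trans (Equiv.swap (e (k, true)) (e (l, true)))) t := by
  unfold fullContraction
  rw [← Finset.sum_add_distrib]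
  refine Finset.sum_congr rfl fun A _ => ?_
  -- Isolates the two pairs that the exchanges alter, so that the relation for two ε applies to
  -- them.
  have split (e' : K × Bool ≃ ι) : matchTensor e' A =
      epsilon (A (e' (k, false))) (A (e' (k, true))) *
      epsilon (A (e' (l, false))) (A (e' (l, true))) *
      ∏ k' ∈ (Finset.univ.erase k).erase l, epsilon (A (e' (k', false))) (A (e' (k', true))) := by
    rw [matchTensor_split e' k, mul_assoc, Finset.mul_prod_erase (Finset.univ.erase k)
      (fun k' => epsilon (A (e' (k', false))) (A (e' (k', true))))
      (Finset.mem_erase.2 ⟨hkl.symm, Finset.mem_univ l⟩)]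
  have rest (b : Bool) : ∏ k' ∈ (Finset.univ.erase k).erase l,
      epsilon (A ((e.trans (Equiv.swap (e (k, true)) (e (l, b)))) (k', false)))
        (A ((e.trans (Equiv.swap (e (k, true)) (e (l, b)))) (k', true))) =
      ∏ k' ∈ (Finset.univ.erase k).erase l,
        epsilon (A (e (k', false))) (A (e (k', true))) := by
    refine Finset.prod_congr rfl fun k' hk' => ?_
    have hl := Finset.ne_of_mem_erase hk'
    have hk := Finset.ne_of_mem_erase (Finset.mem_of_mem_erase hk')
    simp only [Equiv.trans_apply]
    rw [Equiv.swap_apply_of_ne_of_ne, Equiv.swap_apply_of_ne_of_ne] <;> simp [hk, hl]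
  rw [split, split, split, rest, rest, ← add_mul, ← add_mul, epsilon_pluecker]
  congr 2
  have h1 : Equiv.swap (e (k, true)) (e (l, false)) (e (k, false)) = e (k, false) :=
    Equiv.swap_apply_of_ne_of_ne (by simp) (by simp [hkl])
  have h2 : Equiv.swap (e (k, true)) (e (l, true)) (e (k, false)) = e (k, false) :=
    Equiv.swap_apply_of_ne_of_ne (by simp) (by simp [hkl])
  have h3 : Equiv.swap (e (k, true)) (e (l, false)) (e (l, true)) = e (l, true) :=
    Equiv.swap_apply_of_ne_of_ne (by simp [hkl.symm]) (by simp)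
  have h4 : Equiv.swap (e (k, true)) (e (l, true)) (e (l, false)) = e (l, false) :=
    Equiv.swap_apply_of_ne_of_ne (by simp [hkl.symm]) (by simp)
  simp only [Equiv.trans_apply, Equiv.swap_apply_left, Equiv.swap_apply_right, h1, h2, h3, h4]

end Symmetric

/-! ### Four groups of indices -/

/-- The fibres of `f` are disjoint, so subsets of the prescribed sizes may be chosen in each
independently. -/
theorem exists_bool_card_filter_eq {K T : Type*} [Fintype K] [DecidableEq K] [DecidableEq T]
    (f : K → T) (c : T → ℕ)
    (hc : ∀ τ, c τ ≤ (Finset.univ.filter fun k => f k = τ).card) :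
    ∃ χ : K → Bool, ∀ τ, (Finset.univ.filter fun k => f k = τ ∧ χ k = true).card = c τ := by
  choose S hS hcard using fun τ => Finset.exists_subset_card_eq (hc τ)
  refine ⟨fun k => decide (k ∈ S (f k)), fun τ => ?_⟩
  rw [← hcard τ]
  congr 1
  ext k
  simp only [Finset.mem_filter, Finset.mem_univ, true_and, decide_eq_true_eq]
  constructor
  · rintro ⟨rfl, h⟩; exact h
  · intro h
    have hk := (Finset.mem_filter.1 (hS τ h)).2
    exact ⟨hk, hk ▸ h⟩

section FourGroups

variable {ι K : Type} [Fintype ι] [DecidableEq ι] [Fintype K] [DecidableEq K]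

/-- The unordered pair of the groups that are joined by a pair of a matching. -/
def pairType (p : ι → Fin 4) (e : K × Bool ≃ ι) (k : K) : Sym2 (Fin 4) :=
  s(p (e (k, false)), p (e (k, true)))

theorem indicator_pairType : ∀ a x y : Fin 4, x ≠ y →
    ((if x = a then 1 else 0) + (if y = a then 1 else 0) : ℕ) =
      ∑ b ∈ Finset.univ.erase a, if s(x, y) = s(a, b) then 1 else 0 := by
  decide

/-- The number of indices of a group that belong to a set of pairs of the matching. -/
theorem card_filter_eq_sum_pairType (p : ι → Fin 4) (e : K × Bool ≃ ι)
    (hne : ∀ k, p (e (k, false)) ≠ p (e (k, true))) (χ : K → Bool) (a : Fin 4) :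
    (Finset.univ.filter fun x => p x = a ∧ χ (e.symm x).1 = true).card =
      ∑ b ∈ Finset.univ.erase a,
        (Finset.univ.filter fun k => pairType p e k = s(a, b) ∧ χ k = true).card := by
  simp only [Finset.card_filter]
  rw [Finset.sum_comm, ← e.sum_comp, Fintype.sum_prod_type]
  refine Finset.sum_congr rfl fun k _ => ?_
  simp only [Fintype.sum_bool, Equiv.symm_apply_apply]
  by_cases h : χ k = true
  · simp only [h, and_true]
    rw [add_comm]
    exact indicator_pairType a _ _ (hne k)
  · simp [h]

theorem sum_erase_four (f : Fin 4 → ℕ) :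
    (∑ b ∈ Finset.univ.erase 0, f b = f 1 + f 2 + f 3) ∧
    (∑ b ∈ Finset.univ.erase 1, f b = f 0 + f 2 + f 3) ∧
    (∑ b ∈ Finset.univ.erase 2, f b = f 0 + f 1 + f 3) ∧
    (∑ b ∈ Finset.univ.erase 3, f b = f 0 + f 1 + f 2) := by
  refine ⟨?_, ?_, ?_, ?_⟩
  · rw [show Finset.univ.erase (0 : Fin 4) = {1, 2, 3} by decide]; simp [add_assoc]
  · rw [show Finset.univ.erase (1 : Fin 4) = {0, 2, 3} by decide]; simp [add_assoc]
  · rw [show Finset.univ.erase (2 : Fin 4) = {0, 1, 3} by decide]; simp [add_assoc]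
  · rw [show Finset.univ.erase (3 : Fin 4) = {0, 1, 2} by decide]; simp [add_assoc]

/-- The pairs of a planar matching can be distributed so that half of each group is covered. -/
theorem exists_half (p : ι → Fin 4) (m : Fin 4 → ℕ)
    (hm : ∀ a, (Finset.univ.filter fun x => p x = a).card = 2 * m a)
    (heven : Even (∑ a, m a)) (e : K × Bool ≃ ι)
    (hne : ∀ k, p (e (k, false)) ≠ p (e (k, true)))
    (hpl : (∀ k, pairType p e k ≠ s(0, 2)) ∨ ∀ k, pairType p e k ≠ s(1, 3)) :
    ∃ χ : K → Bool, ∀ a,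
      (Finset.univ.filter fun x => p x = a ∧ χ (e.symm x).1 = true).card = m a := by
  set N : Sym2 (Fin 4) → ℕ := fun τ => (Finset.univ.filter fun k => pairType p e k = τ).card
    with hN
  have hpl' : N s(0, 2) = 0 ∨ N s(1, 3) = 0 :=
    hpl.imp (fun h => by simp [hN, h]) fun h => by simp [hN, h]
  have htot (a : Fin 4) : 2 * m a = ∑ b ∈ Finset.univ.erase a, N s(a, b) := by
    have := card_filter_eq_sum_pairType p e hne (fun _ => true) a
    simp only [and_true] at this
    rw [← hm, this]
  -- With one diagonal unused, the even total forces an even number of pairs on the other diagonal,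
  -- and the four sides then carry numbers of equal parity. Each corner meets one of the opposite
  -- sides `01`, `23`, rounded up, and one of `03`, `12`, rounded down; the roundings cancel.
  obtain ⟨c, hc1, hc2⟩ : ∃ c : Sym2 (Fin 4) → ℕ,
      (∀ τ, τ = s(0, 1) ∨ τ = s(2, 3) → c τ = (N τ + 1) / 2) ∧
      ∀ τ, ¬ (τ = s(0, 1) ∨ τ = s(2, 3)) → c τ = N τ / 2 :=
    ⟨fun τ => if τ = s(0, 1) ∨ τ = s(2, 3) then (N τ + 1) / 2 else N τ / 2,
      fun _ h => if_pos h, fun _ h => if_neg h⟩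
  obtain ⟨χ, hχ⟩ := exists_bool_card_filter_eq (pairType p e) c fun τ => by
    change _ ≤ N τ
    by_cases h : τ = s(0, 1) ∨ τ = s(2, 3)
    · rw [hc1 τ h]; omega
    · rw [hc2 τ h]; omega
  refine ⟨χ, fun a => ?_⟩
  rw [card_filter_eq_sum_pairType p e hne χ a]
  simp only [hχ]
  have t0 := (htot 0).trans (sum_erase_four _).1
  have t1 := (htot 1).trans (sum_erase_four _).2.1
  have t2 := (htot 2).trans (sum_erase_four _).2.2.1
  have t3 := (htot 3).trans (sum_erase_four _).2.2.2
  rw [Fin.sum_univ_four, Nat.even_iff] at heven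
  have e10 : s((1 : Fin 4), 0) = s(0, 1) := Sym2.eq_swap
  have e20 : s((2 : Fin 4), 0) = s(0, 2) := Sym2.eq_swap
  have e30 : s((3 : Fin 4), 0) = s(0, 3) := Sym2.eq_swap
  have e21 : s((2 : Fin 4), 1) = s(1, 2) := Sym2.eq_swap
  have e31 : s((3 : Fin 4), 1) = s(1, 3) := Sym2.eq_swap
  have e32 : s((3 : Fin 4), 2) = s(2, 3) := Sym2.eq_swap
  rw [e10] at t1
  rw [e20, e21] at t2
  rw [e30, e31, e32] at t3
  have c01 := hc1 s(0, 1) (by decide)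
  have c23 := hc1 s(2, 3) (by decide)
  have c02 := hc2 s(0, 2) (by decide)
  have c03 := hc2 s(0, 3) (by decide)
  have c12 := hc2 s(1, 2) (by decide)
  have c13 := hc2 s(1, 3) (by decide)
  clear_value N
  fin_cases a
  · refine (sum_erase_four _).1.trans ?_
    change c s(0, 1) + c s(0, 2) + c s(0, 3) = m 0
    omega
  · refine (sum_erase_four _).2.1.trans ?_
    change c s(1, 0) + c s(1, 2) + c s(1, 3) = m 1
    rw [e10]
    omega
  · refine (sum_erase_four _).2.2.1.trans ?_
    change c s(2, 0) + c s(2, 1) + c s(2, 3) = m 2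
    rw [e20, e21]
    omega
  · refine (sum_erase_four _).2.2.2.trans ?_
    change c s(3, 0) + c s(3, 1) + c s(3, 2) = m 3
    rw [e30, e31, e32]
    omega

/-- For an even number of pairs, a tensor that is symmetric in four groups of indices has
vanishing contractions if its contractions along the matchings respecting a halving `q` of the
groups vanish. -/
theorem fullContraction_eq_zero_of_split (p : ι → Fin 4) (q : ι → Bool) (m : Fin 4 → ℕ)
    (hm : ∀ a b, (Finset.univ.filter fun x => p x = a ∧ q x = b).card = m a)
    (heven : Even (∑ a, m a)) {t : (ι → Fin 2) → ℂ}
    (ht : ∀ σ : Equiv.Perm ι, (∀ x, p (σ x) = p x) → ∀ A, t (fun x => A (σ x)) = t A)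
    (hsplit : ∀ e : K × Bool ≃ ι, (∀ k, q (e (k, false)) = q (e (k, true))) →
      fullContraction e t = 0) (n : ℕ) :
    ∀ e : K × Bool ≃ ι, (Finset.univ.filter fun k => pairType p e k = s(0, 2)).card = n →
      fullContraction e t = 0 := by
  have hswap {x y : ι} (hxy : p x = p y) (A : ι → Fin 2) :
      t (fun z => A (Equiv.swap x y z)) = t A :=
    ht _ (fun z => by rw [Equiv.swap_apply_def]; split_ifs with h h' <;> simp_all) A
  have hsum (f : ι → Bool) (a : Fin 4) :
      (Finset.univ.filter fun x => p x = a ∧ f x = true).card +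
      (Finset.univ.filter fun x => p x = a ∧ f x = false).card =
      (Finset.univ.filter fun x => p x = a).card := by
    simp only [Finset.card_filter, ← Finset.sum_add_distrib]
    refine Finset.sum_congr rfl fun x _ => ?_
    cases f x <;> simp
  have hm2 (a : Fin 4) : (Finset.univ.filter fun x => p x = a).card = 2 * m a := by
    rw [← hsum q, hm, hm, two_mul]
  induction n using Nat.strong_induction_on with
  | _ n ih =>
  intro e hn
  by_cases hin : ∃ k, p (e (k, false)) = p (e (k, true))
  · obtain ⟨k, hk⟩ := hin
    exact fullContraction_eq_zero_of_swap e k (hswap hk)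
  push Not at hin
  by_cases hpl : (∀ k, pairType p e k ≠ s(0, 2)) ∨ ∀ k, pairType p e k ≠ s(1, 3)
  · obtain ⟨χ, hχ⟩ := exists_half p m hm2 heven e hin hpl
    have hχ' (a : Fin 4) :
        (Finset.univ.filter fun x => p x = a ∧ χ (e.symm x).1 = false).card = m a := by
      have := hsum (fun x => χ (e.symm x).1) a
      rw [hχ, hm2] at this
      omega
    -- The halvings by `q` and by `χ` have the same sizes in every group, so a permutation within
    -- the groups carries one to the other. As `χ` is constant on pairs, the permuted matching
    -- respects `q`.
    obtain ⟨σ, hσ⟩ := exists_perm_comp_eq (fun x => (p x, q x))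
      (fun x => (p x, χ (e.symm x).1)) fun c => by
        obtain ⟨a, b⟩ := c
        simp only [Prod.mk.injEq]
        rw [hm]
        cases b
        · exact (hχ' a).symm
        · exact (hχ a).symm
    simp only [Prod.mk.injEq] at hσ
    rw [← fullContraction_trans_of_symmetric e σ (ht σ fun x => (hσ x).1)]
    refine hsplit _ fun k => ?_
    simp only [Equiv.trans_apply]
    rw [(hσ _).2, (hσ _).2]
    simp
  · push Not at hpl
    -- Both diagonals occur. The Plücker relation for one pair on each gives two matchings with
    -- fewer pairs on the diagonal `02`, the induction measure.
    obtain ⟨⟨k, hk⟩, l, hl⟩ := hpl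
    have hkl : k ≠ l := by
      rintro rfl
      exact absurd (hk.symm.trans hl) (by decide)
    have hlt (b : Bool) : (Finset.univ.filter fun k' => pairType p
        (e.trans (Equiv.swap (e (k, true)) (e (l, b)))) k' = s(0, 2)).card < n := by
      rw [← hn]
      refine Finset.card_lt_card ?_
      have hother (k' : K) (h1 : k' ≠ k) (h2 : k' ≠ l) : pairType p
          (e.trans (Equiv.swap (e (k, true)) (e (l, b)))) k' = pairType p e k' := by
        simp only [pairType, Equiv.trans_apply]
        rw [Equiv.swap_apply_of_ne_of_ne, Equiv.swap_apply_of_ne_of_ne] <;> simp [h1, h2]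
      -- These are the pairings that the two exchanges create; each joins an end of one diagonal to
      -- an end of the other.
      have dec : ∀ x y z w : Fin 4, s(x, y) = s(0, 2) → s(z, w) = s(1, 3) →
          s(x, z) ≠ s(0, 2) ∧ s(x, w) ≠ s(0, 2) ∧ s(y, w) ≠ s(0, 2) ∧ s(z, y) ≠ s(0, 2) := by
        decide
      have hd := dec _ _ _ _ hk hl
      have hk' : pairType p (e.trans (Equiv.swap (e (k, true)) (e (l, b)))) k ≠ s(0, 2) := by
        simp only [pairType, Equiv.trans_apply, Equiv.swap_apply_left]
        rw [Equiv.swap_apply_of_ne_of_ne (by simp) (by simp [hkl])]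
        cases b
        · exact hd.1
        · exact hd.2.1
      have hl' : pairType p (e.trans (Equiv.swap (e (k, true)) (e (l, b)))) l ≠ s(0, 2) := by
        simp only [pairType, Equiv.trans_apply]
        cases b
        · rw [Equiv.swap_apply_right, Equiv.swap_apply_of_ne_of_ne (by simp [hkl.symm]) (by simp)]
          exact hd.2.2.1
        · rw [Equiv.swap_apply_right, Equiv.swap_apply_of_ne_of_ne (by simp [hkl.symm]) (by simp)]
          exact hd.2.2.2
      rw [Finset.ssubset_iff_of_subset]
      · exact ⟨k, by simpa using hk, by simpa using hk'⟩
      · intro k' h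
        simp only [Finset.mem_filter, Finset.mem_univ, true_and] at h ⊢
        rw [← hother k' (by rintro rfl; exact hk' h) (by rintro rfl; exact hl' h)]
        exact h
    rw [fullContraction_pluecker e hkl, ih _ (hlt false) _ rfl, ih _ (hlt true) _ rfl, add_zero]

end FourGroups

/-! ### Injectivity of the group average -/

section Node

variable {m : Fin 4 → ℕ}

/-- The components of `g ε gᵀ = det g • ε`. -/
theorem sum_epsilon_mul_right (g : SU2) (a b : Fin 2) :
    ∑ c, ∑ d, epsilon c d * ((g : Matrix (Fin 2) (Fin 2) ℂ) a c *
      (g : Matrix (Fin 2) (Fin 2) ℂ) b d) = epsilon a b := by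
  have := det_SU2 g
  fin_cases a <;> fin_cases b <;> simp [epsilon, Fin.sum_univ_two] <;>
    first | ring1 | linear_combination this | linear_combination -this

/-- The tensor of a perfect matching is invariant under group elements that agree on each pair. -/
theorem act_matchTensor {ι K : Type*} [Fintype ι] [DecidableEq ι] [Fintype K] [DecidableEq K]
    (e : K × Bool ≃ ι) (h : ι → SU2) (hh : ∀ k, h (e (k, false)) = h (e (k, true))) :
    act h (WithLp.toLp 2 (matchTensor e)) = WithLp.toLp 2 (matchTensor e) := by
  ext A
  rw [act_apply]
  simp only [matchTensor]
  rw [← sum_comp_equiv e.symm]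
  have key (k : K) : ∑ f : Bool → Fin 2, epsilon (f false) (f true) *
      ∏ b, (h (e (k, b)) : Matrix (Fin 2) (Fin 2) ℂ) (A (e (k, b))) (f b) =
      epsilon (A (e (k, false))) (A (e (k, true))) := by
    rw [sum_bool_arrow, ← sum_epsilon_mul_right (h (e (k, true)))]
    simp [hh, mul_comm]
  simp only [← key]
  rw [Fintype.prod_sum]
  refine Fintype.sum_equiv (Equiv.curry K Bool (Fin 2)) _ _ fun B => ?_
  rw [Finset.prod_mul_distrib, mul_comm]
  congr 1
  · simp
  · rw [piKron_apply, ← e.prod_comp, Fintype.prod_prod_type]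
    simp

/-- The orthogonal projection of an invariant tensor to a stable subspace is invariant. -/
theorem spinAct_starProjection {W : Submodule ℂ (Spinors (Slot m))} {V : Spin4}
    (hW : ∀ s ∈ W, spinAct V s ∈ W) (hW' : ∀ s ∈ W, spinAct V⁻¹ s ∈ W) {t : Spinors (Slot m)}
    (ht : spinAct V t = t) : spinAct V (W.starProjection t) = W.starProjection t := by
  symm
  refine Submodule.eq_starProjection_of_mem_orthogonal
    (hW _ (Submodule.starProjection_apply_mem _ _)) fun s hs => ?_
  have hsub : t - spinAct V (W.starProjection t) = spinAct V (t - W.starProjection t) := by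
    rw [map_sub, ht]
  rw [hsub, ← inner_conj_symm, inner_spinAct_left, Submodule.starProjection_inner_eq_zero _ _
    (hW' _ hs), map_zero]

/-- An `SO(3)` intertwiner that is orthogonal to all `SO(4)` intertwiners vanishes, if the sum of
the spins is an integer. -/
theorem eq_zero_of_inner_invSO4 (heven : Even (∑ a, m a)) {i : Spinors (Slot m)}
    (hi : i ∈ invSO3 m) (h : ∀ I ∈ invSO4 m, inner ℂ I i = 0) : i = 0 := by
  obtain ⟨htop, hinv⟩ := mem_invSO3.1 hi
  have hinv' : IsInvariant (i : (Slot m → Fin 2) → ℂ) := fun g A => by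
    have := congrArg (fun t : Spinors (Slot m) => t A) (hinv g)
    simp only [spinAct, chiral_diag, act_apply] at this
    exact this
  have hzero : (i : (Slot m → Fin 2) → ℂ) = 0 := by
    refine hinv'.eq_zero_of_fullContraction _ rfl fun K _ _ e => ?_
    refine fullContraction_eq_zero_of_split (fun s : Slot m => s.1) (fun s => s.2.1) m ?_ heven
      htop ?_ _ e rfl
    · intro a b
      rw [← Fintype.card_subtype]
      let E : {s : Slot m // s.1 = a ∧ s.2.1 = b} ≃ Fin (m a) :=
        { toFun := fun s => Fin.cast (by rw [s.2.1]) s.1.2.2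
          invFun := fun x => ⟨⟨a, b, x⟩, rfl, rfl⟩
          left_inv := by
            rintro ⟨⟨a', b', x⟩, rfl, rfl⟩
            rfl
          right_inv := fun x => rfl }
      rw [Fintype.card_congr E, Fintype.card_fin]
    · intro e he
      set E : Spinors (Slot m) := WithLp.toLp 2 (matchTensor e) with hE
      have hEinv (V : Spin4) : spinAct V E = E :=
        act_matchTensor e _ fun k => by rw [he]
      -- The inner product conjugates its first argument, so a contraction is an inner product with
      -- the matching tensor because ε is real.
      have hreal (a b : Fin 2) : conj (epsilon a b) = epsilon a b := by
        fin_cases a <;> fin_cases b <;> simp [epsilon]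
      have hcon : fullContraction e (i : (Slot m → Fin 2) → ℂ) = inner ℂ E i := by
        simp only [fullContraction, PiLp.inner_apply, RCLike.inner_apply, hE, matchTensor, map_prod,
          hreal, mul_comm]
      -- The matching tensor is invariant but not symmetric. Its projection to the simple tensors
      -- stays invariant and has the same inner product with `i`, which is itself simple.
      have hmem : (simpleSpace m).starProjection E ∈ invSO4 m :=
        mem_invSO4.2 ⟨Submodule.starProjection_apply_mem _ _, fun V =>
          spinAct_starProjection (fun _ => spinAct_mem_simpleSpace _)
            (fun _ => spinAct_mem_simpleSpace _) (hEinv V)⟩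
      rw [hcon, ← h _ hmem, Submodule.inner_starProjection_left_eq_right,
        Submodule.starProjection_eq_self_iff.2 (invSO3_le_simpleSpace hi)]
  ext A
  exact congrFun hzero A

/-! ### The maps `f` and `π` between the intertwiner spaces. -/

theorem fEmb_mem_Kph {t : Spinors (Slot m)} (ht : t ∈ topSpace m) : fEmb t ∈ Kph m :=
  ⟨t, ht, (fEmb_eq_starProjection (topSpace_le_simpleSpace ht)).symm⟩

theorem Kph_le_invSO4 : Kph m ≤ invSO4 m := by
  rintro _ ⟨t, _, rfl⟩
  exact Submodule.starProjection_apply_mem _ _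

/-- A preimage `t` in `topSpace` may be replaced by its projection to `invSO3`: an `SO(4)`
intertwiner projected to `topSpace` is an `SO(3)` intertwiner, so it does not see the discarded part
of `t`. No parity condition enters. -/
theorem exists_fEmb_eq {I : Spinors (Slot m)} (hI : I ∈ Kph m) : ∃ i ∈ invSO3 m, fEmb i = I := by
  obtain ⟨t, ht, rfl⟩ := hI
  refine ⟨(invSO3 m).starProjection t, Submodule.starProjection_apply_mem _ _, ?_⟩
  have h3 := Submodule.starProjection_apply_mem (invSO3 m) t
  rw [fEmb_eq_starProjection (invSO3_le_simpleSpace h3)]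
  refine (Submodule.eq_starProjection_of_mem_orthogonal
    (Submodule.starProjection_apply_mem _ _) fun J hJ => ?_).symm
  have hsub : t - (invSO4 m).starProjection ((invSO3 m).starProjection t) =
      (t - (invSO3 m).starProjection t) + ((invSO3 m).starProjection t -
        (invSO4 m).starProjection ((invSO3 m).starProjection t)) := by abel
  have htop : t - (invSO3 m).starProjection t ∈ topSpace m :=
    Submodule.sub_mem _ ht (mem_invSO3.1 h3).1
  have hJ3 : (topSpace m).starProjection J ∈ invSO3 m :=
    mem_invSO3.2 ⟨Submodule.starProjection_apply_mem _ _, fun g =>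
      spinAct_starProjection (fun _ => spinAct_diag_mem_topSpace g)
        (fun _ => spinAct_diag_mem_topSpace g⁻¹) ((mem_invSO4.1 hJ).2 _)⟩
  rw [hsub, inner_add_right, ← inner_conj_symm J ((invSO3 m).starProjection t - _),
    Submodule.starProjection_inner_eq_zero _ _ hJ, map_zero, add_zero,
    ← Submodule.starProjection_eq_self_iff.2 htop, ← Submodule.inner_starProjection_left_eq_right,
    ← inner_conj_symm, Submodule.starProjection_inner_eq_zero _ _ hJ3, map_zero]

theorem eq_zero_of_fEmb_eq_zero (heven : Even (∑ a, m a)) {i : Spinors (Slot m)}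
    (hi : i ∈ invSO3 m) (h : fEmb i = 0) : i = 0 :=
  eq_zero_of_inner_invSO4 heven hi fun I hI => by
    rw [← inner_fEmb_of_invariant (mem_invSO4.1 hI).2, h, inner_zero_right]

theorem exists_fEmb_equiv (heven : Even (∑ a, m a)) :
    ∃ Φ : invSO3 m ≃ₗ[ℂ] Kph m, ∀ i, (Φ i : Spinors (Slot m)) = fEmb (i : Spinors (Slot m)) := by
  let φ : invSO3 m →ₗ[ℂ] Kph m :=
    LinearMap.codRestrict (Kph m)
      (((invSO4 m).starProjection : Spinors (Slot m) →ₗ[ℂ] Spinors (Slot m)) ∘ₗ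
        (invSO3 m).subtype) fun i => ⟨i, (mem_invSO3.1 i.2).1, rfl⟩
  have hφ (i : invSO3 m) : (φ i : Spinors (Slot m)) = fEmb (i : Spinors (Slot m)) :=
    (fEmb_eq_starProjection (invSO3_le_simpleSpace i.2)).symm
  refine ⟨LinearEquiv.ofBijective φ ⟨?_, fun I => ?_⟩, hφ⟩
  · refine (injective_iff_map_eq_zero φ).2 fun i hi => Subtype.ext ?_
    refine eq_zero_of_fEmb_eq_zero heven i.2 ?_
    rw [← hφ, hi]; rfl
  · obtain ⟨i, hi, h⟩ := exists_fEmb_eq I.2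
    exact ⟨⟨i, hi⟩, Subtype.ext ((hφ _).trans h)⟩

/-- For `I = f i` with `π I = 0`, adjointness gives `⟨I, I⟩ = ⟨i, π I⟩ = 0`; the dimensions agree by
the isomorphism `f`. -/
theorem exists_piProj_equiv (heven : Even (∑ a, m a)) :
    ∃ Ψ : Kph m ≃ₗ[ℂ] invSO3 m, ∀ I, (Ψ I : Spinors (Slot m)) = piProj (I : Spinors (Slot m)) := by
  obtain ⟨Φ, hΦ⟩ := exists_fEmb_equiv heven
  let ψ : Kph m →ₗ[ℂ] invSO3 m :=
    LinearMap.codRestrict (invSO3 m)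
      (((invSO3 m).starProjection : Spinors (Slot m) →ₗ[ℂ] Spinors (Slot m)) ∘ₗ
        (Kph m).subtype) fun I => Submodule.starProjection_apply_mem _ _
  have hψ (I : Kph m) : (ψ I : Spinors (Slot m)) = piProj (I : Spinors (Slot m)) := rfl
  have hinj : Function.Injective ψ := by
    refine (injective_iff_map_eq_zero ψ).2 fun I hI => Subtype.ext ?_
    obtain ⟨i, hi, h⟩ := exists_fEmb_eq I.2
    have h0 : inner ℂ (fEmb i) (I : Spinors (Slot m)) = 0 := by
      rw [inner_fEmb_eq_inner_piProj hi (Kph_le_invSO4 I.2), ← hψ, hI]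
      simp
    rw [h] at h0
    exact inner_self_eq_zero.1 h0
  exact ⟨LinearEquiv.ofInjectiveOfFinrankEq ψ hinj Φ.finrank_eq.symm, fun I => hψ I⟩

theorem exists_piProj_eq (heven : Even (∑ a, m a)) {i : Spinors (Slot m)} (hi : i ∈ invSO3 m) :
    ∃ I ∈ invSO4 m, piProj I = i := by
  obtain ⟨Ψ, hΨ⟩ := exists_piProj_equiv heven
  exact ⟨Ψ.symm ⟨i, hi⟩, Kph_le_invSO4 (Ψ.symm ⟨i, hi⟩).2, by rw [← hΨ]; simp⟩

/-- The element `(-1, 1)` changes the sign of every unprimed index and so acts by `(-1) ^ ∑ a, m a =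
-1`. -/
theorem invSO4_eq_bot (hodd : ¬ Even (∑ a, m a)) : invSO4 m = ⊥ := by
  refine (Submodule.eq_bot_iff _).2 fun t ht => ?_
  have hmem : -(1 : Matrix (Fin 2) (Fin 2) ℂ) ∈ Matrix.specialUnitaryGroup (Fin 2) ℂ := by
    rw [Matrix.mem_specialUnitaryGroup_iff, Matrix.mem_unitaryGroup_iff]
    constructor
    · simp
    · simp [Matrix.det_neg]
  have h := (mem_invSO4.1 ht).2 (⟨_, hmem⟩, 1)
  set c : Bool → ℂ := fun b => bif b then -1 else 1 with hc
  have hchi (b : Bool) : (chiral (⟨_, hmem⟩, 1) b : Matrix (Fin 2) (Fin 2) ℂ) = c b • 1 := by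
    cases b
    · simp [hc, chiral]
    · simp [hc, chiral]
  have hprod : ∏ s : Slot m, c s.2.1 = -1 := by
    rw [Fintype.prod_sigma]
    simp only [Fintype.prod_prod_type, Finset.prod_const, Finset.card_univ, Fintype.card_fin,
      Fintype.prod_bool, hc, cond_true, cond_false, one_pow, mul_one]
    rw [Finset.prod_pow_eq_pow_sum]
    exact (Nat.not_even_iff_odd.1 hodd).neg_one_pow
  ext A
  have hA := congrArg (fun t : Spinors (Slot m) => t A) h
  simp only [spinAct, act_apply, hchi, piKron_smul, hprod, piKron_one] at hA
  simp only [Matrix.smul_apply, Matrix.one_apply, smul_eq_mul, mul_ite, mul_one, mul_zero, ite_mul,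
    zero_mul, Finset.sum_ite_eq, Finset.mem_univ, if_true, neg_mul, one_mul] at hA
  simp only [PiLp.zero_apply]
  linear_combination (-1 / 2 : ℂ) * hA

end Node

/-! ### Orthogonality relations for the symmetric tensor representations of `SU(2)` -/

section Schur

variable {S S' : Type} [Fintype S] [DecidableEq S] [Fintype S'] [DecidableEq S']

/-- The matching of the two summands along a bijection. -/
def sumMatching (e : S ≃ S') : S × Bool ≃ S ⊕ S' where
  toFun x := if x.2 = true then Sum.inr (e x.1) else Sum.inl x.1
  invFun y := Sum.elim (fun s => (s, false)) (fun s => (e.symm s, true)) y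
  left_inv x := by
    obtain ⟨s, _ | _⟩ := x <;> simp
  right_inv y := by
    cases y <;> simp

/-- Reversal of the pairs of a matching singled out by `w`. -/
def flipPairs {K : Type*} (w : K → Bool) : K × Bool ≃ K × Bool where
  toFun x := (x.1, xor x.2 (w x.1))
  invFun x := (x.1, xor x.2 (w x.1))
  left_inv x := by simp
  right_inv x := by simp

theorem matchTensor_flipPairs {ι K : Type*} [Fintype ι] [DecidableEq ι] [Fintype K]
    [DecidableEq K] (w : K → Bool) (e : K × Bool ≃ ι) (A : ι → Fin 2) :
    matchTensor ((flipPairs w).trans e) A = (∏ k, bif w k then -1 else 1) * matchTensor e A := by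
  unfold matchTensor
  rw [← Finset.prod_mul_distrib]
  refine Finset.prod_congr rfl fun k _ => ?_
  simp only [Equiv.trans_apply, flipPairs, Equiv.coe_fn_mk]
  cases w k
  · simp
  · simp [← epsilon_antisymm]

/-- A pair inside `S` or inside `S'` contracts symmetric indices to zero; a matching without such
pairs is a bijection `S ≃ S'`, up to the orientation of its pairs. -/
theorem eq_zero_of_sumMatching {t : (S ⊕ S' → Fin 2) → ℂ} (hinv : IsInvariant t)
    (hsym : ∀ (σ : Equiv.Perm S) (τ : Equiv.Perm S') A,
      t (fun x => A (Equiv.sumCongr σ τ x)) = t A)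
    (h : ∀ e : S ≃ S', fullContraction (sumMatching e) t = 0) : t = 0 := by
  refine hinv.eq_zero_of_fullContraction _ rfl fun K _ _ e => ?_
  by_cases hl : ∃ k a b, e (k, false) = Sum.inl a ∧ e (k, true) = Sum.inl b
  · obtain ⟨k, a, b, ha, hb⟩ := hl
    refine fullContraction_eq_zero_of_swap e k fun A => ?_
    rw [ha, hb, ← hsym (Equiv.swap a b) 1 A]
    exact congrArg (fun σ : Equiv.Perm (S ⊕ S') => t fun x => A (σ x))
      (Equiv.Perm.sumCongr_swap_one a b).symm
  by_cases hr : ∃ k a b, e (k, false) = Sum.inr a ∧ e (k, true) = Sum.inr b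
  · obtain ⟨k, a, b, ha, hb⟩ := hr
    refine fullContraction_eq_zero_of_swap e k fun A => ?_
    rw [ha, hb, ← hsym 1 (Equiv.swap a b) A]
    exact congrArg (fun σ : Equiv.Perm (S ⊕ S') => t fun x => A (σ x))
      (Equiv.Perm.sumCongr_one_swap a b).symm
  push Not at hl hr
  -- Reversing the pairs that start in `S'` makes all pairs run from `S` to `S'`, at the cost of a
  -- sign.
  set w : K → Bool := fun k => (e (k, false)).isRight with hw
  set e₁ := (flipPairs w).trans e with he₁
  have h₁ (k : K) : (∃ s, e₁ (k, false) = Sum.inl s) ∧ ∃ s, e₁ (k, true) = Sum.inr s := by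
    simp only [he₁, hw, Equiv.trans_apply, flipPairs, Equiv.coe_fn_mk]
    rcases hf : e (k, false) with a | a <;> rcases ht : e (k, true) with b | b
    · exact absurd ht (hl k a b hf)
    · simp [hf, ht]
    · simp [hf, ht]
    · exact absurd ht (hr k a b hf)
  choose α hα using fun k => (h₁ k).1
  choose β hβ using fun k => (h₁ k).2
  have hαb : Function.Bijective α := by
    refine ⟨fun k l hkl => ?_, fun s => ?_⟩
    · have := e₁.injective ((hα k).trans ((congrArg Sum.inl hkl).trans (hα l).symm))
      exact congrArg Prod.fst this
    · obtain ⟨⟨k, b⟩, hk⟩ := e₁.surjective (Sum.inl s)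
      cases b
      · exact ⟨k, Sum.inl_injective ((hα k).symm.trans hk)⟩
      · rw [hβ] at hk; cases hk
  have hβb : Function.Bijective β := by
    refine ⟨fun k l hkl => ?_, fun s => ?_⟩
    · have := e₁.injective ((hβ k).trans ((congrArg Sum.inr hkl).trans (hβ l).symm))
      exact congrArg Prod.fst this
    · obtain ⟨⟨k, b⟩, hk⟩ := e₁.surjective (Sum.inr s)
      cases b
      · rw [hα] at hk; cases hk
      · exact ⟨k, Sum.inr_injective ((hβ k).symm.trans hk)⟩
  have hm (A : S ⊕ S' → Fin 2) : matchTensor (sumMatching ((Equiv.ofBijective α hαb).symm.trans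
      (Equiv.ofBijective β hβb))) A = matchTensor e₁ A := by
    unfold matchTensor
    rw [← (Equiv.ofBijective α hαb).prod_comp]
    refine Finset.prod_congr rfl fun k _ => ?_
    rw [hα, hβ]
    simp [sumMatching]
  have h₂ := h ((Equiv.ofBijective α hαb).symm.trans (Equiv.ofBijective β hβb))
  unfold fullContraction at h₂ ⊢
  simp only [hm, he₁, matchTensor_flipPairs, mul_assoc, ← Finset.mul_sum] at h₂
  refine (mul_eq_zero.1 h₂).resolve_left (Finset.prod_ne_zero_iff.2 fun k _ => ?_)
  cases w k <;> simp

/-- The sign `ε a (1 - a)`. -/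
def sgn : Fin 2 → ℂ := ![1, -1]

theorem conjTranspose_eq_adjugate (h : SU2) : (h : Matrix (Fin 2) (Fin 2) ℂ).conjTranspose =
    (h : Matrix (Fin 2) (Fin 2) ℂ).adjugate := by
  have h1 : (h : Matrix (Fin 2) (Fin 2) ℂ).conjTranspose * (h : Matrix (Fin 2) (Fin 2) ℂ) = 1 :=
    Matrix.mem_unitaryGroup_iff'.1 (Matrix.mem_specialUnitaryGroup_iff.1 h.2).1
  have h2 := Matrix.mul_adjugate (h : Matrix (Fin 2) (Fin 2) ℂ)
  rw [(Matrix.mem_specialUnitaryGroup_iff.1 h.2).2, one_smul] at h2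
  calc _ = (h : Matrix (Fin 2) (Fin 2) ℂ).conjTranspose *
        ((h : Matrix (Fin 2) (Fin 2) ℂ) * (h : Matrix (Fin 2) (Fin 2) ℂ).adjugate) := by
        rw [h2, mul_one]
    _ = _ := by rw [← mul_assoc, h1, one_mul]

theorem SU2_entries (h : SU2) :
    (h : Matrix (Fin 2) (Fin 2) ℂ) 1 1 = conj ((h : Matrix (Fin 2) (Fin 2) ℂ) 0 0) ∧
    (h : Matrix (Fin 2) (Fin 2) ℂ) 1 0 = -conj ((h : Matrix (Fin 2) (Fin 2) ℂ) 0 1) := by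
  have := conjTranspose_eq_adjugate h
  rw [Matrix.adjugate_fin_two] at this
  have h0 := congrFun (congrFun this 0) 0
  have h1 := congrFun (congrFun this 1) 0
  simp only [Matrix.conjTranspose_apply, Matrix.of_apply, Matrix.cons_val_zero,
    Matrix.cons_val_one, RCLike.star_def, Matrix.cons_val', Matrix.cons_val_fin_one] at h0 h1
  exact ⟨h0.symm, by rw [h1, neg_neg]⟩

/-- The defining representation is equivalent to its conjugate through ε, whose components are
expressed by `rev` and `sgn`. -/
theorem SU2_apply_rev_mul_sgn (h : SU2) (a e : Fin 2) :
    (h : Matrix (Fin 2) (Fin 2) ℂ) a e.rev * sgn e.rev =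
      sgn a * conj ((h : Matrix (Fin 2) (Fin 2) ℂ) a.rev e) := by
  obtain ⟨h1, h2⟩ := SU2_entries h
  have r0 : Fin.rev (0 : Fin 2) = 1 := rfl
  have r1 : Fin.rev (1 : Fin 2) = 0 := rfl
  fin_cases a <;> fin_cases e <;> simp [sgn, r0, r1, h1, h2]

theorem sum_rev (F : (S → Fin 2) → ℂ) : ∑ A : S → Fin 2, F (fun s => (A s).rev) = ∑ A, F A :=
  Fintype.sum_equiv ((Equiv.refl S).arrowCongr Fin.revPerm) _ _ fun _ => rfl

/-- An invariant sesquilinear kernel on symmetric tensors vanishes if its trace does. -/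
theorem kernel_eq_zero {M : (S → Fin 2) → (S' → Fin 2) → ℂ}
    (hinv : ∀ (h : SU2) A A', ∑ D, ∑ D', piKron (fun _ => (h : Matrix (Fin 2) (Fin 2) ℂ)) A D *
      conj (piKron (fun _ => (h : Matrix (Fin 2) (Fin 2) ℂ)) A' D') * M D D' = M A A')
    (hsym : ∀ (σ : Equiv.Perm S) A A', M (fun s => A (σ s)) A' = M A A')
    (hsym' : ∀ (σ : Equiv.Perm S') A A', M A (fun s => A' (σ s)) = M A A')
    (htr : ∀ e : S ≃ S', ∑ D, M D (fun s => D (e.symm s)) = 0) (A : S → Fin 2) (A' : S' → Fin 2) :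
    M A A' = 0 := by
  -- Applying ε to the conjugate indices turns sesquilinear invariance of `M` into invariance of an
  -- ordinary tensor.
  set t : (S ⊕ S' → Fin 2) → ℂ := fun C =>
    (∏ s, sgn (C (Sum.inr s))) * M (fun s => C (Sum.inl s)) (fun s => (C (Sum.inr s)).rev) with ht
  have hzero : t = 0 := by
    refine eq_zero_of_sumMatching ?_ ?_ ?_
    · intro h C
      simp only [ht]
      rw [← hinv h, sum_sum_elim, Finset.mul_sum]
      refine Finset.sum_congr rfl fun D _ => ?_
      rw [← sum_rev, Finset.mul_sum]
      refine Finset.sum_congr rfl fun D' _ => ?_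
      have hs : piKron (fun _ => (h : Matrix (Fin 2) (Fin 2) ℂ)) (fun s => C (Sum.inr s))
          (fun s => (D' s).rev) * ∏ s, sgn (D' s).rev = (∏ s, sgn (C (Sum.inr s))) *
          conj (piKron (fun _ => (h : Matrix (Fin 2) (Fin 2) ℂ))
            (fun s => (C (Sum.inr s)).rev) D') := by
        simp only [piKron_apply, map_prod, ← Finset.prod_mul_distrib, SU2_apply_rev_mul_sgn]
      have hC : C = Sum.elim (fun s => C (Sum.inl s)) fun s => C (Sum.inr s) :=
        (Sum.elim_comp_inl_inr C).symm
      conv_lhs => rw [hC, piKron_sum_elim]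
      simp only [Sum.elim_inl, Sum.elim_inr, Fin.rev_rev]
      linear_combination (piKron (fun _ => (h : Matrix (Fin 2) (Fin 2) ℂ))
        (fun s => C (Sum.inl s)) D * M D D') * hs
    · intro σ τ C
      simp only [ht, Equiv.sumCongr_apply, Sum.map_inl, Sum.map_inr]
      rw [Equiv.prod_comp τ fun s => sgn (C (Sum.inr s)), hsym σ fun s => C (Sum.inl s),
        hsym' τ _ fun s => (C (Sum.inr s)).rev]
    · intro e
      -- Contraction along `e` undoes this ε up to a sign for each index, so it is the trace up to
      -- sign.
      have hkey (D : S → Fin 2) (E : S' → Fin 2) :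
          matchTensor (sumMatching e) (Sum.elim D fun s => (E s).rev) * ∏ s, sgn (E s).rev =
            if (fun s => D (e.symm s)) = E then ∏ _s : S', -1 else 0 := by
        rw [matchTensor, ← e.symm.prod_comp, ← Finset.prod_mul_distrib]
        simp only [funext_iff]
        have hloc (s : S') : epsilon (D (e.symm s)) (E s).rev * sgn (E s).rev =
            if D (e.symm s) = E s then -1 else 0 := by
          generalize D (e.symm s) = a
          generalize E s = b
          have r0 : Fin.rev (0 : Fin 2) = 1 := rfl
          have r1 : Fin.rev (1 : Fin 2) = 0 := rfl
          fin_cases a <;> fin_cases b <;> simp [epsilon, sgn, r0, r1]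
        simp only [sumMatching, Equiv.coe_fn_mk, Sum.elim_inl, Sum.elim_inr, Bool.false_eq_true,
          if_false, if_true, Equiv.apply_symm_apply, hloc]
        rw [Finset.prod_ite_zero]
        simp
      have h0 := htr e
      rw [fullContraction, sum_sum_elim]
      rw [← mul_zero (∏ _s : S', (-1 : ℂ)), ← h0, Finset.mul_sum]
      refine Finset.sum_congr rfl fun D _ => ?_
      rw [← sum_rev, Finset.sum_eq_single fun s => D (e.symm s)]
      · simp only [ht, Sum.elim_inl, Sum.elim_inr, ← mul_assoc, hkey, if_true, Fin.rev_rev]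
      · intro E _ hE
        simp only [ht, Sum.elim_inl, Sum.elim_inr, ← mul_assoc, hkey, if_neg (Ne.symm hE),
          zero_mul]
      · simp
  have h1 := congrFun hzero (Sum.elim A fun s => (A' s).rev)
  simp only [ht, Sum.elim_inl, Sum.elim_inr, Fin.rev_rev, Pi.zero_apply] at h1
  refine (mul_eq_zero.1 h1).resolve_left (Finset.prod_ne_zero_iff.2 fun s _ => ?_)
  generalize (A' s).rev = a
  fin_cases a <;> simp [sgn]

/-! ### The symmetriser: invariance and trace. -/

/-- The kernel of the (unnormalised) projection to the symmetric tensors. -/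
def symKernel (A A' : S → Fin 2) : ℂ :=
  ∑ σ : Equiv.Perm S, if (fun s => A (σ s)) = A' then 1 else 0

theorem symKernel_comp_left (σ : Equiv.Perm S) (A A' : S → Fin 2) :
    symKernel (fun s => A (σ s)) A' = symKernel A A' :=
  Fintype.sum_equiv (Equiv.mulLeft σ) _ _ fun _ => rfl

theorem comp_perm_eq_iff (σ : Equiv.Perm S) (A A' : S → Fin 2) :
    (fun s => A (σ s)) = A' ↔ A = fun s => A' (σ⁻¹ s) := by
  constructor
  · rintro rfl; funext s; simp
  · rintro rfl; funext s; simp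

theorem symKernel_comm (A A' : S → Fin 2) : symKernel A A' = symKernel A' A := by
  exact Fintype.sum_equiv (Equiv.inv _) _ _ fun σ =>
    if_congr ((comp_perm_eq_iff σ A A').trans eq_comm) rfl rfl

theorem symKernel_comp_right (σ : Equiv.Perm S) (A A' : S → Fin 2) :
    symKernel A (fun s => A' (σ s)) = symKernel A A' := by
  rw [symKernel_comm, symKernel_comp_left, symKernel_comm]

theorem piKron_mul_conjTranspose (h : SU2) (A A' : S → Fin 2) :
    ∑ D, piKron (fun _ => (h : Matrix (Fin 2) (Fin 2) ℂ)) A D *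
      conj (piKron (fun _ => (h : Matrix (Fin 2) (Fin 2) ℂ)) A' D) = if A = A' then 1 else 0 := by
  have h1 : (h : Matrix (Fin 2) (Fin 2) ℂ) * (h : Matrix (Fin 2) (Fin 2) ℂ).conjTranspose = 1 :=
    Matrix.mem_unitaryGroup_iff.1 (Matrix.mem_specialUnitaryGroup_iff.1 h.2).1
  have h2 := piKron_mul (fun _ : S => (h : Matrix (Fin 2) (Fin 2) ℂ))
    (fun _ => (h : Matrix (Fin 2) (Fin 2) ℂ).conjTranspose)
  rw [h1, piKron_one, ← piKron_conjTranspose] at h2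
  have h3 := congrFun (congrFun h2 A) A'
  rw [Matrix.one_apply, Matrix.mul_apply] at h3
  exact h3.symm

/-- Permutations commute with tensor powers of `h`, and these are unitary. -/
theorem symKernel_invariant (h : SU2) (A A' : S → Fin 2) :
    ∑ D, ∑ D', piKron (fun _ => (h : Matrix (Fin 2) (Fin 2) ℂ)) A D *
      conj (piKron (fun _ => (h : Matrix (Fin 2) (Fin 2) ℂ)) A' D') * symKernel D D' =
      symKernel A A' := by
  simp only [symKernel, Finset.mul_sum, mul_ite, mul_one, mul_zero]
  rw [Finset.sum_congr rfl fun D _ => Finset.sum_comm, Finset.sum_comm]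
  refine Finset.sum_congr rfl fun σ _ => ?_
  simp only [Finset.sum_ite_eq, Finset.mem_univ, if_true]
  refine Eq.trans ?_ (if_congr (comp_perm_eq_iff σ A A').symm rfl rfl)
  rw [← piKron_mul_conjTranspose h]
  refine Finset.sum_congr rfl fun D _ => ?_
  congr 2
  have := piKron_comp (fun _ => (h : Matrix (Fin 2) (Fin 2) ℂ)) σ (fun s => A' (σ⁻¹ s)) D
  rw [← this]
  simp

/-- With `n = card S`, the diagonal entry at an `A` with `k` ones is the order `k! (n - k)!` of its
stabiliser. There are `n.choose k` such `A`, so each `k` from `0` to `n` contributes `n!`. -/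
theorem symKernel_trace : ∑ A : S → Fin 2, symKernel A A =
    (Fintype.card S + 1) * (Fintype.card S).factorial := by
  have h1 (A : S → Fin 2) : symKernel A A =
      ((Fintype.card S - (Finset.univ.filter fun s => A s = 1).card).factorial *
        ((Finset.univ.filter fun s => A s = 1).card).factorial : ℕ) := by
    have h2 := DomMulAct.stabilizer_card A
    rw [Fin.prod_univ_two, Fintype.card_subtype, Fintype.card_subtype, Fintype.card_subtype] at h2
    have h3 : (Finset.univ.filter fun s => A s = 0).card =
        Fintype.card S - (Finset.univ.filter fun s => A s = 1).card := by
      rw [← Finset.card_univ, ← Finset.card_filter_add_card_filter_not (s := Finset.univ)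
        (fun s => A s = 1), Nat.add_sub_cancel_left]
      refine congrArg Finset.card (Finset.filter_congr fun s _ => ?_)
      generalize A s = a
      fin_cases a <;> simp
    rw [← h3, ← h2, symKernel, Finset.sum_boole]
    rfl
  simp only [h1]
  have h4 : ∑ A : S → Fin 2,
      (((Fintype.card S - (Finset.univ.filter fun s => A s = 1).card).factorial *
        ((Finset.univ.filter fun s => A s = 1).card).factorial : ℕ) : ℂ) =
      ∑ T ∈ (Finset.univ : Finset S).powerset,
        (((Fintype.card S - T.card).factorial * T.card.factorial : ℕ) : ℂ) := by
    refine Finset.sum_bij (fun A _ => Finset.univ.filter fun s => A s = 1) (by simp) ?_ ?_ ?_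
    · intro A _ B _ h
      funext s
      have := congrArg (s ∈ ·) h
      simp only [Finset.mem_filter, Finset.mem_univ, true_and, eq_iff_iff] at this
      revert this
      generalize A s = a
      generalize B s = b
      fin_cases a <;> fin_cases b <;> simp
    · intro T _
      refine ⟨fun s => if s ∈ T then 1 else 0, Finset.mem_univ _, ?_⟩
      ext s
      by_cases h : s ∈ T <;> simp [h]
    · intro A _; rfl
  rw [h4, Finset.sum_powerset_apply_card
    (fun k => (((Fintype.card S - k).factorial * k.factorial : ℕ) : ℂ)), Finset.card_univ]
  rw [Finset.sum_congr rfl (g := fun _ => ((Fintype.card S).factorial : ℂ))]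
  · simp
  · intro k hk
    have hk' : k ≤ Fintype.card S := Nat.lt_succ_iff.1 (Finset.mem_range.1 hk)
    rw [nsmul_eq_mul, ← Nat.cast_mul, ← Nat.choose_mul_factorial_mul_factorial hk']
    congr 1
    ring

/-! ### Haar averages over a single link. -/

/-- The matrix elements of the averaged operators `g ↦ D(g)^* ⊗ D'(g)` for tensor powers `D`, `D'`
of the defining representation, with the first index lowered. -/
def linkKernel (A B : S → Fin 2) (A' B' : S' → Fin 2) : ℂ :=
  ∫ g : SU2, conj (piKron (fun _ => epsilon * (g : Matrix (Fin 2) (Fin 2) ℂ)) A B) *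
    piKron (fun _ => epsilon * (g : Matrix (Fin 2) (Fin 2) ℂ)) A' B' ∂haarSU2

theorem continuous_piKron_epsilon (A B : S → Fin 2) : Continuous fun g : SU2 =>
    piKron (fun _ => epsilon * (g : Matrix (Fin 2) (Fin 2) ℂ)) A B := by
  simp only [piKron_apply]
  exact continuous_finsetProd _ fun s _ =>
    (continuous_const.matrix_mul continuous_subtype_val).matrix_elem _ _

theorem integrable_linkKernel (A B : S → Fin 2) (A' B' : S' → Fin 2) :
    Integrable (fun g : SU2 =>
      conj (piKron (fun _ => epsilon * (g : Matrix (Fin 2) (Fin 2) ℂ)) A B) *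
      piKron (fun _ => epsilon * (g : Matrix (Fin 2) (Fin 2) ℂ)) A' B') haarSU2 :=
  integrable_of_continuous ((Complex.continuous_conj.comp (continuous_piKron_epsilon A B)).mul
    (continuous_piKron_epsilon A' B'))

theorem linkKernel_comp_left (σ : Equiv.Perm S) (A B : S → Fin 2) (A' B' : S' → Fin 2) :
    linkKernel (fun s => A (σ s)) (fun s => B (σ s)) A' B' = linkKernel A B A' B' := by
  unfold linkKernel
  congr 1
  funext g
  rw [← piKron_comp (fun _ => epsilon * (g : Matrix (Fin 2) (Fin 2) ℂ)) σ A B]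

theorem linkKernel_comp_right (σ : Equiv.Perm S') (A B : S → Fin 2) (A' B' : S' → Fin 2) :
    linkKernel A B (fun s => A' (σ s)) (fun s => B' (σ s)) = linkKernel A B A' B' := by
  unfold linkKernel
  congr 1
  funext g
  rw [← piKron_comp (fun _ => epsilon * (g : Matrix (Fin 2) (Fin 2) ℂ)) σ A' B']

theorem epsilon_mul_SU2 (h : SU2) : epsilon * (h : Matrix (Fin 2) (Fin 2) ℂ) =
    (h : Matrix (Fin 2) (Fin 2) ℂ).map conj * epsilon := by
  obtain ⟨h1, h2⟩ := SU2_entries h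
  ext i j
  fin_cases i <;> fin_cases j <;>
    simp [epsilon, Matrix.mul_apply, Fin.sum_univ_two, h1, h2]

/-- Substitute `h * g` for `g` in the Haar integral and move `h` past ε, which conjugates it. -/
theorem linkKernel_invariant (h : SU2) (A B : S → Fin 2) (A' B' : S' → Fin 2) :
    ∑ D, ∑ D', piKron (fun _ => (h : Matrix (Fin 2) (Fin 2) ℂ)) A D *
      conj (piKron (fun _ => (h : Matrix (Fin 2) (Fin 2) ℂ)) A' D') * linkKernel D B D' B' =
      linkKernel A B A' B' := by
  have hmul {R : Type} [Fintype R] [DecidableEq R] (g : SU2) (C E : R → Fin 2) :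
      piKron (fun _ => epsilon * ((h * g : SU2) : Matrix (Fin 2) (Fin 2) ℂ)) C E =
      ∑ D, conj (piKron (fun _ => (h : Matrix (Fin 2) (Fin 2) ℂ)) C D) *
        piKron (fun _ => epsilon * (g : Matrix (Fin 2) (Fin 2) ℂ)) D E := by
    have : epsilon * ((h * g : SU2) : Matrix (Fin 2) (Fin 2) ℂ) =
        (h : Matrix (Fin 2) (Fin 2) ℂ).map conj *
          (epsilon * (g : Matrix (Fin 2) (Fin 2) ℂ)) := by
      rw [← mul_assoc, ← epsilon_mul_SU2, mul_assoc]; rfl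
    rw [this, piKron_mul, Matrix.mul_apply]
    simp only [conj_piKron]
  have hinv := integral_mul_left_eq_self (μ := haarSU2) (fun g : SU2 =>
    conj (piKron (fun _ => epsilon * (g : Matrix (Fin 2) (Fin 2) ℂ)) A B) *
    piKron (fun _ => epsilon * (g : Matrix (Fin 2) (Fin 2) ℂ)) A' B') h
  rw [linkKernel, ← hinv]
  simp only [hmul, map_sum, map_mul, Complex.conj_conj, Finset.sum_mul_sum]
  rw [integral_finsetSum]
  · refine Finset.sum_congr rfl fun D _ => ?_
    rw [integral_finsetSum]
    · refine Finset.sum_congr rfl fun D' _ => ?_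
      rw [linkKernel, ← integral_const_mul]
      congr 1
      funext g
      ring
    · intro D' _
      refine ((integrable_linkKernel D B D' B').const_mul
        (piKron (fun _ => (h : Matrix (Fin 2) (Fin 2) ℂ)) A D *
          conj (piKron (fun _ => (h : Matrix (Fin 2) (Fin 2) ℂ)) A' D'))).congr
        (.of_forall fun g => ?_)
      simp only
      ring
  · intro D _
    refine integrable_finsetSum _ fun D' _ => ?_
    refine ((integrable_linkKernel D B D' B').const_mul
      (piKron (fun _ => (h : Matrix (Fin 2) (Fin 2) ℂ)) A D *
        conj (piKron (fun _ => (h : Matrix (Fin 2) (Fin 2) ℂ)) A' D'))).congr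
      (.of_forall fun g => ?_)
    simp only
    ring

/-- The sum is already constant before integration, because `ε g` is unitary. -/
theorem linkKernel_trace (B B' : S → Fin 2) :
    ∑ A : S → Fin 2, linkKernel A B A B' = if B = B' then 1 else 0 := by
  unfold linkKernel
  rw [← integral_finsetSum _ fun A _ => integrable_linkKernel A B A B']
  have h (g : SU2) : ∑ A : S → Fin 2,
      conj (piKron (fun _ => epsilon * (g : Matrix (Fin 2) (Fin 2) ℂ)) A B) *
      piKron (fun _ => epsilon * (g : Matrix (Fin 2) (Fin 2) ℂ)) A B' =
      if B = B' then 1 else 0 := by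
    have h1 : (epsilon * (g : Matrix (Fin 2) (Fin 2) ℂ)).conjTranspose *
        (epsilon * (g : Matrix (Fin 2) (Fin 2) ℂ)) = 1 := by
      have he : epsilon.conjTranspose * epsilon = 1 := by
        ext i j
        fin_cases i <;> fin_cases j <;> simp [epsilon, Matrix.mul_apply, Fin.sum_univ_two]
      rw [Matrix.conjTranspose_mul, mul_assoc, ← mul_assoc _ epsilon, he, one_mul]
      exact Matrix.mem_unitaryGroup_iff'.1 (Matrix.mem_specialUnitaryGroup_iff.1 g.2).1
    have h2 := piKron_mul
      (fun _ : S => (epsilon * (g : Matrix (Fin 2) (Fin 2) ℂ)).conjTranspose)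
      (fun _ => epsilon * (g : Matrix (Fin 2) (Fin 2) ℂ))
    rw [h1, piKron_one, ← piKron_conjTranspose] at h2
    have h3 := congrFun (congrFun h2 B) B'
    rw [Matrix.one_apply, Matrix.mul_apply] at h3
    exact h3.symm
  simp only [h]
  simp

/-- Permuting both index families of a tensor power changes nothing, so the permutations can be
moved onto `B` and `B'`, where they do not interfere with `h`. -/
theorem sum_linkKernel_invariant (h : SU2) (A B : S → Fin 2) (A' B' : S' → Fin 2) :
    ∑ D, ∑ D', piKron (fun _ => (h : Matrix (Fin 2) (Fin 2) ℂ)) A D *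
      conj (piKron (fun _ => (h : Matrix (Fin 2) (Fin 2) ℂ)) A' D') *
      (∑ σ : Equiv.Perm S, ∑ τ : Equiv.Perm S',
        linkKernel (fun s => D (σ s)) B (fun s => D' (τ s)) B') =
      ∑ σ : Equiv.Perm S, ∑ τ : Equiv.Perm S',
        linkKernel (fun s => A (σ s)) B (fun s => A' (τ s)) B' := by
  have hσ (σ : Equiv.Perm S) (τ : Equiv.Perm S') (D : S → Fin 2) (D' : S' → Fin 2) :
      linkKernel (fun s => D (σ s)) B (fun s => D' (τ s)) B' =
      linkKernel D (fun s => B (σ⁻¹ s)) D' (fun s => B' (τ⁻¹ s)) := by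
    rw [← linkKernel_comp_left σ D, ← linkKernel_comp_right τ _ _ D']
    simp
  simp only [hσ]
  simp only [← linkKernel_invariant h A _ A' _, Finset.mul_sum]
  rw [Finset.sum_congr rfl fun D _ => Finset.sum_comm, Finset.sum_comm]
  refine Finset.sum_congr rfl fun σ _ => ?_
  rw [Finset.sum_congr rfl fun D _ => Finset.sum_comm, Finset.sum_comm]

/-- Schur orthogonality for inequivalent representations. -/
theorem sum_linkKernel_of_card_ne (hcard : Fintype.card S ≠ Fintype.card S') (A B : S → Fin 2)
    (A' B' : S' → Fin 2) :
    ∑ σ : Equiv.Perm S, ∑ τ : Equiv.Perm S',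
      linkKernel (fun s => A (σ s)) B (fun s => A' (τ s)) B' = 0 := by
  refine kernel_eq_zero (M := fun A A' => ∑ σ : Equiv.Perm S, ∑ τ : Equiv.Perm S',
      linkKernel (fun s => A (σ s)) B (fun s => A' (τ s)) B')
    (fun h A A' => sum_linkKernel_invariant h A B A' B') ?_ ?_
    (fun e => absurd (Fintype.card_congr e) hcard) A A'
  · intro ρ A A'
    exact Fintype.sum_equiv (Equiv.mulLeft ρ) _ _ fun _ => rfl
  · intro ρ A A'
    exact Finset.sum_congr rfl fun _ _ => Fintype.sum_equiv (Equiv.mulLeft ρ) _ _ fun _ => rfl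

/-- Schur orthogonality for the symmetric tensor representations. -/
theorem sum_linkKernel (A B A' B' : S → Fin 2) :
    ∑ σ : Equiv.Perm S, ∑ τ : Equiv.Perm S,
      linkKernel (fun s => A (σ s)) B (fun s => A' (τ s)) B' =
      (Fintype.card S + 1 : ℂ)⁻¹ * symKernel B B' * symKernel A A' := by
  -- With `n = card S`, this is the trace `n! * symKernel B B'` of the averaged kernel over the
  -- trace `(n + 1) * n!` of the symmetriser; subtracting `c` times the symmetriser leaves an
  -- invariant kernel of trace zero.
  set c := (Fintype.card S + 1 : ℂ)⁻¹ * symKernel B B' with hc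
  set M : (S → Fin 2) → (S → Fin 2) → ℂ := fun A A' => ∑ σ : Equiv.Perm S, ∑ τ : Equiv.Perm S,
      linkKernel (fun s => A (σ s)) B (fun s => A' (τ s)) B' with hM
  have hs (ρ : Equiv.Perm S) (A A' : S → Fin 2) : M (fun s => A (ρ s)) A' = M A A' :=
    Fintype.sum_equiv (Equiv.mulLeft ρ) _ _ fun _ => rfl
  have hs' (ρ : Equiv.Perm S) (A A' : S → Fin 2) : M A (fun s => A' (ρ s)) = M A A' :=
    Finset.sum_congr rfl fun _ _ => Fintype.sum_equiv (Equiv.mulLeft ρ) _ _ fun _ => rfl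
  have htr : ∑ D, M D D = (Fintype.card S).factorial * symKernel B B' := by
    have h1 (σ τ : Equiv.Perm S) : ∑ D : S → Fin 2,
        linkKernel (fun s => D (σ s)) B (fun s => D (τ s)) B' =
        if (fun s => B ((σ⁻¹ * τ) s)) = B' then 1 else 0 := by
      have (D : S → Fin 2) : linkKernel (fun s => D (σ s)) B (fun s => D (τ s)) B' =
          linkKernel D (fun s => B (σ⁻¹ s)) D (fun s => B' (τ⁻¹ s)) := by
        rw [← linkKernel_comp_left σ D, ← linkKernel_comp_right τ _ _ D]
        simp
      simp only [this, linkKernel_trace]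
      exact if_congr (comp_perm_eq_iff τ (fun s => B (σ⁻¹ s)) B').symm rfl rfl
    simp only [hM]
    rw [Finset.sum_comm, Finset.sum_congr rfl fun σ _ => Finset.sum_comm]
    simp only [h1]
    have h2 (σ : Equiv.Perm S) :
        (∑ τ : Equiv.Perm S, if (fun s => B ((σ⁻¹ * τ) s)) = B' then (1 : ℂ) else 0) =
          symKernel B B' :=
      Fintype.sum_equiv (Equiv.mulLeft σ⁻¹) _ _ fun _ => rfl
    simp only [h2, Finset.sum_const, Finset.card_univ, Fintype.card_perm, nsmul_eq_mul]
  have key := kernel_eq_zero (M := fun A A' => M A A' - c * symKernel A A') ?_ ?_ ?_ ?_ A A'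
  · exact sub_eq_zero.1 key
  · intro h A A'
    simp only [mul_sub, Finset.sum_sub_distrib]
    congr 1
    · exact sum_linkKernel_invariant h A B A' B'
    · rw [← symKernel_invariant h A A']
      simp only [Finset.mul_sum]
      refine Finset.sum_congr rfl fun D _ => Finset.sum_congr rfl fun D' _ => ?_
      ring
  · intro ρ A A'
    simp only [hs, symKernel_comp_left]
  · intro ρ A A'
    simp only [hs', symKernel_comp_right]
  · intro e
    simp only [hs' e.symm, symKernel_comp_right e.symm]
    rw [Finset.sum_sub_distrib, htr, ← Finset.mul_sum, symKernel_trace, hc]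
    have : (Fintype.card S + 1 : ℂ) ≠ 0 := by exact_mod_cast Nat.succ_ne_zero (Fintype.card S)
    field_simp
    ring

end Schur

/-! ### Averaging a product kernel -/

section Average

variable {M : Type*} [Fintype M] [DecidableEq M]

/-- Symmetric tensors may be paired with the symmetrised kernel instead: after reindexing, every
choice of permutations contributes the same amount. This is how the one-link relations, known only
after symmetrisation, become usable. -/
theorem sum_kernel_average {X X' R R' : M → Type*} [∀ m, Fintype (X m)] [∀ m, Fintype (X' m)]
    [∀ m, Fintype (R m)] [∀ m, Fintype (R' m)]
    (ρ : ∀ m, R m → Equiv.Perm (X m)) (ρ' : ∀ m, R' m → Equiv.Perm (X' m))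
    (κ : ∀ m, X m → X' m → ℂ) (T : (∀ m, X m) → ℂ) (T' : (∀ m, X' m) → ℂ)
    (hT : ∀ (r : ∀ m, R m) x, T (fun m => ρ m (r m) (x m)) = T x)
    (hT' : ∀ (r : ∀ m, R' m) x, T' (fun m => ρ' m (r m) (x m)) = T' x) :
    ∑ x, ∑ x', T x * T' x' * ∏ m, ∑ r, ∑ r', κ m (ρ m r (x m)) (ρ' m r' (x' m)) =
      (∏ m, (Fintype.card (R m) * Fintype.card (R' m) : ℂ)) *
        ∑ x, ∑ x', T x * T' x' * ∏ m, κ m (x m) (x' m) := by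
  have hprod (x : ∀ m, X m) (x' : ∀ m, X' m) :
      ∏ m, ∑ r, ∑ r', κ m (ρ m r (x m)) (ρ' m r' (x' m)) =
      ∑ r : ∀ m, R m, ∑ r' : ∀ m, R' m, ∏ m, κ m (ρ m (r m) (x m)) (ρ' m (r' m) (x' m)) := by
    rw [Fintype.prod_sum]
    exact Finset.sum_congr rfl fun r _ => Fintype.prod_sum _
  have hinv (r : ∀ m, R m) (r' : ∀ m, R' m) :
      ∑ x, ∑ x', T x * T' x' * ∏ m, κ m (ρ m (r m) (x m)) (ρ' m (r' m) (x' m)) =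
      ∑ x, ∑ x', T x * T' x' * ∏ m, κ m (x m) (x' m) := by
    refine Eq.trans ?_ ((Equiv.piCongrRight fun m => ρ m (r m)).sum_comp _)
    refine Finset.sum_congr rfl fun x _ => ?_
    refine Eq.trans ?_ ((Equiv.piCongrRight fun m => ρ' m (r' m)).sum_comp _)
    refine Finset.sum_congr rfl fun x' _ => ?_
    have h1 : T (Equiv.piCongrRight (fun m => ρ m (r m)) x) = T x := hT r x
    have h2 : T' (Equiv.piCongrRight (fun m => ρ' m (r' m)) x') = T' x' := hT' r' x'
    rw [h1, h2]
    rfl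
  simp only [hprod, Finset.mul_sum (Finset.univ : Finset (∀ m, R m)),
    Finset.mul_sum (Finset.univ : Finset (∀ m, R' m))]
  rw [Finset.sum_congr rfl fun x _ => Finset.sum_comm, Finset.sum_comm,
    Finset.sum_congr rfl fun r _ => Finset.sum_congr rfl fun x _ => Finset.sum_comm,
    Finset.sum_congr rfl fun r _ => Finset.sum_comm]
  simp only [hinv, Finset.sum_const, Finset.card_univ, Fintype.card_pi, nsmul_eq_mul,
    Finset.prod_mul_distrib, Nat.cast_prod]
  ring

end Average

/-! ### Orthogonality for products of representations -/

section Links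

variable {M : Type*} [Fintype M] [DecidableEq M]

/-- The permutations of the indices at the two ends of a link, acting on index values. -/
def permAct {S : Type} (r : Bool → Equiv.Perm S) : Equiv.Perm (Bool → S → Fin 2) where
  toFun x b s := x b (r b s)
  invFun x b s := x b ((r b).symm s)
  left_inv x := by funext b s; simp
  right_inv x := by funext b s; simp

theorem sum_linkKernel_links_of_card_ne {S S' : M → Type} [∀ m, Fintype (S m)]
    [∀ m, DecidableEq (S m)] [∀ m, Fintype (S' m)] [∀ m, DecidableEq (S' m)]
    {T : (∀ m, Bool → S m → Fin 2) → ℂ} {T' : (∀ m, Bool → S' m → Fin 2) → ℂ}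
    (hT : ∀ (r : ∀ m, Bool → Equiv.Perm (S m)) x, T (fun m => permAct (r m) (x m)) = T x)
    (hT' : ∀ (r : ∀ m, Bool → Equiv.Perm (S' m)) x, T' (fun m => permAct (r m) (x m)) = T' x)
    {m : M} (hm : Fintype.card (S m) ≠ Fintype.card (S' m)) :
    ∑ x, ∑ x', conj (T x) * T' x' * ∏ m, linkKernel (x m false) (x m true) (x' m false)
      (x' m true) = 0 := by
  have h := sum_kernel_average (fun m => permAct (S := S m)) (fun m => permAct (S := S' m))
    (fun m x x' => linkKernel (x false) (x true) (x' false) (x' true)) (fun x => conj (T x)) T'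
    (fun r x => congrArg conj (hT r x)) hT'
  have hz (x : Bool → S m → Fin 2) (x' : Bool → S' m → Fin 2) :
      ∑ r, ∑ r', linkKernel (permAct r x false) (permAct r x true) (permAct r' x' false)
        (permAct r' x' true) = 0 := by
    -- With the permutations at the target fixed, the sum over those at the source already vanishes.
    rw [sum_bool_arrow, Finset.sum_comm]
    refine Finset.sum_eq_zero fun b _ => ?_
    simp only [sum_bool_arrow (α := Equiv.Perm (S' m))]
    rw [Finset.sum_congr rfl fun a _ => Finset.sum_comm, Finset.sum_comm]
    exact Finset.sum_eq_zero fun b' _ => sum_linkKernel_of_card_ne hm (x false)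
      (fun s => x true (b s)) (x' false) (fun s => x' true (b' s))
  have h0 : ∑ x, ∑ x', conj (T x) * T' x' * ∏ m, ∑ r, ∑ r', linkKernel
      (permAct r (x m) false) (permAct r (x m) true) (permAct r' (x' m) false)
      (permAct r' (x' m) true) = 0 :=
    Finset.sum_eq_zero fun x _ => Finset.sum_eq_zero fun x' _ => by
      rw [Finset.prod_eq_zero (Finset.mem_univ m) (hz _ _), mul_zero]
  refine (mul_eq_zero.1 (h.symm.trans h0)).resolve_left (Finset.prod_ne_zero_iff.2 fun m _ => ?_)
  exact mul_ne_zero (by exact_mod_cast Fintype.card_ne_zero)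
    (by exact_mod_cast Fintype.card_ne_zero)

theorem sum_linkKernel_links {S : M → Type} [∀ m, Fintype (S m)] [∀ m, DecidableEq (S m)]
    {T T' : (∀ m, Bool → S m → Fin 2) → ℂ}
    (hT : ∀ (r : ∀ m, Bool → Equiv.Perm (S m)) x, T (fun m => permAct (r m) (x m)) = T x)
    (hT' : ∀ (r : ∀ m, Bool → Equiv.Perm (S m)) x, T' (fun m => permAct (r m) (x m)) = T' x) :
    ∑ x, ∑ x', conj (T x) * T' x' * ∏ m, linkKernel (x m false) (x m true) (x' m false)
      (x' m true) = (∏ m, (Fintype.card (S m) + 1 : ℂ)⁻¹) * ∑ x, conj (T x) * T' x := by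
  have h := sum_kernel_average (fun m => permAct (S := S m)) (fun m => permAct (S := S m))
    (fun m x x' => linkKernel (x false) (x true) (x' false) (x' true)) (fun x => conj (T x)) T'
    (fun r x => congrArg conj (hT r x)) hT'
  -- Schur orthogonality uses up the source permutations. Its value does not depend on the target
  -- ones, which contribute only their number; the two symmetrisers together form a sum of delta
  -- functions over the permutations at both ends.
  have hz (m : M) (x x' : Bool → S m → Fin 2) :
      ∑ r, ∑ r', linkKernel (permAct r x false) (permAct r x true) (permAct r' x' false)
        (permAct r' x' true) = (Fintype.card (S m) + 1 : ℂ)⁻¹ *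
          Fintype.card (Bool → Equiv.Perm (S m)) *
          ∑ r : Bool → Equiv.Perm (S m), if permAct r x = x' then 1 else 0 := by
    have h1 (b b' : Equiv.Perm (S m)) : ∑ a : Equiv.Perm (S m), ∑ a' : Equiv.Perm (S m),
        linkKernel (fun s => x false (a s)) (fun s => x true (b s))
          (fun s => x' false (a' s)) (fun s => x' true (b' s)) =
        (Fintype.card (S m) + 1 : ℂ)⁻¹ * symKernel (x true) (x' true) *
          symKernel (x false) (x' false) := by
      rw [sum_linkKernel, symKernel_comp_left, symKernel_comp_right]
    have h2 : (∑ r : Bool → Equiv.Perm (S m), if permAct r x = x' then (1 : ℂ) else 0) =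
        symKernel (x true) (x' true) * symKernel (x false) (x' false) := by
      rw [sum_bool_arrow, symKernel, symKernel, Finset.sum_mul_sum, Finset.sum_comm]
      refine Finset.sum_congr rfl fun b _ => Finset.sum_congr rfl fun a _ => ?_
      rw [ite_zero_mul_ite_zero, one_mul]
      refine if_congr ?_ rfl rfl
      rw [funext_iff, Bool.forall_bool, and_comm]
      rfl
    rw [h2, sum_bool_arrow, Finset.sum_comm]
    simp only [sum_bool_arrow (fun r' : Bool → Equiv.Perm (S m) => linkKernel _ _ _ _)]
    rw [Finset.sum_congr rfl fun b _ =>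
      (Finset.sum_congr rfl fun a _ => Finset.sum_comm).trans Finset.sum_comm]
    refine Eq.trans (Finset.sum_congr rfl fun b _ => Finset.sum_congr rfl fun b' _ => h1 b b') ?_
    simp only [Finset.sum_const, Finset.card_univ, nsmul_eq_mul, Fintype.card_fun,
      Fintype.card_bool]
    push_cast
    ring
  have hprod (x x' : ∀ m, Bool → S m → Fin 2) :
      ∏ m, ∑ r, ∑ r', linkKernel (permAct r (x m) false) (permAct r (x m) true)
        (permAct r' (x' m) false) (permAct r' (x' m) true) =
      (∏ m, (Fintype.card (S m) + 1 : ℂ)⁻¹) *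
        (∏ m, (Fintype.card (Bool → Equiv.Perm (S m)) : ℂ)) *
        ∑ r : ∀ m, Bool → Equiv.Perm (S m),
          if (fun m => permAct (r m) (x m)) = x' then 1 else 0 := by
    simp only [hz, Finset.prod_mul_distrib]
    rw [Fintype.prod_sum]
    congr 1
    refine Finset.sum_congr rfl fun r _ => ?_
    rw [Finset.prod_ite_zero]
    simp [funext_iff]
  simp only [hprod] at h
  have hsum : ∑ x : ∀ m, Bool → S m → Fin 2, ∑ x' : ∀ m, Bool → S m → Fin 2,
      conj (T x) * T' x' * ((∏ m, (Fintype.card (S m) + 1 : ℂ)⁻¹) *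
        (∏ m, (Fintype.card (Bool → Equiv.Perm (S m)) : ℂ)) *
        ∑ r : ∀ m, Bool → Equiv.Perm (S m),
          if (fun m => permAct (r m) (x m)) = x' then 1 else 0) =
      (∏ m, (Fintype.card (Bool → Equiv.Perm (S m)) : ℂ)) *
      (∏ m, (Fintype.card (Bool → Equiv.Perm (S m)) : ℂ)) *
        ((∏ m, (Fintype.card (S m) + 1 : ℂ)⁻¹) * ∑ x, conj (T x) * T' x) := by
    have hx (x : ∀ m, Bool → S m → Fin 2) : ∑ x' : ∀ m, Bool → S m → Fin 2,
        conj (T x) * T' x' * ((∏ m, (Fintype.card (S m) + 1 : ℂ)⁻¹) *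
        (∏ m, (Fintype.card (Bool → Equiv.Perm (S m)) : ℂ)) *
        ∑ r : ∀ m, Bool → Equiv.Perm (S m),
          if (fun m => permAct (r m) (x m)) = x' then 1 else 0) =
        (∏ m, (Fintype.card (Bool → Equiv.Perm (S m)) : ℂ)) *
        (∏ m, (Fintype.card (Bool → Equiv.Perm (S m)) : ℂ)) *
        (∏ m, (Fintype.card (S m) + 1 : ℂ)⁻¹) * (conj (T x) * T' x) := by
      have hcard : (Fintype.card (∀ m, Bool → Equiv.Perm (S m)) : ℂ) =
          ∏ m, (Fintype.card (Bool → Equiv.Perm (S m)) : ℂ) := by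
        rw [Fintype.card_pi, Nat.cast_prod]
      simp only [Finset.mul_sum, mul_ite, mul_one, mul_zero]
      rw [Finset.sum_comm]
      simp only [Finset.sum_ite_eq, Finset.mem_univ, if_true, hT', Finset.sum_const,
        Finset.card_univ, nsmul_eq_mul, hcard]
      ring
    simp only [hx]
    rw [← Finset.mul_sum]
    ring
  rw [hsum, Finset.prod_mul_distrib] at h
  refine (mul_left_cancel₀ (mul_ne_zero ?_ ?_) h).symm <;>
  exact Finset.prod_ne_zero_iff.2 fun m _ => by exact_mod_cast Fintype.card_ne_zero

end Links

/-! ### Scalar products of spin-network states -/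

section Networks

variable {N L : Type*} [Fintype N] [Fintype L] [DecidableEq L] (Γ : FourValentGraph N L)

/-- The values of the spinor indices on all half-links. -/
abbrev HalfLinkIndices (L : Type*) (k : L → ℕ) : Type _ :=
  (h : L × Bool) → (Bool × Fin (k h.1) → Fin 2)

/-- The product of the tensors at the nodes, as a function of the indices on the half-links. -/
def nodeTensor (k : L → ℕ) (i : ∀ n, Spinors (Slot (Γ.atNode k n))) (A : HalfLinkIndices L k) :
    ℂ :=
  ∏ n, i n (fun s => A (Γ.leg.symm (n, s.1)) s.2)

theorem contraction_eq (k : L → ℕ) (i : ∀ n, Spinors (Slot (Γ.atNode k n))) (G : L → Spin4) :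
    contraction Γ k i G = ∑ A : HalfLinkIndices L k,
      (∏ l, ∏ s : Bool × Fin (k l), (epsilon * (chiral (G l) s.1 : Matrix (Fin 2) (Fin 2) ℂ))
        (A (l, false) s) (A (l, true) s)) * nodeTensor Γ k i A := rfl

/-- Indices on the half-links are the same as indices on the legs of the nodes. -/
def legEquiv (k : L → ℕ) :
    HalfLinkIndices L k ≃ ∀ n, (Slot (Γ.atNode k n) → Fin 2) :=
  (Equiv.piCongrLeft' (fun h : L × Bool => Bool × Fin (k h.1) → Fin 2) Γ.leg).trans
    { toFun := fun B n s => B (n, s.1) s.2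
      invFun := fun C x s => C x.1 ⟨x.2, s⟩
      left_inv := fun _ => rfl
      right_inv := fun _ => rfl }

theorem nodeTensor_eq (k : L → ℕ) (i : ∀ n, Spinors (Slot (Γ.atNode k n)))
    (A : HalfLinkIndices L k) : nodeTensor Γ k i A = ∏ n, i n (legEquiv Γ k A n) := rfl

theorem sum_conj_nodeTensor_mul (k : L → ℕ) (i i' : ∀ n, Spinors (Slot (Γ.atNode k n))) :
    ∑ A, conj (nodeTensor Γ k i A) * nodeTensor Γ k i' A = ∏ n, inner ℂ (i n) (i' n) := by
  classical
  simp only [nodeTensor_eq, map_prod, ← Finset.prod_mul_distrib, PiLp.inner_apply,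
    RCLike.inner_apply]
  rw [Fintype.prod_sum]
  refine Fintype.sum_equiv (legEquiv Γ k) _ _ fun A => Finset.prod_congr rfl fun n _ => ?_
  exact mul_comm _ _

theorem nodeTensor_comp (k : L → ℕ) (i : ∀ n, Spinors (Slot (Γ.atNode k n)))
    (r : ∀ h : L × Bool, Equiv.Perm (Bool × Fin (k h.1)))
    (hi : ∀ n B, i n (fun s => B ⟨s.1, r (Γ.leg.symm (n, s.1)) s.2⟩) = i n B)
    (A : HalfLinkIndices L k) :
    nodeTensor Γ k i (fun h s => A h (r h s)) = nodeTensor Γ k i A :=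
  Finset.prod_congr rfl fun n _ => hi n (legEquiv Γ k A n)

/-- Here a permutation may mix chiralities, unlike for simple tensors. So a link counts as one
representation with `2 * k l` indices in the `SO(3)` case and as two with `k l` indices each in the
`SO(4)` case. -/
theorem nodeTensor_comp_of_topSpace (k : L → ℕ) {i : ∀ n, Spinors (Slot (Γ.atNode k n))}
    (hi : ∀ n, i n ∈ topSpace (Γ.atNode k n))
    (r : ∀ h : L × Bool, Equiv.Perm (Bool × Fin (k h.1))) (A : HalfLinkIndices L k) :
    nodeTensor Γ k i (fun h s => A h (r h s)) = nodeTensor Γ k i A :=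
  nodeTensor_comp Γ k i r (fun n => hi n
    (Equiv.sigmaCongrRight fun a => r (Γ.leg.symm (n, a))) fun _ => rfl) A

theorem nodeTensor_comp_of_simpleSpace (k : L → ℕ) {i : ∀ n, Spinors (Slot (Γ.atNode k n))}
    (hi : ∀ n, i n ∈ simpleSpace (Γ.atNode k n))
    (r : ∀ h : L × Bool, Bool → Equiv.Perm (Fin (k h.1))) (A : HalfLinkIndices L k) :
    nodeTensor Γ k i (fun h s => A h (s.1, r h s.1 s.2)) = nodeTensor Γ k i A :=
  nodeTensor_comp Γ k i (fun h => Equiv.prodShear (Equiv.refl _) (r h)) (fun n => hi n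
    (Equiv.sigmaCongrRight fun a => Equiv.prodShear (Equiv.refl _) (r (Γ.leg.symm (n, a))))
    fun _ => rfl) A

/-- Indices grouped by links. -/
def linkEquiv₃ (k : L → ℕ) :
    (∀ l, Bool → Bool × Fin (k l) → Fin 2) ≃ HalfLinkIndices L k where
  toFun x h := x h.1 h.2
  invFun A l b := A (l, b)
  left_inv _ := rfl
  right_inv _ := rfl

/-- Indices grouped by links and chiralities. -/
def linkEquiv₄ (k : L → ℕ) :
    (∀ m : L × Bool, Bool → Fin (k m.1) → Fin 2) ≃ HalfLinkIndices L k where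
  toFun x h s := x (h.1, s.1) h.2 s.2
  invFun A m b j := A (m.1, b) (m.2, j)
  left_inv _ := rfl
  right_inv _ := rfl

theorem contraction₃_eq_sum (k : L → ℕ) (i : ∀ n, Spinors (Slot (Γ.atNode k n))) (g : L → SU2) :
    contraction₃ Γ k i g = ∑ x : ∀ l, Bool → Bool × Fin (k l) → Fin 2,
      (∏ l, piKron (fun _ => epsilon * (g l : Matrix (Fin 2) (Fin 2) ℂ)) (x l false) (x l true)) *
        nodeTensor Γ k i (linkEquiv₃ k x) := by
  rw [contraction₃, contraction_eq]
  refine (Fintype.sum_equiv (linkEquiv₃ k) _ _ fun x => ?_).symm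
  simp only [chiral_diag]
  rfl

theorem contraction_eq_sum (k : L → ℕ) (i : ∀ n, Spinors (Slot (Γ.atNode k n))) (G : L → Spin4) :
    contraction Γ k i G = ∑ x : ∀ m : L × Bool, Bool → Fin (k m.1) → Fin 2,
      (∏ m : L × Bool, piKron (fun _ => epsilon * (chiral (G m.1) m.2 : Matrix (Fin 2) (Fin 2) ℂ))
        (x m false) (x m true)) * nodeTensor Γ k i (linkEquiv₄ k x) := by
  rw [contraction_eq]
  refine (Fintype.sum_equiv (linkEquiv₄ k) _ _ fun x => ?_).symm
  simp only [Fintype.prod_prod_type]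
  rfl

theorem integral_conj_sum_mul_sum {X Y Z : Type*} [Fintype X] [Fintype Y] [TopologicalSpace Z]
    [CompactSpace Z] [T2Space Z] [MeasurableSpace Z] [OpensMeasurableSpace Z] (μ : Measure Z)
    [IsFiniteMeasure μ] {a : X → Z → ℂ} {b : Y → Z → ℂ} (ha : ∀ x, Continuous (a x))
    (hb : ∀ y, Continuous (b y)) (T : X → ℂ) (T' : Y → ℂ) :
    ∫ z, conj (∑ x, a x z * T x) * ∑ y, b y z * T' y ∂μ =
      ∑ x, ∑ y, conj (T x) * T' y * ∫ z, conj (a x z) * b y z ∂μ := by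
  have hint (x : X) (y : Y) : Integrable (fun z => conj (T x) * T' y * (conj (a x z) * b y z)) μ :=
    integrable_of_continuous (continuous_const.mul
      ((Complex.continuous_conj.comp (ha x)).mul (hb y)))
  have hz (z : Z) : conj (∑ x, a x z * T x) * ∑ y, b y z * T' y =
      ∑ x, ∑ y, conj (T x) * T' y * (conj (a x z) * b y z) := by
    rw [map_sum, Finset.sum_mul_sum]
    refine Finset.sum_congr rfl fun x _ => Finset.sum_congr rfl fun y _ => ?_
    rw [map_mul]
    ring
  simp only [hz]
  rw [integral_finsetSum _ fun x _ => integrable_finsetSum _ fun y _ => hint x y]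
  refine Finset.sum_congr rfl fun x _ => ?_
  rw [integral_finsetSum _ fun y _ => hint x y]
  exact Finset.sum_congr rfl fun y _ => integral_const_mul _ _

theorem integral_conj_contraction₃_mul (k k' : L → ℕ) (i : ∀ n, Spinors (Slot (Γ.atNode k n)))
    (i' : ∀ n, Spinors (Slot (Γ.atNode k' n))) :
    ∫ g : L → SU2, conj (contraction₃ Γ k i g) * contraction₃ Γ k' i' g
        ∂(Measure.pi fun _ : L => haarSU2) =
      ∑ x : ∀ l, Bool → Bool × Fin (k l) → Fin 2, ∑ x' : ∀ l, Bool → Bool × Fin (k' l) → Fin 2,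
        conj (nodeTensor Γ k i (linkEquiv₃ k x)) * nodeTensor Γ k' i' (linkEquiv₃ k' x') *
          ∏ l, linkKernel (x l false) (x l true) (x' l false) (x' l true) := by
  simp only [contraction₃_eq_sum]
  rw [integral_conj_sum_mul_sum]
  · refine Finset.sum_congr rfl fun x _ => Finset.sum_congr rfl fun x' _ => ?_
    congr 1
    simp only [map_prod, ← Finset.prod_mul_distrib]
    exact integral_fintype_prod_eq_prod (μ := fun _ : L => haarSU2)
      fun l (g : SU2) => conj (piKron (fun _ => epsilon * (g : Matrix (Fin 2) (Fin 2) ℂ))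
        (x l false) (x l true)) * piKron (fun _ => epsilon * (g : Matrix (Fin 2) (Fin 2) ℂ))
        (x' l false) (x' l true)
  · exact fun x => continuous_finsetProd _ fun l _ =>
      (continuous_piKron_epsilon _ _).comp (continuous_apply l)
  · exact fun x => continuous_finsetProd _ fun l _ =>
      (continuous_piKron_epsilon _ _).comp (continuous_apply l)

theorem continuous_chiral_apply (m : L × Bool) :
    Continuous fun G : L → Spin4 => chiral (G m.1) m.2 := by
  obtain ⟨l, b⟩ := m
  cases b
  · exact continuous_snd.comp (continuous_apply l)
  · exact continuous_fst.comp (continuous_apply l)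

/-- For integration, each `Spin4` link is two independent `SU2` links, one for each chirality. -/
theorem integral_prod_chiral (F : L × Bool → SU2 → ℂ) :
    ∫ G : L → Spin4, ∏ m : L × Bool, F m (chiral (G m.1) m.2)
      ∂(Measure.pi fun _ : L => haarSpin4) = ∏ m, ∫ g, F m g ∂haarSU2 := by
  simp only [Fintype.prod_prod_type, Fintype.prod_bool]
  refine (integral_fintype_prod_eq_prod (μ := fun _ : L => haarSpin4)
    fun l (V : Spin4) => F (l, true) V.1 * F (l, false) V.2).trans ?_
  exact Finset.prod_congr rfl fun l _ => integral_prod_mul _ _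

theorem integral_conj_contraction_mul (k k' : L → ℕ) (i : ∀ n, Spinors (Slot (Γ.atNode k n)))
    (i' : ∀ n, Spinors (Slot (Γ.atNode k' n))) :
    ∫ G : L → Spin4, conj (contraction Γ k i G) * contraction Γ k' i' G
        ∂(Measure.pi fun _ : L => haarSpin4) =
      ∑ x : ∀ m : L × Bool, Bool → Fin (k m.1) → Fin 2,
        ∑ x' : ∀ m : L × Bool, Bool → Fin (k' m.1) → Fin 2,
        conj (nodeTensor Γ k i (linkEquiv₄ k x)) * nodeTensor Γ k' i' (linkEquiv₄ k' x') *
          ∏ m, linkKernel (x m false) (x m true) (x' m false) (x' m true) := by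
  simp only [contraction_eq_sum]
  rw [integral_conj_sum_mul_sum]
  · refine Finset.sum_congr rfl fun x _ => Finset.sum_congr rfl fun x' _ => ?_
    congr 1
    simp only [map_prod, ← Finset.prod_mul_distrib]
    exact integral_prod_chiral
      fun m (g : SU2) => conj (piKron (fun _ => epsilon * (g : Matrix (Fin 2) (Fin 2) ℂ))
        (x m false) (x m true)) * piKron (fun _ => epsilon * (g : Matrix (Fin 2) (Fin 2) ℂ))
        (x' m false) (x' m true)
  · exact fun x => continuous_finsetProd _ fun m _ =>
      (continuous_piKron_epsilon _ _).comp (continuous_chiral_apply m)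
  · exact fun x => continuous_finsetProd _ fun m _ =>
      (continuous_piKron_epsilon _ _).comp (continuous_chiral_apply m)

variable {Γ}

theorem inner_ket₃_eq (k k' : L → ℕ) (i : ∀ n, Spinors (Slot (Γ.atNode k n)))
    (i' : ∀ n, Spinors (Slot (Γ.atNode k' n))) :
    inner ℂ (ket₃ Γ k i) (ket₃ Γ k' i') =
      (∏ l, (√(2 * k l + 1) : ℂ)) * (∏ l, (√(2 * k' l + 1) : ℂ)) *
      ∫ g : L → SU2, conj (contraction₃ Γ k i g) * contraction₃ Γ k' i' g
        ∂(Measure.pi fun _ : L => haarSU2) := by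
  unfold ket₃
  rw [inner_smul_left, inner_smul_right, ContinuousMap.inner_toLp, map_prod, ← mul_assoc]
  simp only [Complex.conj_ofReal, ContinuousMap.coe_mk, mul_comm (contraction₃ _ _ _ _)]

theorem inner_ket₄_eq (k k' : L → ℕ) (i : ∀ n, Spinors (Slot (Γ.atNode k n)))
    (i' : ∀ n, Spinors (Slot (Γ.atNode k' n))) :
    inner ℂ (ket₄ Γ k i) (ket₄ Γ k' i') =
      (∏ l, (√((k l + 1) ^ 2) : ℂ)) * (∏ l, (√((k' l + 1) ^ 2) : ℂ)) *
      ∫ G : L → Spin4, conj (contraction Γ k i G) * contraction Γ k' i' G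
        ∂(Measure.pi fun _ : L => haarSpin4) := by
  unfold ket₄
  rw [inner_smul_left, inner_smul_right, ContinuousMap.inner_toLp, map_prod, ← mul_assoc]
  simp only [Complex.conj_ofReal, ContinuousMap.coe_mk, mul_comm (contraction _ _ _ _)]

theorem inner_ket₃_of_ne {k k' : L → ℕ} (hk : k ≠ k') {i : ∀ n, Spinors (Slot (Γ.atNode k n))}
    {i' : ∀ n, Spinors (Slot (Γ.atNode k' n))} (hi : ∀ n, i n ∈ topSpace (Γ.atNode k n))
    (hi' : ∀ n, i' n ∈ topSpace (Γ.atNode k' n)) :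
    inner ℂ (ket₃ Γ k i) (ket₃ Γ k' i') = 0 := by
  obtain ⟨l, hl⟩ := Function.ne_iff.1 hk
  rw [inner_ket₃_eq, integral_conj_contraction₃_mul]
  refine mul_eq_zero_of_right _ ?_
  exact sum_linkKernel_links_of_card_ne (m := l)
    (T := fun x => nodeTensor Γ k i (linkEquiv₃ k x))
    (T' := fun x => nodeTensor Γ k' i' (linkEquiv₃ k' x))
    (fun r x => nodeTensor_comp_of_topSpace Γ k hi (fun h => r h.1 h.2) (linkEquiv₃ k x))
    (fun r x => nodeTensor_comp_of_topSpace Γ k' hi' (fun h => r h.1 h.2) (linkEquiv₃ k' x))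
    (by simpa using hl)

/-- Schur orthogonality produces `1 / (2 k l + 1)` for each link, cancelled by the normalisation,
and leaves the pairing of the node tensors. -/
theorem inner_ket₃ {k : L → ℕ} {i i' : ∀ n, Spinors (Slot (Γ.atNode k n))}
    (hi : ∀ n, i n ∈ topSpace (Γ.atNode k n)) (hi' : ∀ n, i' n ∈ topSpace (Γ.atNode k n)) :
    inner ℂ (ket₃ Γ k i) (ket₃ Γ k i') = ∏ n, inner ℂ (i n) (i' n) := by
  rw [inner_ket₃_eq, integral_conj_contraction₃_mul]
  rw [sum_linkKernel_links (T := fun x => nodeTensor Γ k i (linkEquiv₃ k x))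
    (T' := fun x => nodeTensor Γ k i' (linkEquiv₃ k x))
    (fun r x => nodeTensor_comp_of_topSpace Γ k hi (fun h => r h.1 h.2) (linkEquiv₃ k x))
    (fun r x => nodeTensor_comp_of_topSpace Γ k hi' (fun h => r h.1 h.2) (linkEquiv₃ k x)),
    (linkEquiv₃ k).sum_comp fun A => conj (nodeTensor Γ k i A) * nodeTensor Γ k i' A,
    sum_conj_nodeTensor_mul, ← mul_assoc, ← Finset.prod_mul_distrib, ← Finset.prod_mul_distrib]
  rw [Finset.prod_eq_one, one_mul]
  intro l _
  have h : (0 : ℝ) ≤ 2 * k l + 1 := by positivity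
  rw [← Complex.ofReal_mul, Real.mul_self_sqrt h, Fintype.card_prod, Fintype.card_bool,
    Fintype.card_fin]
  push_cast
  exact mul_inv_cancel₀ (by exact_mod_cast Nat.succ_ne_zero (2 * k l))

theorem inner_ket₄_of_ne {k k' : L → ℕ} (hk : k ≠ k') {i : ∀ n, Spinors (Slot (Γ.atNode k n))}
    {i' : ∀ n, Spinors (Slot (Γ.atNode k' n))} (hi : ∀ n, i n ∈ simpleSpace (Γ.atNode k n))
    (hi' : ∀ n, i' n ∈ simpleSpace (Γ.atNode k' n)) :
    inner ℂ (ket₄ Γ k i) (ket₄ Γ k' i') = 0 := by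
  obtain ⟨l, hl⟩ := Function.ne_iff.1 hk
  rw [inner_ket₄_eq, integral_conj_contraction_mul]
  refine mul_eq_zero_of_right _ ?_
  -- Either chirality of the link `l` would do.
  exact sum_linkKernel_links_of_card_ne (m := (l, true))
    (T := fun x => nodeTensor Γ k i (linkEquiv₄ k x))
    (T' := fun x => nodeTensor Γ k' i' (linkEquiv₄ k' x))
    (fun r x => nodeTensor_comp_of_simpleSpace Γ k hi (fun h b => r (h.1, b) h.2)
      (linkEquiv₄ k x))
    (fun r x => nodeTensor_comp_of_simpleSpace Γ k' hi' (fun h b => r (h.1, b) h.2)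
      (linkEquiv₄ k' x))
    (by simpa using hl)

/-- Each chirality of a link contributes `1 / (k l + 1)`. -/
theorem inner_ket₄ {k : L → ℕ} {i i' : ∀ n, Spinors (Slot (Γ.atNode k n))}
    (hi : ∀ n, i n ∈ simpleSpace (Γ.atNode k n))
    (hi' : ∀ n, i' n ∈ simpleSpace (Γ.atNode k n)) :
    inner ℂ (ket₄ Γ k i) (ket₄ Γ k i') = ∏ n, inner ℂ (i n) (i' n) := by
  rw [inner_ket₄_eq, integral_conj_contraction_mul]
  rw [sum_linkKernel_links (T := fun x => nodeTensor Γ k i (linkEquiv₄ k x))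
    (T' := fun x => nodeTensor Γ k i' (linkEquiv₄ k x))
    (fun r x => nodeTensor_comp_of_simpleSpace Γ k hi (fun h b => r (h.1, b) h.2)
      (linkEquiv₄ k x))
    (fun r x => nodeTensor_comp_of_simpleSpace Γ k hi' (fun h b => r (h.1, b) h.2)
      (linkEquiv₄ k x)),
    (linkEquiv₄ k).sum_comp fun A => conj (nodeTensor Γ k i A) * nodeTensor Γ k i' A,
    sum_conj_nodeTensor_mul, ← mul_assoc, Fintype.prod_prod_type, ← Finset.prod_mul_distrib,
    ← Finset.prod_mul_distrib]
  rw [Finset.prod_eq_one, one_mul]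
  intro l _
  have h : (0 : ℝ) ≤ k l + 1 := by positivity
  have h0 : (k l + 1 : ℂ) ≠ 0 := by exact_mod_cast Nat.succ_ne_zero (k l)
  rw [Real.sqrt_sq h, Fintype.prod_bool, Fintype.card_fin]
  push_cast
  field_simp

end Networks

/-! ### Group averaging at the nodes -/

section Averaging

variable {N L : Type*} [Fintype N] [Fintype L] [DecidableEq L] (Γ : FourValentGraph N L)

theorem piKron_transpose {ι : Type*} [Fintype ι] (h : ι → Matrix (Fin 2) (Fin 2) ℂ) :
    (piKron h).transpose = piKron fun x => (h x).transpose := rfl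

theorem prod_piKron_legEquiv (k : L → ℕ) (W : N → Bool → Matrix (Fin 2) (Fin 2) ℂ)
    (A B : HalfLinkIndices L k) :
    ∏ n, piKron (fun s : Slot (Γ.atNode k n) => W n s.2.1) (legEquiv Γ k A n) (legEquiv Γ k B n) =
      ∏ h : L × Bool, piKron (fun s => W (Γ.leg h).1 s.1) (A h) (B h) := by
  rw [← Γ.leg.symm.prod_comp, Fintype.prod_prod_type]
  refine Finset.prod_congr rfl fun n _ => ?_
  rw [piKron_apply, Fintype.prod_sigma]
  refine Finset.prod_congr rfl fun a _ => ?_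
  rw [Equiv.apply_symm_apply]
  rfl

/-- A gauge transformation of the group elements acts on the tensors at the nodes. -/
theorem contraction_gauge (k : L → ℕ) (i : ∀ n, Spinors (Slot (Γ.atNode k n))) (G : L → Spin4)
    (V : N → Spin4) :
    contraction Γ k i (fun l => V (Γ.source l) * G l * (V (Γ.target l))⁻¹) =
      contraction Γ k (fun n => spinAct (V n)⁻¹ (i n)) G := by
  classical
  set W : N → Bool → Matrix (Fin 2) (Fin 2) ℂ := fun n b => (chiral (V n)⁻¹ b : SU2) with hW
  have hnode (A : HalfLinkIndices L k) : nodeTensor Γ k (fun n => spinAct (V n)⁻¹ (i n)) A =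
      ∑ B, (∏ h : L × Bool, piKron (fun s => W (Γ.leg h).1 s.1) (A h) (B h)) *
        nodeTensor Γ k i B := by
    simp only [nodeTensor_eq, spinAct, act_apply]
    rw [Fintype.prod_sum, ← (legEquiv Γ k).sum_comp]
    refine Finset.sum_congr rfl fun B _ => ?_
    rw [← prod_piKron_legEquiv, Finset.prod_mul_distrib]
  -- The source index is lowered, so the node matrix enters transposed there; unitarity makes it the
  -- conjugate of `g`, and moving it past ε gives `g`.
  have hε (g g' h : SU2) : ((g⁻¹ : SU2) : Matrix (Fin 2) (Fin 2) ℂ).transpose *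
      (epsilon * (h : Matrix (Fin 2) (Fin 2) ℂ)) * ((g' : SU2) : Matrix (Fin 2) (Fin 2) ℂ) =
      epsilon * ((g * h * g' : SU2) : Matrix (Fin 2) (Fin 2) ℂ) := by
    have : ((g⁻¹ : SU2) : Matrix (Fin 2) (Fin 2) ℂ).transpose =
        (g : Matrix (Fin 2) (Fin 2) ℂ).map conj := rfl
    rw [this, ← mul_assoc, ← epsilon_mul_SU2, mul_assoc, mul_assoc]
    rw [Submonoid.coe_mul, Submonoid.coe_mul, mul_assoc]
  -- The node matrices at both ends of a link are absorbed into its group element.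
  have hlink (l : L) (b b' : Bool × Fin (k l) → Fin 2) :
      ∑ x : Bool → Bool × Fin (k l) → Fin 2,
        piKron (fun s => epsilon * (chiral (G l) s.1 : Matrix (Fin 2) (Fin 2) ℂ))
          (x false) (x true) *
        (piKron (fun s => W (Γ.target l) s.1) (x true) b' *
          piKron (fun s => W (Γ.source l) s.1) (x false) b) =
      piKron (fun s => epsilon * (chiral (V (Γ.source l) * G l * (V (Γ.target l))⁻¹) s.1 :
        Matrix (Fin 2) (Fin 2) ℂ)) b b' := by
    have hm : (fun s : Bool × Fin (k l) => epsilon *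
        (chiral (V (Γ.source l) * G l * (V (Γ.target l))⁻¹) s.1 : Matrix (Fin 2) (Fin 2) ℂ)) =
        fun s => (W (Γ.source l) s.1).transpose *
          (epsilon * (chiral (G l) s.1 : Matrix (Fin 2) (Fin 2) ℂ)) * W (Γ.target l) s.1 := by
      funext s
      rw [chiral_mul, chiral_mul, ← hε]
      simp only [hW, chiral_inv]
    rw [hm, piKron_mul (fun s : Bool × Fin (k l) => (W (Γ.source l) s.1).transpose *
        (epsilon * (chiral (G l) s.1 : Matrix (Fin 2) (Fin 2) ℂ))),
      piKron_mul (fun s : Bool × Fin (k l) => (W (Γ.source l) s.1).transpose),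
      ← piKron_transpose, Matrix.mul_apply, sum_bool_arrow,
      Finset.sum_comm]
    refine Finset.sum_congr rfl fun c _ => ?_
    rw [Matrix.mul_apply, Finset.sum_mul]
    refine Finset.sum_congr rfl fun a _ => ?_
    simp only [cond_false, cond_true, Matrix.transpose_apply]
    ring
  rw [contraction_eq, contraction_eq]
  simp only [hnode, Finset.mul_sum]
  rw [Finset.sum_comm]
  refine Finset.sum_congr rfl fun B _ => ?_
  simp only [← mul_assoc, ← Finset.sum_mul]
  congr 1
  refine Eq.trans (Finset.prod_congr rfl fun l _ =>
    (hlink l (B (l, false)) (B (l, true))).symm) ?_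
  rw [Fintype.prod_sum]
  refine Fintype.sum_equiv (linkEquiv₃ k) _ _ fun x => ?_
  rw [Fintype.prod_prod_type, ← Finset.prod_mul_distrib]
  refine Finset.prod_congr rfl fun l _ => ?_
  rw [Fintype.prod_bool]
  rfl

/-- The contraction is multilinear in the node tensors, so the average over all nodes factorises
into averages of `V⁻¹` at single nodes. -/
theorem contraction_fEmb (k : L → ℕ) (i : ∀ n, Spinors (Slot (Γ.atNode k n))) (G : L → Spin4) :
    contraction Γ k (fun n => fEmb (i n)) G =
      ∫ V : N → Spin4, contraction Γ k i (fun l => V (Γ.source l) * G l * (V (Γ.target l))⁻¹)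
        ∂(Measure.pi fun _ : N => haarSpin4) := by
  have hcomp (n : N) (B : Slot (Γ.atNode k n) → Fin 2) :
      fEmb (i n) B = ∫ V : Spin4, spinAct V⁻¹ (i n) B ∂haarSpin4 := by
    rw [← integral_spinAct_inv]
    exact ((EuclideanSpace.proj (𝕜 := ℂ) B).integral_comp_comm
      (integrable_of_continuous ((continuous_spinAct (i n)).comp continuous_inv))).symm
  have hcont (n : N) (B : Slot (Γ.atNode k n) → Fin 2) :
      Continuous fun V : N → Spin4 => spinAct (V n)⁻¹ (i n) B :=
    (EuclideanSpace.proj (𝕜 := ℂ) B).continuous.comp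
      ((continuous_spinAct (i n)).comp (continuous_apply n).inv)
  have hint (A : HalfLinkIndices L k) (c : ℂ) : Integrable (fun V : N → Spin4 =>
      c * nodeTensor Γ k (fun n => spinAct (V n)⁻¹ (i n)) A)
      (Measure.pi fun _ : N => haarSpin4) :=
    integrable_of_continuous (continuous_const.mul
      (continuous_finsetProd _ fun n _ => hcont n _))
  simp only [contraction_gauge]
  simp only [contraction_eq]
  rw [integral_finsetSum _ fun A _ => hint A _]
  refine Finset.sum_congr rfl fun A _ => ?_
  rw [integral_const_mul]
  congr 1
  rw [nodeTensor_eq]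
  simp only [hcomp, nodeTensor_eq]
  exact (integral_fintype_prod_eq_prod (μ := fun _ : N => haarSpin4)
    fun n (V : Spin4) => spinAct V⁻¹ (i n) (legEquiv Γ k A n)).symm

end Averaging

/-! ### Hilbert space lemmas -/

section Hilbert

variable {E E' : Type*} [NormedAddCommGroup E] [InnerProductSpace ℂ E]
  [NormedAddCommGroup E'] [InnerProductSpace ℂ E']

theorem inner_linearCombination_eq {X Y : Type*} {u : X → E} {w : Y → E} {u' : X → E'}
    {w' : Y → E'} (h : ∀ x y, inner ℂ (u x) (w y) = inner ℂ (u' x) (w' y)) (c : X →₀ ℂ)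
    (d : Y →₀ ℂ) :
    inner ℂ (Finsupp.linearCombination ℂ u c) (Finsupp.linearCombination ℂ w d) =
      inner ℂ (Finsupp.linearCombination ℂ u' c) (Finsupp.linearCombination ℂ w' d) := by
  simp only [Finsupp.linearCombination_apply, Finsupp.sum, sum_inner, inner_sum, inner_smul_left,
    inner_smul_right, h]

theorem eq_zero_of_mem_closure_span {s : Set E} {ψ : E}
    (hψ : ψ ∈ (Submodule.span ℂ s).topologicalClosure) (h : ∀ y ∈ s, inner ℂ y ψ = 0) :
    ψ = 0 := by
  have h1 : ψ ∈ (Submodule.span ℂ s)ᗮ := by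
    refine (Submodule.mem_orthogonal _ _).2 fun y hy => ?_
    induction hy using Submodule.span_induction with
    | mem y hy => exact h y hy
    | zero => exact inner_zero_left _
    | add y z _ _ hy hz => rw [inner_add_left, hy, hz, add_zero]
    | smul c y _ hy => rw [inner_smul_left, hy, mul_zero]
  rw [← Submodule.orthogonal_closure] at h1
  exact inner_self_eq_zero.1 ((Submodule.mem_orthogonal _ _).1 h1 ψ hψ)

/-- The bases together are orthonormal and span the algebraic sum, which is dense in its closure. -/
theorem exists_hilbertBasis [CompleteSpace E] {ι : Type*} {J : ι → Type*} [∀ k, Fintype (J k)]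
    (A : ι → Submodule ℂ E) (hA : Pairwise fun k k' => A k ⟂ A k')
    (b : ∀ k, OrthonormalBasis (J k) ℂ (A k)) :
    ∃ B : HilbertBasis (Σ k, J k) ℂ (⨆ k, A k).topologicalClosure,
      ∀ x, (B x : E) = b x.1 x.2 := by
  have hle (k : ι) : A k ≤ (⨆ k, A k).topologicalClosure :=
    (le_iSup A k).trans (Submodule.le_topologicalClosure _)
  let v : (Σ k, J k) → (⨆ k, A k).topologicalClosure :=
    fun x => ⟨b x.1 x.2, hle x.1 (b x.1 x.2).2⟩
  have hE : Orthonormal ℂ fun x : Σ k, J k => (b x.1 x.2 : E) :=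
    (OrthogonalFamily.of_pairwise hA).orthonormal_sigma_orthonormal fun k => (b k).orthonormal
  have hv : Orthonormal ℂ v := by
    rw [← LinearIsometry.orthonormal_comp_iff (⨆ k, A k).topologicalClosure.subtypeₗᵢ]
    exact hE
  have hmap : (Submodule.span ℂ (Set.range v)).map (⨆ k, A k).topologicalClosure.subtype =
      ⨆ k, A k := by
    rw [Submodule.map_span, ← Set.range_comp]
    apply le_antisymm
    · rw [Submodule.span_le]
      rintro _ ⟨x, rfl⟩
      exact Submodule.mem_iSup_of_mem x.1 (b x.1 x.2).2
    · refine iSup_le fun k => ?_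
      have h1 := congrArg (Submodule.map (A k).subtype) (b k).toBasis.span_eq
      rw [Submodule.map_span, Submodule.map_top, Submodule.range_subtype, ← Set.range_comp] at h1
      rw [← h1, Submodule.span_le]
      rintro _ ⟨j, rfl⟩
      refine Submodule.subset_span ⟨⟨k, j⟩, ?_⟩
      simp [v]
  have hd : ⊤ ≤ (Submodule.span ℂ (Set.range v)).topologicalClosure := by
    intro ψ _
    change ψ ∈ closure ((Submodule.span ℂ (Set.range v) : Submodule ℂ _) : Set _)
    rw [closure_subtype]
    have h2 : ((↑) : (⨆ k, A k).topologicalClosure → E) ''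
        (Submodule.span ℂ (Set.range v) : Set _) = ((⨆ k, A k : Submodule ℂ E) : Set E) :=
      congrArg (fun S : Submodule ℂ E => (S : Set E)) hmap
    rw [h2]
    exact ψ.2
  refine ⟨HilbertBasis.mk hv hd, fun x => ?_⟩
  rw [HilbertBasis.coe_mk]

theorem coe_apply_mem_of_orthonormalBasis {C₁ : Submodule ℂ E} {C₂ : Submodule ℂ E'}
    {J : Type*} [Fintype J] {A₁ : Submodule ℂ E} {A₂ : Submodule ℂ E'}
    (a₁ : OrthonormalBasis J ℂ A₁) (a₂ : J → A₂) (w : J → C₁) (T : C₁ →ₗ[ℂ] C₂)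
    (hw : ∀ j, (w j : E) = a₁ j) (hT : ∀ j, (T (w j) : E') = a₂ j) (ψ : C₁)
    (hψ : (ψ : E) ∈ A₁) : (T ψ : E') ∈ A₂ := by
  have h1 : ψ = ∑ j, (a₁.repr ⟨ψ, hψ⟩) j • w j := by
    apply Subtype.ext
    have := congrArg (Subtype.val) (a₁.sum_repr ⟨ψ, hψ⟩)
    simp only [Submodule.coe_sum, Submodule.coe_smul] at this ⊢
    simp only [hw, this]
  rw [h1, map_sum, Submodule.coe_sum]
  refine Submodule.sum_mem _ fun j _ => ?_
  rw [map_smul, Submodule.coe_smul, hT]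
  exact Submodule.smul_mem _ _ (a₂ j).2

/-- Hilbert sums of finite-dimensional spaces of the same dimensions are isometric. -/
theorem exists_isometry_of_finrank_eq [CompleteSpace E] [CompleteSpace E'] {ι : Type*}
    (A : ι → Submodule ℂ E) (B : ι → Submodule ℂ E') (hA : Pairwise fun k k' => A k ⟂ A k')
    (hB : Pairwise fun k k' => B k ⟂ B k') [∀ k, FiniteDimensional ℂ (A k)]
    [∀ k, FiniteDimensional ℂ (B k)]
    (h : ∀ k, Module.finrank ℂ (A k) = Module.finrank ℂ (B k)) :
    ∃ U : (⨆ k, A k).topologicalClosure ≃ₗᵢ[ℂ] (⨆ k, B k).topologicalClosure,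
      ∀ k (ψ : (⨆ k, A k).topologicalClosure), (ψ : E) ∈ A k ↔ (U ψ : E') ∈ B k := by
  let a (k : ι) := stdOrthonormalBasis ℂ (A k)
  -- Equal dimensions give both bases one index type, so the two Hilbert bases share their index
  -- set.
  let b (k : ι) := (stdOrthonormalBasis ℂ (B k)).reindex (finCongr (h k).symm)
  obtain ⟨va, ha⟩ := exists_hilbertBasis A hA a
  obtain ⟨vb, hb⟩ := exists_hilbertBasis B hB b
  let U := va.repr.trans vb.repr.symm
  have hU (x) : U (va x) = vb x := by
    classical
    change vb.repr.symm (va.repr (va x)) = vb x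
    rw [HilbertBasis.repr_self, HilbertBasis.repr_symm_single]
  have hU' (x) : U.symm (vb x) = va x := by
    rw [← hU, LinearIsometryEquiv.symm_apply_apply]
  refine ⟨U, fun k ψ => ⟨fun hψ => ?_, fun hψ => ?_⟩⟩
  · exact coe_apply_mem_of_orthonormalBasis (a k) (b k) (fun j => va ⟨k, j⟩)
      U.toLinearEquiv.toLinearMap
      (fun j => ha ⟨k, j⟩)
      (fun j => (congrArg Subtype.val (hU ⟨k, j⟩)).trans (hb ⟨k, j⟩)) ψ hψ
  · have := coe_apply_mem_of_orthonormalBasis (b k) (a k) (fun j => vb ⟨k, j⟩)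
      U.symm.toLinearEquiv.toLinearMap
      (fun j => hb ⟨k, j⟩)
      (fun j => (congrArg Subtype.val (hU' ⟨k, j⟩)).trans (ha ⟨k, j⟩)) (U ψ) hψ
    have h2 : U.symm (U ψ) = ψ := U.symm_apply_apply ψ
    rw [← h2]
    exact this

end Hilbert

/-! ### The embedding of spin-network states -/

section Embedding

variable {N L : Type*} [Fintype N] [Fintype L] [DecidableEq L] (Γ : FourValentGraph N L)

/-- Labels of the `SO(3)` spin networks with given spins. -/
abbrev NodeIntertwiners (k : L → ℕ) : Type _ :=
  {i : ∀ n, Spinors (Slot (Γ.atNode k n)) // ∀ n, i n ∈ invSO3 (Γ.atNode k n)}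

/-- Labels of the `SO(3)` spin networks. -/
abbrev SpinLabel : Type _ := Σ k : L → ℕ, NodeIntertwiners Γ k

/-- The `SO(3)` spin-network state with a given label. -/
def labelKet₃ (x : SpinLabel Γ) : HSO3 Γ := ⟨ket₃ Γ x.1 x.2.1, ket₃_mem Γ x.1 x.2.1 x.2.2⟩

/-- The image under the embedding of the spin-network state with a given label. -/
def labelKet₄ (x : SpinLabel Γ) : L2SO4 L := ket₄ Γ x.1 fun n => fEmb (x.2.1 n)

variable {Γ}

/-- Reading an `SO(3)` network as an `SO(4)` one, without averaging, preserves inner products: both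
are the product over the nodes, or zero for different spins. -/
theorem inner_ket₃_label (x y : SpinLabel Γ) :
    inner ℂ (labelKet₃ Γ x) (labelKet₃ Γ y) =
      inner ℂ (ket₄ Γ x.1 x.2.1) (ket₄ Γ y.1 y.2.1) := by
  obtain ⟨k, i, hi⟩ := x
  obtain ⟨k', i', hi'⟩ := y
  change inner ℂ (ket₃ Γ k i) (ket₃ Γ k' i') = inner ℂ (ket₄ Γ k i) (ket₄ Γ k' i')
  by_cases h : k = k'
  · subst h
    rw [inner_ket₃ (fun n => (mem_invSO3.1 (hi n)).1) fun n => (mem_invSO3.1 (hi' n)).1,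
      inner_ket₄ (fun n => invSO3_le_simpleSpace (hi n)) fun n => invSO3_le_simpleSpace (hi' n)]
  · rw [inner_ket₃_of_ne h (fun n => (mem_invSO3.1 (hi n)).1) fun n => (mem_invSO3.1 (hi' n)).1,
      inner_ket₄_of_ne h (fun n => invSO3_le_simpleSpace (hi n))
        fun n => invSO3_le_simpleSpace (hi' n)]

theorem inner_labelKet₄_label (x y : SpinLabel Γ) :
    inner ℂ (labelKet₄ Γ x) (labelKet₄ Γ y) = inner ℂ (ket₄ Γ x.1 x.2.1) (labelKet₄ Γ y) := by
  obtain ⟨k, i, hi⟩ := x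
  obtain ⟨k', i', hi'⟩ := y
  change inner ℂ (ket₄ Γ k fun n => fEmb (i n)) (ket₄ Γ k' fun n => fEmb (i' n)) =
    inner ℂ (ket₄ Γ k i) (ket₄ Γ k' fun n => fEmb (i' n))
  have h1 (n) := invSO3_le_simpleSpace (hi n)
  have h2 (n) := fEmb_mem_simpleSpace (invSO3_le_simpleSpace (hi n))
  have h2' (n) := fEmb_mem_simpleSpace (invSO3_le_simpleSpace (hi' n))
  by_cases h : k = k'
  · subst h
    rw [inner_ket₄ h2 h2', inner_ket₄ h1 h2']
    exact Finset.prod_congr rfl fun n _ => inner_fEmb_fEmb _ _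
  · rw [inner_ket₄_of_ne h h2 h2', inner_ket₄_of_ne h h1 h2']

theorem inner_labelKet₄_ket₄ (x : SpinLabel Γ) {k : L → ℕ}
    {I : ∀ n, Spinors (Slot (Γ.atNode k n))} (hI : ∀ n, I n ∈ invSO4 (Γ.atNode k n)) :
    inner ℂ (labelKet₄ Γ x) (ket₄ Γ k I) =
      inner ℂ (labelKet₃ Γ x) (labelKet₃ Γ ⟨k, fun n => piProj (I n),
        fun _ => Submodule.starProjection_apply_mem _ _⟩) := by
  obtain ⟨k', i, hi⟩ := x
  change inner ℂ (ket₄ Γ k' fun n => fEmb (i n)) (ket₄ Γ k I) =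
    inner ℂ (ket₃ Γ k' i) (ket₃ Γ k fun n => piProj (I n))
  have h1 (n) := (mem_invSO3.1 (hi n)).1
  have h2 (n) := fEmb_mem_simpleSpace (invSO3_le_simpleSpace (hi n))
  have h3 (n) := (mem_invSO4.1 (hI n)).1
  have h4 (n) : piProj (I n) ∈ topSpace (Γ.atNode k n) :=
    (mem_invSO3.1 (Submodule.starProjection_apply_mem _ _)).1
  by_cases h : k' = k
  · subst h
    rw [inner_ket₄ h2 h3, inner_ket₃ h1 h4]
    exact Finset.prod_congr rfl fun n _ => inner_fEmb_eq_inner_piProj (hi n) (hI n)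
  · rw [inner_ket₄_of_ne h h2 h3, inner_ket₃_of_ne h h1 h4]

/-- With `a` the unaveraged and `v` the averaged combination, `⟨v, v⟩ = ⟨a, v⟩`, so Cauchy-Schwarz
gives `‖v‖ ≤ ‖a‖`. -/
theorem norm_linearCombination_labelKet₄_le (c : SpinLabel Γ →₀ ℂ) :
    ‖Finsupp.linearCombination ℂ (labelKet₄ Γ) c‖ ≤
      ‖Finsupp.linearCombination ℂ (labelKet₃ Γ) c‖ := by
  set v := Finsupp.linearCombination ℂ (labelKet₄ Γ) c with hv
  set a := Finsupp.linearCombination ℂ (fun x : SpinLabel Γ => ket₄ Γ x.1 x.2.1) c with ha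
  have h1 : ‖Finsupp.linearCombination ℂ (labelKet₃ Γ) c‖ = ‖a‖ := by
    have := inner_linearCombination_eq inner_ket₃_label c c
    exact (norm_eq_sqrt_re_inner (𝕜 := ℂ) _).trans
      ((congrArg (fun z => √(RCLike.re z)) this).trans (norm_eq_sqrt_re_inner (𝕜 := ℂ) _).symm)
  have h2 : inner ℂ v v = inner ℂ a v := inner_linearCombination_eq inner_labelKet₄_label c c
  rw [h1]
  have h3 : ‖v‖ * ‖v‖ ≤ ‖a‖ * ‖v‖ := by
    have h4 := norm_inner_le_norm (𝕜 := ℂ) a v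
    rw [← h2, inner_self_eq_norm_sq_to_K] at h4
    simpa [sq] using h4
  rcases (norm_nonneg v).eq_or_lt with h0 | h0
  · rw [← h0]; exact norm_nonneg _
  · exact le_of_mul_le_mul_right h3 h0

theorem sector₃_eq (k : L → ℕ) : sector₃ Γ k =
    (Submodule.span ℂ (Set.range fun i : NodeIntertwiners Γ k => labelKet₃ Γ ⟨k, i⟩)).map
      (HSO3 Γ).subtype := by
  rw [sector₃, Submodule.map_span, ← Set.range_comp]
  refine congrArg (Submodule.span ℂ) ?_
  ext ψ
  constructor
  · rintro ⟨i, hi, rfl⟩; exact ⟨⟨i, hi⟩, rfl⟩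
  · rintro ⟨⟨i, hi⟩, rfl⟩; exact ⟨i, hi, rfl⟩

theorem span₃_eq : span₃ Γ =
    (Submodule.span ℂ (Set.range (labelKet₃ Γ))).map (HSO3 Γ).subtype := by
  simp only [span₃, sector₃_eq]
  rw [← Submodule.map_iSup, ← Submodule.span_iUnion]
  congr 2
  ext ψ
  simp [Set.mem_iUnion]

theorem topologicalClosure_span_labelKet₃ :
    (Submodule.span ℂ (Set.range (labelKet₃ Γ))).topologicalClosure = ⊤ := by
  refine (Submodule.eq_top_iff'.2 fun ψ => ?_)
  change ψ ∈ closure ((Submodule.span ℂ (Set.range (labelKet₃ Γ)) : Submodule ℂ _) : Set _)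
  rw [closure_subtype]
  have h : ((↑) : HSO3 Γ → L2SO3 L) '' (Submodule.span ℂ (Set.range (labelKet₃ Γ)) : Set _) =
      (span₃ Γ : Set (L2SO3 L)) :=
    congrArg (fun S : Submodule ℂ (L2SO3 L) => (S : Set (L2SO3 L))) span₃_eq.symm
  rw [h]
  exact ψ.2

variable (Γ) in
/-- The embedding of the `SO(3)` spin-network states. -/
theorem exists_embedding : ∃ F : HSO3 Γ →L[ℂ] L2SO4 L, ∀ x, F (labelKet₃ Γ x) = labelKet₄ Γ x := by
  have hd : DenseRange (Finsupp.linearCombination ℂ (labelKet₃ Γ)) := by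
    have := topologicalClosure_span_labelKet₃ (Γ := Γ)
    rw [← Finsupp.range_linearCombination, ← Submodule.dense_iff_topologicalClosure_eq_top] at this
    exact this
  -- The labelled states are linearly dependent, so `F` is defined on formal combinations; the norm
  -- bound makes it well defined and extends it to the closure.
  refine ⟨(Finsupp.linearCombination ℂ (labelKet₄ Γ)).extendOfNorm
    (Finsupp.linearCombination ℂ (labelKet₃ Γ)), fun x => ?_⟩
  have h := LinearMap.extendOfNorm_eq (f := Finsupp.linearCombination ℂ (labelKet₄ Γ)) hd
    ⟨1, fun c => by rw [one_mul]; exact norm_linearCombination_labelKet₄_le c⟩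
    (Finsupp.single x 1)
  simpa using h

theorem eq_of_inner_labelKet₃ {φ ψ : HSO3 Γ}
    (h : ∀ x, inner ℂ (labelKet₃ Γ x) φ = inner ℂ (labelKet₃ Γ x) ψ) : φ = ψ := by
  refine sub_eq_zero.1 (eq_zero_of_mem_closure_span (s := Set.range (labelKet₃ Γ)) ?_ ?_)
  · rw [topologicalClosure_span_labelKet₃]; trivial
  · rintro _ ⟨x, rfl⟩
    rw [inner_sub_right, h, sub_self]

/-! ### Adjoint, kernel and range of `F`. -/

variable {F : HSO3 Γ →L[ℂ] L2SO4 L} (hF : ∀ x, F (labelKet₃ Γ x) = labelKet₄ Γ x)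

include hF

theorem adjoint_apply_ket₄ {k : L → ℕ} {I : ∀ n, Spinors (Slot (Γ.atNode k n))}
    (hI : ∀ n, I n ∈ invSO4 (Γ.atNode k n)) :
    ContinuousLinearMap.adjoint F (ket₄ Γ k I) = labelKet₃ Γ ⟨k, fun n => piProj (I n),
      fun _ => Submodule.starProjection_apply_mem _ _⟩ :=
  eq_of_inner_labelKet₃ fun x => by
    rw [ContinuousLinearMap.adjoint_inner_right, hF, inner_labelKet₄_ket₄ x hI]

/-- Surjectivity of `f` onto `Kph` at each node suffices, so this holds for all labels. -/
theorem map_span_labelKet₃ (k : L → ℕ) :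
    (Submodule.span ℂ (Set.range fun i : NodeIntertwiners Γ k => labelKet₃ Γ ⟨k, i⟩)).map
      (F : HSO3 Γ →ₗ[ℂ] L2SO4 L) = sectorPh Γ k := by
  rw [sectorPh, Submodule.map_span, ← Set.range_comp]
  refine congrArg (Submodule.span ℂ) ?_
  ext ψ
  constructor
  · rintro ⟨i, rfl⟩
    exact ⟨fun n => fEmb (i.1 n), fun n => fEmb_mem_Kph (mem_invSO3.1 (i.2 n)).1, hF ⟨k, i⟩⟩
  · rintro ⟨I, hI, rfl⟩
    choose i hi hI' using fun n => exists_fEmb_eq (hI n)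
    refine ⟨⟨i, hi⟩, (hF _).trans ?_⟩
    simp only [labelKet₄, hI']

-- At a node with half-integral spin sum the tensor is zero, so the norm of the state, a product
-- over the nodes, vanishes.
omit hF in
theorem sectorPh_eq_bot {k : L → ℕ} (hk : ¬ Γ.Admissible k) : sectorPh Γ k = ⊥ := by
  refine (Submodule.span_eq_bot).2 ?_
  rintro _ ⟨I, hI, rfl⟩
  simp only [FourValentGraph.Admissible, not_forall] at hk
  obtain ⟨n, hn⟩ := hk
  have h0 : I n = 0 := (Submodule.eq_bot_iff _).1 (invSO4_eq_bot hn) _ (Kph_le_invSO4 (hI n))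
  have hs (n) : I n ∈ simpleSpace (Γ.atNode k n) := (mem_invSO4.1 (Kph_le_invSO4 (hI n))).1
  have h := inner_ket₄ hs hs
  rw [Finset.prod_eq_zero (Finset.mem_univ n) (by rw [h0, inner_zero_left])] at h
  exact inner_self_eq_zero.1 h

theorem apply_eq_zero_of_not_admissible {k : L → ℕ} (hk : ¬ Γ.Admissible k) {ψ : HSO3 Γ}
    (hψ : (ψ : L2SO3 L) ∈ sector₃ Γ k) : F ψ = 0 := by
  rw [sector₃_eq] at hψ
  obtain ⟨φ, hφ, h⟩ := hψ
  have h' : φ = ψ := Subtype.ext h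
  subst h'
  have := Submodule.mem_map_of_mem (f := (F : HSO3 Γ →ₗ[ℂ] L2SO4 L)) hφ
  rw [map_span_labelKet₃ hF, sectorPh_eq_bot hk] at this
  exact this

omit hF in
theorem spanAdm_eq_span : spanAdm Γ = Submodule.span ℂ {ψ | ∃ k : {k : L → ℕ // Γ.Admissible k},
    ∃ i : ∀ n, Spinors (Slot (Γ.atNode k.1 n)), (∀ n, i n ∈ invSO3 (Γ.atNode k.1 n)) ∧
      ψ = ket₃ Γ k.1 i} := by
  simp only [spanAdm, sector₃]
  rw [← Submodule.span_iUnion]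
  congr 1
  ext ψ
  simp only [Set.mem_iUnion, Set.mem_ofPred_eq]

/-- A vector in the kernel of `F` is orthogonal to the range of the adjoint, which contains every
admissible spin network because `π` is onto at each node. -/
theorem eq_zero_of_mem_HAdm {ψ : HSO3 Γ} (hψ : (ψ : L2SO3 L) ∈ HAdm Γ) (h0 : F ψ = 0) :
    ψ = 0 := by
  refine Subtype.ext ?_
  rw [HAdm, spanAdm_eq_span] at hψ
  refine eq_zero_of_mem_closure_span hψ ?_
  rintro _ ⟨⟨k, hk⟩, i, hi, rfl⟩
  choose I hI hi' using fun n => exists_piProj_eq (hk n) (hi n)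
  have h1 := ContinuousLinearMap.adjoint_inner_left F ψ (ket₄ Γ k I)
  rw [h0, inner_zero_right, adjoint_apply_ket₄ hF hI] at h1
  have h2 : labelKet₃ Γ ⟨k, fun n => piProj (I n),
      fun _ => Submodule.starProjection_apply_mem _ _⟩ = ⟨ket₃ Γ k i, ket₃_mem Γ k i hi⟩ := by
    apply Subtype.ext
    change ket₃ Γ k (fun n => piProj (I n)) = ket₃ Γ k i
    rw [funext hi']
  rw [h2] at h1
  exact h1

omit hF in
theorem spanPh_eq : spanPh Γ = ⨆ k : {k : L → ℕ // Γ.Admissible k}, sectorPh Γ k.1 := by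
  refine le_antisymm (iSup_le fun k => ?_) (iSup_le fun k => le_iSup (sectorPh Γ) k.1)
  by_cases hk : Γ.Admissible k
  · exact le_iSup (fun k : {k : L → ℕ // Γ.Admissible k} => sectorPh Γ k.1) ⟨k, hk⟩
  · rw [sectorPh_eq_bot hk]; exact bot_le

omit hF in
theorem spanAdm_eq : spanAdm Γ =
    (⨆ k : {k : L → ℕ // Γ.Admissible k}, Submodule.span ℂ
      (Set.range fun i : NodeIntertwiners Γ k.1 => labelKet₃ Γ ⟨k.1, i⟩)).map
      (HSO3 Γ).subtype := by
  rw [Submodule.map_iSup]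
  simp only [spanAdm, sector₃_eq]

omit hF in
theorem spanAdm_le : spanAdm Γ ≤ HSO3 Γ := by
  have h : spanAdm Γ ≤ span₃ Γ := iSup_le fun k => le_iSup (sector₃ Γ) k.1
  exact h.trans (Submodule.le_topologicalClosure (span₃ Γ))

theorem exists_spanAdm_equiv : ∃ Φ : spanAdm Γ ≃ₗ[ℂ] spanPh Γ,
    ∀ (ψ : HSO3 Γ) (h : (ψ : L2SO3 L) ∈ spanAdm Γ), (Φ ⟨ψ, h⟩ : L2SO4 L) = F ψ := by
  have hmap : (⨆ k : {k : L → ℕ // Γ.Admissible k}, Submodule.span ℂ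
      (Set.range fun i : NodeIntertwiners Γ k.1 => labelKet₃ Γ ⟨k.1, i⟩)).map
      (F : HSO3 Γ →ₗ[ℂ] L2SO4 L) = spanPh Γ := by
    rw [Submodule.map_iSup, spanPh_eq]
    simp only [map_span_labelKet₃ hF]
  let φ₀ : spanAdm Γ →ₗ[ℂ] L2SO4 L :=
    (F : HSO3 Γ →ₗ[ℂ] L2SO4 L) ∘ₗ Submodule.inclusion spanAdm_le
  have hφ₀ (ψ : HSO3 Γ) (h : (ψ : L2SO3 L) ∈ spanAdm Γ) : φ₀ ⟨ψ, h⟩ = F ψ := rfl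
  have hmem (ψ : spanAdm Γ) : φ₀ ψ ∈ spanPh Γ := by
    obtain ⟨φ, hφ, h⟩ := le_of_eq spanAdm_eq ψ.2
    rw [← hmap]
    exact ⟨φ, hφ, congrArg F (Subtype.ext h)⟩
  refine ⟨LinearEquiv.ofBijective (LinearMap.codRestrict (spanPh Γ) φ₀ hmem) ⟨?_, ?_⟩,
    fun ψ h => hφ₀ ψ h⟩
  · refine (injective_iff_map_eq_zero _).2 fun ψ hψ => ?_
    have h0 : F (Submodule.inclusion spanAdm_le ψ) = 0 := congrArg Subtype.val hψ
    have h1 := eq_zero_of_mem_HAdm hF (Submodule.le_topologicalClosure _ ψ.2) h0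
    exact Subtype.ext (congrArg (fun z : HSO3 Γ => (z : L2SO3 L)) h1)
  · rintro ⟨χ, hχ⟩
    rw [← hmap] at hχ
    obtain ⟨φ, hφ, rfl⟩ := hχ
    refine ⟨⟨φ, ?_⟩, rfl⟩
    rw [spanAdm_eq]
    exact ⟨φ, hφ, rfl⟩

theorem closure_range_eq :
    (LinearMap.range (F : HSO3 Γ →ₗ[ℂ] L2SO4 L)).topologicalClosure = Hph Γ := by
  have hmap : (Submodule.span ℂ (Set.range (labelKet₃ Γ))).map (F : HSO3 Γ →ₗ[ℂ] L2SO4 L) =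
      spanPh Γ := by
    have h1 : Submodule.span ℂ (Set.range (labelKet₃ Γ)) = ⨆ k, Submodule.span ℂ
        (Set.range fun i : NodeIntertwiners Γ k => labelKet₃ Γ ⟨k, i⟩) := by
      rw [← Submodule.span_iUnion]
      congr 1
      ext ψ
      simp [Set.mem_iUnion]
    rw [h1, Submodule.map_iSup]
    simp only [map_span_labelKet₃ hF, spanPh]
  apply le_antisymm
  · refine Submodule.topologicalClosure_minimal _ ?_ (Submodule.isClosed_topologicalClosure _)
    have h2 := Submodule.topologicalClosure_map F (Submodule.span ℂ (Set.range (labelKet₃ Γ)))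
    rw [topologicalClosure_span_labelKet₃, Submodule.map_top] at h2
    refine h2.trans (le_of_eq ?_)
    exact congrArg Submodule.topologicalClosure hmap
  · refine Submodule.topologicalClosure_mono ?_
    rw [← hmap]
    exact LinearMap.map_le_range

/-- `F` is injective on the sector and maps it onto `sectorPh`. -/
theorem finrank_sector₃ {k : L → ℕ} (hk : Γ.Admissible k) :
    Module.finrank ℂ (sector₃ Γ k) = Module.finrank ℂ (sectorPh Γ k) := by
  set S := Submodule.span ℂ (Set.range fun i : NodeIntertwiners Γ k => labelKet₃ Γ ⟨k, i⟩)
    with hS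
  have e₁ : S ≃ₗ[ℂ] sector₃ Γ k :=
    (Submodule.equivMapOfInjective _ (Submodule.injective_subtype _) S).trans
      (LinearEquiv.ofEq _ _ (sector₃_eq k).symm)
  have hinj : Function.Injective ((F : HSO3 Γ →ₗ[ℂ] L2SO4 L).domRestrict S) := by
    refine (injective_iff_map_eq_zero _).2 fun ψ hψ => Subtype.ext ?_
    refine eq_zero_of_mem_HAdm hF (Submodule.le_topologicalClosure _ ?_) hψ
    have h1 : sector₃ Γ k ≤ spanAdm Γ :=
      le_iSup (fun k : {k : L → ℕ // Γ.Admissible k} => sector₃ Γ k.1) ⟨k, hk⟩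
    refine h1 ?_
    rw [sector₃_eq]
    exact ⟨ψ, ψ.2, rfl⟩
  have e₂ : S ≃ₗ[ℂ] sectorPh Γ k :=
    (LinearEquiv.ofInjective _ hinj).trans (LinearEquiv.ofEq _ _ (by
      rw [LinearMap.range_domRestrict, hS, map_span_labelKet₃ hF]))
  rw [← e₁.finrank_eq, e₂.finrank_eq]

/-! ### Finite-dimensional orthogonal sectors and the unitary map. -/

omit hF in
/-- A space of `L²` functions inside the span of finitely many functions is finite-dimensional. -/
theorem finiteDimensional_span_toLp {Z : Type*} [TopologicalSpace Z] [CompactSpace Z]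
    [MeasurableSpace Z] [BorelSpace Z] [SecondCountableTopologyEither Z ℂ] {μ : Measure Z}
    [IsFiniteMeasure μ] {X : Type*} [Fintype X] (P : X → C(Z, ℂ)) (S : Submodule ℂ (Lp ℂ 2 μ))
    (hS : S ≤ Submodule.span ℂ (Set.range fun x => ContinuousMap.toLp 2 μ ℂ (P x))) :
    FiniteDimensional ℂ S := by
  have : FiniteDimensional ℂ
      (Submodule.span ℂ (Set.range fun x => ContinuousMap.toLp 2 μ ℂ (P x))) :=
    FiniteDimensional.span_of_finite ℂ (Set.finite_range _)
  exact Submodule.finiteDimensional_of_le hS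

omit hF in
theorem smul_toLp_mem_span {Z : Type*} [TopologicalSpace Z] [CompactSpace Z]
    [MeasurableSpace Z] [BorelSpace Z] [SecondCountableTopologyEither Z ℂ] {μ : Measure Z}
    [IsFiniteMeasure μ] {X : Type*} [Fintype X] (P : X → C(Z, ℂ)) (c : ℂ) (T : X → ℂ)
    {Φ : C(Z, ℂ)} (hΦ : ∀ z, Φ z = ∑ x, P x z * T x) :
    c • ContinuousMap.toLp 2 μ ℂ Φ ∈
      Submodule.span ℂ (Set.range fun x => ContinuousMap.toLp 2 μ ℂ (P x)) := by
  have h : Φ = ∑ x, T x • P x := by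
    ext z
    rw [hΦ, ContinuousMap.sum_apply]
    exact Finset.sum_congr rfl fun x _ => mul_comm _ _
  rw [h, map_sum]
  refine Submodule.smul_mem _ _ (Submodule.sum_mem _ fun x _ => ?_)
  rw [map_smul]
  exact Submodule.smul_mem _ _ (Submodule.subset_span ⟨x, rfl⟩)

omit hF in
instance (k : L → ℕ) : FiniteDimensional ℂ (sector₃ Γ k) := by
  refine finiteDimensional_span_toLp
    (fun x : ∀ l, Bool → Bool × Fin (k l) → Fin 2 => (⟨fun g : L → SU2 => ∏ l, piKron
      (fun _ => epsilon * (g l : Matrix (Fin 2) (Fin 2) ℂ)) (x l false) (x l true),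
      continuous_finsetProd _ fun l _ =>
        (continuous_piKron_epsilon _ _).comp (continuous_apply l)⟩ : C(L → SU2, ℂ))) _ ?_
  rw [sector₃, Submodule.span_le]
  rintro _ ⟨i, _, rfl⟩
  exact smul_toLp_mem_span _ _ _ fun g => contraction₃_eq_sum Γ k i g

omit hF in
instance (k : L → ℕ) : FiniteDimensional ℂ (sectorPh Γ k) := by
  refine finiteDimensional_span_toLp
    (fun x : ∀ m : L × Bool, Bool → Fin (k m.1) → Fin 2 => (⟨fun G : L → Spin4 =>
      ∏ m : L × Bool, piKron (fun _ => epsilon * (chiral (G m.1) m.2 : Matrix (Fin 2) (Fin 2) ℂ))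
        (x m false) (x m true),
      continuous_finsetProd _ fun m _ =>
        (continuous_piKron_epsilon _ _).comp (continuous_chiral_apply m)⟩ :
      C(L → Spin4, ℂ))) _ ?_
  rw [sectorPh, Submodule.span_le]
  rintro _ ⟨i, _, rfl⟩
  exact smul_toLp_mem_span _ _ _ fun g => contraction_eq_sum Γ k i g

omit hF in
theorem sector₃_isOrtho {k k' : L → ℕ} (h : k ≠ k') : sector₃ Γ k ⟂ sector₃ Γ k' := by
  refine Submodule.isOrtho_span.2 ?_
  rintro _ ⟨i, hi, rfl⟩ _ ⟨i', hi', rfl⟩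
  exact inner_ket₃_of_ne h (fun n => (mem_invSO3.1 (hi n)).1) fun n => (mem_invSO3.1 (hi' n)).1

omit hF in
theorem sectorPh_isOrtho {k k' : L → ℕ} (h : k ≠ k') : sectorPh Γ k ⟂ sectorPh Γ k' := by
  refine Submodule.isOrtho_span.2 ?_
  rintro _ ⟨i, hi, rfl⟩ _ ⟨i', hi', rfl⟩
  exact inner_ket₄_of_ne h (fun n => (mem_invSO4.1 (Kph_le_invSO4 (hi n))).1)
    fun n => (mem_invSO4.1 (Kph_le_invSO4 (hi' n))).1

/-- `F` enters only through the equality of dimensions; no isometry property of it is used. -/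
theorem exists_unitary : ∃ U : HAdm Γ ≃ₗᵢ[ℂ] Hph Γ, ∀ k : L → ℕ, Γ.Admissible k →
    ∀ ψ : HAdm Γ, (ψ : L2SO3 L) ∈ sector₃ Γ k ↔ (U ψ : L2SO4 L) ∈ sectorPh Γ k := by
  have key : ∃ U : (⨆ k : {k : L → ℕ // Γ.Admissible k}, sector₃ Γ k.1).topologicalClosure ≃ₗᵢ[ℂ]
      (⨆ k : {k : L → ℕ // Γ.Admissible k}, sectorPh Γ k.1).topologicalClosure,
      ∀ (k : {k : L → ℕ // Γ.Admissible k})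
        (ψ : (⨆ k : {k : L → ℕ // Γ.Admissible k}, sector₃ Γ k.1).topologicalClosure),
        (ψ : L2SO3 L) ∈ sector₃ Γ k.1 ↔ (U ψ : L2SO4 L) ∈ sectorPh Γ k.1 :=
    exists_isometry_of_finrank_eq
      (fun k : {k : L → ℕ // Γ.Admissible k} => sector₃ Γ k.1) (fun k => sectorPh Γ k.1)
      (fun k k' h => sector₃_isOrtho fun h' => h (Subtype.ext h'))
      (fun k k' h => sectorPh_isOrtho fun h' => h (Subtype.ext h'))
      fun k => finrank_sector₃ hF k.2
  rw [← spanPh_eq] at key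
  obtain ⟨U, hU⟩ := key
  exact ⟨U, fun k hk ψ => hU ⟨k, hk⟩ ψ⟩

end Embedding

end EPR

end
-- The theorem for a node and for a graph.
theorem mainTheorem2 :
    -- a single node, with spins `j_a = m a / 2`
    (∀ m : Fin 4 → ℕ,
      -- the group average defining `f` is the orthogonal projection to the `SO(4)` invariants
      (∀ i ∈ EPR.invSO3 m, EPR.fEmb i = (EPR.invSO4 m).starProjection i) ∧
      -- `π` and `f` are adjoint to each other
      (∀ i ∈ EPR.invSO3 m, ∀ I ∈ EPR.invSO4 m,
        inner ℂ (EPR.fEmb i) I = inner ℂ i (EPR.piProj I)) ∧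
      -- if `j_1 + j_2 + j_3 + j_4` is an integer, `f` and `π` restrict to isomorphisms
      (Even (∑ a, m a) →
        (∃ Φ : EPR.invSO3 m ≃ₗ[ℂ] EPR.Kph m,
          ∀ i, (Φ i : EPR.Spinors (EPR.Slot m)) = EPR.fEmb (i : EPR.Spinors (EPR.Slot m))) ∧
        (∃ Ψ : EPR.Kph m ≃ₗ[ℂ] EPR.invSO3 m,
          ∀ I, (Ψ I : EPR.Spinors (EPR.Slot m)) = EPR.piProj (I : EPR.Spinors (EPR.Slot m))))) ∧
    -- a whole graph, with link spins `j_l = k l / 2`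
    (∀ (N L : Type*) [Fintype N] [Fintype L] [DecidableEq L] (Γ : EPR.FourValentGraph N L),
      -- `f`, applied at every node, is the average over `SO(4)` at every node
      (∀ (k : L → ℕ) (i : ∀ n, EPR.Spinors (EPR.Slot (Γ.atNode k n))),
        (∀ n, i n ∈ EPR.invSO3 (Γ.atNode k n)) → ∀ G : L → EPR.Spin4,
          EPR.contraction Γ k (fun n => EPR.fEmb (i n)) G =
            ∫ V : N → EPR.Spin4,
              EPR.contraction Γ k i (fun l => V (Γ.source l) * G l * (V (Γ.target l))⁻¹)
              ∂(Measure.pi fun _ : N => EPR.haarSpin4)) ∧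
      (∃ F : EPR.HSO3 Γ →L[ℂ] EPR.L2SO4 L,
        -- `F` and its adjoint are given by `f` and `π` at the nodes
        (∀ (k : L → ℕ) (i : ∀ n, EPR.Spinors (EPR.Slot (Γ.atNode k n)))
          (hi : ∀ n, i n ∈ EPR.invSO3 (Γ.atNode k n)),
          F ⟨EPR.ket₃ Γ k i, EPR.ket₃_mem Γ k i hi⟩ =
            EPR.ket₄ Γ k fun n => EPR.fEmb (i n)) ∧
        (∀ (k : L → ℕ) (I : ∀ n, EPR.Spinors (EPR.Slot (Γ.atNode k n))),
          (∀ n, I n ∈ EPR.invSO4 (Γ.atNode k n)) →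
          ((ContinuousLinearMap.adjoint F (EPR.ket₄ Γ k I) : EPR.HSO3 Γ) : EPR.L2SO3 L) =
            EPR.ket₃ Γ k fun n => EPR.piProj (I n)) ∧
        -- the spin networks with other than admissible spins are mapped to zero
        (∀ k : L → ℕ, ¬ Γ.Admissible k → ∀ ψ : EPR.HSO3 Γ,
          (ψ : EPR.L2SO3 L) ∈ EPR.sector₃ Γ k → F ψ = 0) ∧
        -- isomorphism of the spans of the spin networks
        (∃ Φ : EPR.spanAdm Γ ≃ₗ[ℂ] EPR.spanPh Γ,
          ∀ (ψ : EPR.HSO3 Γ) (h : (ψ : EPR.L2SO3 L) ∈ EPR.spanAdm Γ),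
            (Φ ⟨ψ, h⟩ : EPR.L2SO4 L) = F ψ) ∧
        -- on the Hilbert spaces, `F` is one-to-one with dense image
        (∀ ψ : EPR.HSO3 Γ, (ψ : EPR.L2SO3 L) ∈ EPR.HAdm Γ → F ψ = 0 → ψ = 0) ∧
        (LinearMap.range (F : EPR.HSO3 Γ →ₗ[ℂ] EPR.L2SO4 L)).topologicalClosure = EPR.Hph Γ) ∧
      -- the Hilbert spaces are identified, with `2 j_l` on the one side and `(j_l, j_l)` on the other
      (∃ U : EPR.HAdm Γ ≃ₗᵢ[ℂ] EPR.Hph Γ, ∀ k : L → ℕ, Γ.Admissible k → ∀ ψ : EPR.HAdm Γ,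
        (ψ : EPR.L2SO3 L) ∈ EPR.sector₃ Γ k ↔ (U ψ : EPR.L2SO4 L) ∈ EPR.sectorPh Γ k)) := by
  refine ⟨fun m => ⟨fun i hi => EPR.fEmb_eq_starProjection (EPR.invSO3_le_simpleSpace hi),
    fun i hi I hI => EPR.inner_fEmb_eq_inner_piProj hi hI,
    fun h => ⟨EPR.exists_fEmb_equiv h, EPR.exists_piProj_equiv h⟩⟩, ?_⟩
  intro N L _ _ _ Γ
  obtain ⟨F, hF⟩ := EPR.exists_embedding Γ
  exact ⟨fun k i _ G => EPR.contraction_fEmb Γ k i G,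
    ⟨F, fun k i hi => hF ⟨k, i, hi⟩,
      fun k I hI => congrArg Subtype.val (EPR.adjoint_apply_ket₄ hF hI),
      fun k hk ψ hψ => EPR.apply_eq_zero_of_not_admissible hF hk hψ,
      EPR.exists_spanAdm_equiv hF,
      fun ψ h h0 => EPR.eq_zero_of_mem_HAdm hF h h0,
      EPR.closure_range_eq hF⟩,
    EPR.exists_unitary hF⟩
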